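/- **Standing data.** Let $X$ be an infinite totally disconnected compact metrizable space, $T$ a homeomorphism of $X$, and $\mu$ an ergodic $T$-invariant Borel probability measure on $X$ that is full (nonempty open sets have positive measure). Let $K$ be a field with a positive definite involution ($\sum_i \overline{c_i}c_i=0$ implies that all $c_i=0$). Let $\mathcal A=C_K(X)\rtimes_T\mathbb Z$, the $*$-algebra of finite sums $\sum_k f_kt^k$ with $f_k:X\to K$ locally constant, $tft^{-1}=f\circ T^{-1}$ and $t^*=t^{-1}$. Fix $y\in X$, a decreasing sequence of clopen sets $E_n$ with $\bigcap_nE_n=\{y\}$, and finite partitions $\mathcal P_n$ of $X\setminus E_n$ into clopen sets such that $\mathcal P_{n+1}\cup\{E_{n+1}\}$ refines $\mathcal P_n\cup\{E_n\}$ and $\bigcup_n(\mathcal P_n\cup\{E_n\})$ generates the topology of $X$. Let $\mathcal A_n$ be the unital $*$-subalgebra of $\mathcal A$ generated by the $\chi_Zt$, $Z\in\mathcal P_n$, and $\mathcal A_\infty=\bigcup_n\mathcal A_n$. Let $\mathbb V_n$ be the set of nonempty sets $W=E_n\cap T^{-1}(Z_1)\cap\dots\cap T^{-k+1}(Z_{k-1})\cap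 T^{-k}(E_n)$ with $k\ge1$, $Z_i\in\mathcal P_n$; put $|W|=k$, $e_{ij}(W)=(\chi_{X\setminus E_n}t)^i\chi_W(t^{-1}\chi_{X\setminus E_n})^j$ for $0\le i,j<|W|$, and $h_W=\sum_ie_{ii}(W)$. Let $\mathfrak R_n=\prod_{W\in\mathbb V_n}M_{|W|}(K)$ with the $*$-transpose involution, and let $\pi_n:\mathcal A_n\to\mathfrak R_n$, $\pi_n(a)=(h_Wa)_W$, where $h_W\mathcal A_n$ is identified with $M_{|W|}(K)$ through the matrix units $e_{ij}(W)$. Let $\mathfrak R_n\to\mathfrak R_{n+1}$ be the block diagonal embedding: for $W'\in\mathbb V_{n+1}$ the sequence $W',T(W'),\dots,T^{|W'|-1}(W')$ is cut into consecutive blocks, each of the form $T^i(W'),\dots,T^{i+|W|-1}(W')$ with $W\in\mathbb V_n$ and $T^i(W')\subseteq W$, and $(M_W)_W$ is sent to the element whose $W'$-component is the block diagonal matrix with the corresponding blocks $M_W$. Let $\mathfrak R_\infty=\varinjlim\mathfrak R_n$, with the rank function $\mathrm{rk}_\infty$ induced by $\mathrm{rk}_n(M)=\sum_{W\in\mathbb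 V_n}\mu(W)\,\mathrm{Rk}(M_W)$, and let $\mathfrak R_{\mathrm{rk}}$ be the completion of $\mathfrak R_\infty$ for the metric $\mathrm{rk}_\infty(x-z)$. Then $\mathcal A$ embeds in $\mathfrak R_{\mathrm{rk}}$ by a unique injective $*$-homomorphism that restricts to $\pi_n$ on each $\mathcal A_n$ and sends $t$ to $\lim_n\pi_n(\chi_{X\setminus E_n}t)$. The $*$-regular closure of a subset of a $*$-regular ring is the smallest unital $*$-regular subring containing it. Let $\mathcal R_n$, $\mathcal R_\infty$, $\mathcal R_{\mathcal A}$ be the $*$-regular closures of $\mathcal A_n$, $\mathcal A_\infty$, $\mathcal A$ in $\mathfrak R_n$, $\mathfrak R_\infty$, $\mathfrak R_{\mathrm{rk}}$ respectively; all of these are regarded as subsets of $\mathfrak R_{\mathrm{rk}}$. **Proposition.** Suppose that $y$ is a periodic point of $T$ with (minimal) period $l\ge1$. Let $I$ be the ideal of $\mathcal A$ generated by the $\chi_V$ with $V\subseteq X\setminus\{y,Ty,\dots,T^{l-1}y\}$ clopen. Then $I\subseteq\mathcal A_\infty$, and there is an $M$ such that for every $n\ge M$ there is exactly one $W_n\in\mathbb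 V_n$ of length $l$ containing $y$. Let $M$ be any number with this property, and let $\widetilde I$ be the ideal of $\mathcal R_\infty$ generated by $I$. (i) $\widetilde I=\bigcup_{n\ge M}(1-h_{W_n})\mathcal R_n$, and there is a $*$-isomorphism $\mathcal R_\infty/\widetilde I\cong M_l(K)$ of $K$-algebras. (ii) Let $\mathcal R$ be the $*$-subalgebra of $\mathcal R_{\mathcal A}$ generated by $\widetilde I$, $h_{W_M}\mathcal A_M$ and $K[t,t^{-1}]$. Then $\mathcal A\subseteq\mathcal R$, $\widetilde I$ is an ideal of $\mathcal R$, and there is a $*$-isomorphism $\mathcal R/\widetilde I\cong M_l(K[t^l,t^{-l}])$ of $K$-algebras, where $K[t^l,t^{-l}]\subseteq\mathcal A$ carries the involution of $\mathcal A$ and matrices the $*$-transpose. -/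

import Mathlib

open Filter Topology MeasureTheory

set_option linter.unusedSectionVars false

namespace CrossedApprox

noncomputable section

/-! ### The crossed product `C_K(X) ⋊_T ℤ` -/

/-- The algebra `C_K(X)` of locally constant functions `X → K`. The homeomorphism `T` is only
recorded in order to equip it with the action `n • f = f ∘ T⁻ⁿ` of `ℤ`. -/
def CK {X : Type*} [TopologicalSpace X] (_T : X ≃ₜ X) (K : Type*) : Type _ := LocallyConstant X K

section CrossedProduct

variable {X : Type*} [TopologicalSpace X] (T : X ≃ₜ X) (K : Type*) [Field K]

instance : CommRing (CK T K) := inferInstanceAs (CommRing (LocallyConstant X K))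

instance : Algebra K (CK T K) := inferInstanceAs (Algebra K (LocallyConstant X K))

instance : FunLike (CK T K) X K := inferInstanceAs (FunLike (LocallyConstant X K) X K)

variable {T K}

@[ext] theorem CK.ext {f g : CK T K} (h : ∀ x, f x = g x) : f = g := LocallyConstant.ext h

@[simp] theorem CK.add_apply (f g : CK T K) (x : X) : (f + g) x = f x + g x := rfl

@[simp] theorem CK.mul_apply (f g : CK T K) (x : X) : (f * g) x = f x * g x := rfl

@[simp] theorem CK.zero_apply (x : X) : (0 : CK T K) x = 0 := rfl

@[simp] theorem CK.one_apply (x : X) : (1 : CK T K) x = 1 := rfl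

@[simp] theorem CK.smul_apply (c : K) (f : CK T K) (x : X) : (c • f) x = c * f x := rfl

/-- The action of `ℤ` on `C_K(X)`: `n • f = f ∘ T⁻ⁿ`. -/
instance : MulSemiringAction (Multiplicative ℤ) (CK T K) where
  smul n f := LocallyConstant.comap
    (⟨fun x => (T ^ (-(Multiplicative.toAdd n))) x, (T ^ (-(Multiplicative.toAdd n))).continuous⟩ :
      C(X, X)) f
  one_smul f := by ext x; rfl
  mul_smul m n f := by
    ext x
    change f ((T ^ (-(Multiplicative.toAdd (m * n)))) x) =
      f ((T ^ (-(Multiplicative.toAdd n))) ((T ^ (-(Multiplicative.toAdd m))) x))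
    rw [toAdd_mul, neg_add_rev, zpow_add]; rfl
  smul_zero n := by ext x; rfl
  smul_add n f g := by ext x; rfl
  smul_one n := by ext x; rfl
  smul_mul n f g := by ext x; rfl

theorem CK.act_apply (n : Multiplicative ℤ) (f : CK T K) (x : X) :
    (n • f) x = f ((T ^ (-(Multiplicative.toAdd n))) x) := rfl

instance : SMulCommClass (Multiplicative ℤ) K (CK T K) where
  smul_comm n c f := by ext x; rfl

variable [StarRing K]

instance : StarRing (CK T K) where
  star f := LocallyConstant.map star f
  star_involutive f := by ext x; exact star_star (f x)
  star_mul f g := by ext x; exact star_mul (f x) (g x)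
  star_add f g := by ext x; exact star_add (f x) (g x)

@[simp] theorem CK.star_apply (f : CK T K) (x : X) : (star f) x = star (f x) := rfl

instance : StarModule K (CK T K) where
  star_smul c f := by ext x; simp

theorem CK.star_act (n : Multiplicative ℤ) (f : CK T K) : star (n • f) = n • star f := rfl

variable (T K) in
/-- The crossed product `A = C_K(X) ⋊_T ℤ`: finite sums `∑ f_k t^k` with
`(f t^k) (g t^m) = f (g ∘ T⁻ᵏ) t^{k+m}`. The coefficient `f_k` of `a` is
`a.coeff (Multiplicative.ofAdd k)`. -/
abbrev Crossed : Type _ := SkewMonoidAlgebra (CK T K) (Multiplicative ℤ)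

namespace Crossed

/-- The involution of the crossed product, `(f t^k)^* = t^{-k} f^*`. -/
def starFun (a : Crossed T K) : Crossed T K :=
  a.sum fun g f => SkewMonoidAlgebra.single g⁻¹ (g⁻¹ • star f)

theorem starFun_single (g : Multiplicative ℤ) (f : CK T K) :
    starFun (SkewMonoidAlgebra.single g f : Crossed T K) =
      SkewMonoidAlgebra.single g⁻¹ (g⁻¹ • star f) :=
  SkewMonoidAlgebra.sum_single_index (by simp)

theorem starFun_add (a b : Crossed T K) : starFun (a + b) = starFun a + starFun b :=
  SkewMonoidAlgebra.sum_add_index' (by simp) (by simp [smul_add, SkewMonoidAlgebra.single_add])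

instance : StarRing (Crossed T K) where
  star := starFun
  star_add := starFun_add
  star_involutive a := by
    induction a using SkewMonoidAlgebra.induction_on' with
    | single g f =>
      rw [starFun_single, starFun_single, CK.star_act, smul_smul]
      simp
    | add a b ha hb => rw [starFun_add, starFun_add, ha, hb]
  star_mul a b := by
    change starFun (a * b) = starFun b * starFun a
    induction a using SkewMonoidAlgebra.induction_on' with
    | single g f =>
      induction b using SkewMonoidAlgebra.induction_on' with
      | single h k =>
        simp only [starFun_single, SkewMonoidAlgebra.single_mul_single, star_mul, CK.star_act,
          smul_mul', smul_smul, mul_inv_rev]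
        simp
      | add a b ha hb => rw [mul_add, starFun_add, starFun_add, ha, hb, add_mul]
    | add a b ha hb => rw [add_mul, starFun_add, starFun_add, ha, hb, mul_add]

theorem star_single (g : Multiplicative ℤ) (f : CK T K) :
    star (SkewMonoidAlgebra.single g f : Crossed T K) =
      SkewMonoidAlgebra.single g⁻¹ (g⁻¹ • star f) := starFun_single g f

instance : StarModule K (Crossed T K) where
  star_smul c a := by
    induction a using SkewMonoidAlgebra.induction_on' with
    | single g f =>
      rw [SkewMonoidAlgebra.smul_single, star_single, star_single, star_smul,
        SkewMonoidAlgebra.smul_single, smul_comm]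
    | add a b ha hb => rw [smul_add, star_add, star_add, ha, hb, smul_add]

variable (T K) in
/-- The canonical unitary `t`. -/
def t : Crossed T K := SkewMonoidAlgebra.single (Multiplicative.ofAdd 1) 1

variable (T K) in
/-- The inverse `t⁻¹` of the canonical unitary. -/
def tInv : Crossed T K := SkewMonoidAlgebra.single (Multiplicative.ofAdd (-1)) 1

/-- The copy of `C_K(X)` in the crossed product. -/
def C (f : CK T K) : Crossed T K := SkewMonoidAlgebra.single 1 f

variable (T K) in
/-- The characteristic function `χ_U`, as an element of `C_K(X)`. -/
def chi {U : Set X} (hU : IsClopen U) : CK T K := LocallyConstant.charFn K hU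

theorem t_mul_tInv : t T K * tInv T K = 1 := by
  simp [t, tInv, SkewMonoidAlgebra.single_mul_single]

theorem tInv_mul_t : tInv T K * t T K = 1 := by
  simp [t, tInv, SkewMonoidAlgebra.single_mul_single]

theorem star_t : star (t T K) = tInv T K := by
  rw [t, star_single, star_one, smul_one]; rfl

theorem t_mul_C (f : CK T K) :
    t T K * C f = C (Multiplicative.ofAdd (1 : ℤ) • f) * t T K := by
  simp [t, C, SkewMonoidAlgebra.single_mul_single]

end Crossed

variable (T K) in
/-- `C_{c,K}(U)`: the ideal of `C_K(X)` generated by the `χ_V` with `V ⊆ U` clopen. -/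
def Cc (U : Set X) : Ideal (CK T K) :=
  Ideal.span {f | ∃ (V : Set X) (hV : IsClopen V), V ⊆ U ∧ f = Crossed.chi T K hV}

end CrossedProduct

/-! ### `*`-regular closures -/

/-- The `*`-regular closure of `s` in a `*`-regular `K`-algebra `R`: the smallest unital
`*`-subalgebra of `R` that contains `s` and is von Neumann regular (properness of the involution is
inherited from `R`). It is applied to sets `s` that contain the scalars `K ⬝ 1`, for which subrings
containing `s` and subalgebras containing `s` are the same thing. -/
def starRegularClosure (K : Type*) {R : Type*} [Field K] [StarRing K] [Ring R] [StarRing R]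
    [Algebra K R] [StarModule K R] (s : Set R) : StarSubalgebra K R :=
  sInf {B | s ⊆ (B : Set R) ∧ ∀ x ∈ B, ∃ z ∈ B, x * z * x = x}

/-! ### Matrix ranks -/

theorem rank_add_le {K ι : Type*} [Field K] [Fintype ι] (A B : Matrix ι ι K) :
    (A + B).rank ≤ A.rank + B.rank := by
  unfold Matrix.rank
  rw [Matrix.mulVecLin_add]
  exact (Submodule.finrank_mono (LinearMap.range_add_le _ _)).trans
    (Submodule.finrank_add_le_finrank_add_finrank _ _)

theorem rank_map_star {K ι : Type*} [Field K] [StarRing K] [Fintype ι] (A : Matrix ι ι K) :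
    (A.map star).rank = A.rank := by
  have hA : ∀ (B : Matrix ι ι K) (v : ι → K), star (B.mulVec v) = (B.map star).mulVec (star v) := by
    intro B v
    ext i
    simp [Matrix.mulVec, dotProduct]
  have hmem : ∀ (B : Matrix ι ι K), ∀ x ∈ LinearMap.range B.mulVecLin,
      star x ∈ LinearMap.range (B.map star).mulVecLin := by
    rintro B _ ⟨v, rfl⟩
    exact ⟨star v, (hA B v).symm⟩
  have hmem' : ∀ x ∈ LinearMap.range (A.map star).mulVecLin,
      star x ∈ LinearMap.range A.mulVecLin := by
    intro x hx
    have := hmem _ x hx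
    rwa [show (A.map star).map star = A by ext i k; simp] at this
  let e : LinearMap.range A.mulVecLin ≃+ LinearMap.range (A.map star).mulVecLin :=
    { toFun := fun x => ⟨star x.1, hmem A _ x.2⟩
      invFun := fun x => ⟨star x.1, hmem' _ x.2⟩
      left_inv := fun x => Subtype.ext (star_star x.1)
      right_inv := fun x => Subtype.ext (star_star x.1)
      map_add' := fun x z => Subtype.ext (star_add x.1 z.1) }
  have := rank_eq_of_equiv_equiv (star : K → K) e star_involutive.bijective fun r x =>
    Subtype.ext (by simp [e])
  unfold Matrix.rank Module.finrank
  rw [this]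

theorem rank_star {K ι : Type*} [Field K] [StarRing K] [Fintype ι] (A : Matrix ι ι K) :
    (star A).rank = A.rank := by
  rw [show star A = (A.map star).transpose from rfl, Matrix.rank_transpose, rank_map_star]

theorem rank_smul_le {K ι : Type*} [Field K] [Fintype ι] [DecidableEq ι] (c : K)
    (A : Matrix ι ι K) : (c • A).rank ≤ A.rank := by
  rw [show c • A = A * c • (1 : Matrix ι ι K) by rw [Matrix.mul_smul, mul_one]]
  exact Matrix.rank_mul_le_left _ _

/-! ### The standing data -/

/-- The standing data: a homeomorphism `T` of `X`, a full ergodic `T`-invariant probability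
measure `μ`, a point `y`, and a sequence `(E n, P n)` where the clopen sets `E n` decrease to `{y}`,
`P n` is a finite partition of `X \ E n` into clopen sets, the partitions `P n ∪ {E n}` become finer,
and together they generate the topology of `X`. -/
structure ApproxSystem (X : Type*) [τ : TopologicalSpace X] [MeasurableSpace X] where
  T : X ≃ₜ X
  μ : Measure X
  isProbabilityMeasure : IsProbabilityMeasure μ
  ergodic : Ergodic T μ
  full : ∀ U : Set X, IsOpen U → U.Nonempty → 0 < μ U
  y : X
  E : ℕ → Set X
  P : ℕ → Set (Set X)
  isClopen_E : ∀ n, IsClopen (E n)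
  E_succ_subset : ∀ n, E (n + 1) ⊆ E n
  iInter_E : ⋂ n, E n = {y}
  finite_P : ∀ n, (P n).Finite
  isClopen_P : ∀ n, ∀ Z ∈ P n, IsClopen Z
  nonempty_P : ∀ n, ∀ Z ∈ P n, Z.Nonempty
  disjoint_P : ∀ n, (P n).PairwiseDisjoint id
  sUnion_P : ∀ n, ⋃₀ P n = (E n)ᶜ
  finer : ∀ n, ∀ Z ∈ insert (E (n + 1)) (P (n + 1)), ∃ Z₀ ∈ insert (E n) (P n), Z ⊆ Z₀
  generates : τ = TopologicalSpace.generateFrom (⋃ n, insert (E n) (P n))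

namespace ApproxSystem

variable {X : Type*} [TopologicalSpace X] [MeasurableSpace X] (S : ApproxSystem X)

theorem E_anti : Antitone S.E := antitone_nat_of_succ_le S.E_succ_subset

theorem finer_of_le {m n : ℕ} (h : m ≤ n) :
    ∀ Z ∈ insert (S.E n) (S.P n), ∃ Z₀ ∈ insert (S.E m) (S.P m), Z ⊆ Z₀ := by
  induction n, h using Nat.le_induction with
  | base => exact fun Z hZ => ⟨Z, hZ, subset_rfl⟩
  | succ n _ ih =>
    intro Z hZ
    obtain ⟨Z₁, hZ₁, h₁⟩ := S.finer n Z hZ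
    obtain ⟨Z₂, hZ₂, h₂⟩ := ih Z₁ hZ₁
    exact ⟨Z₂, hZ₂, h₁.trans h₂⟩

theorem notMem_E {n : ℕ} {Z : Set X} (hZ : Z ∈ S.P n) {x : X} (hx : x ∈ Z) : x ∉ S.E n := by
  have : x ∈ ⋃₀ S.P n := ⟨Z, hZ, hx⟩
  rwa [S.sUnion_P] at this

theorem atom_eq {n : ℕ} {A B : Set X} (hA : A ∈ insert (S.E n) (S.P n))
    (hB : B ∈ insert (S.E n) (S.P n)) {x : X} (hxA : x ∈ A) (hxB : x ∈ B) : A = B := by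
  rcases hA with rfl | hA <;> rcases hB with rfl | hB
  · rfl
  · exact absurd hxA (S.notMem_E hB hxB)
  · exact absurd hxB (S.notMem_E hA hxA)
  · by_contra hne
    exact Set.disjoint_left.1 (S.disjoint_P n hA hB hne) hxA hxB

/-- The family `𝕍_n` of nonempty sets
`W = E_n ∩ T⁻¹(Z_1) ∩ ⋯ ∩ T^{-k+1}(Z_{k-1}) ∩ T^{-k}(E_n)` with `k ≥ 1` and `Z_i ∈ P_n`; here
`base = W` and `len = |W| = k`. -/
@[ext] structure Tower (n : ℕ) where
  base : Set X
  len : ℕ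
  len_pos : 0 < len
  nonempty : base.Nonempty
  exists_word : ∃ Z : ℕ → Set X, (∀ i, 0 < i → i < len → Z i ∈ S.P n) ∧
    base = {x | x ∈ S.E n ∧ (∀ i : ℕ, 0 < i → i < len → (S.T ^ (i : ℤ)) x ∈ Z i) ∧
      (S.T ^ (len : ℤ)) x ∈ S.E n}

namespace Tower

variable {S} {n m k : ℕ}

theorem isClopen (W : S.Tower n) : IsClopen W.base := by
  obtain ⟨Z, hZ, h⟩ := W.exists_word
  have : W.base = S.E n ∩
      ((⋂ i ∈ Finset.Ioo 0 W.len, (S.T ^ ((i : ℕ) : ℤ)) ⁻¹' (Z i)) ∩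
        (S.T ^ (W.len : ℤ)) ⁻¹' S.E n) := by
    rw [h]; ext x; simp [and_left_comm, and_assoc]
  rw [this]
  refine (S.isClopen_E n).inter (IsClopen.inter ?_ ((S.isClopen_E n).preimage
    (S.T ^ (W.len : ℤ)).continuous))
  refine isClopen_biInter_finset fun i hi => ?_
  rw [Finset.mem_Ioo] at hi
  exact (S.isClopen_P n _ (hZ i hi.1 hi.2)).preimage (S.T ^ (i : ℤ)).continuous

theorem base_subset (W : S.Tower n) {x : X} (hx : x ∈ W.base) : x ∈ S.E n := by
  obtain ⟨Z, -, h⟩ := W.exists_word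
  rw [h] at hx; exact hx.1

theorem return_mem (W : S.Tower n) {x : X} (hx : x ∈ W.base) :
    (S.T ^ (W.len : ℤ)) x ∈ S.E n := by
  obtain ⟨Z, -, h⟩ := W.exists_word
  rw [h] at hx; exact hx.2.2

theorem notMem_of_lt (W : S.Tower n) {x : X} (hx : x ∈ W.base) {i : ℤ} (h0 : 0 < i)
    (h1 : i < W.len) : (S.T ^ i) x ∉ S.E n := by
  obtain ⟨Z, hZ, h⟩ := W.exists_word
  rw [h] at hx
  lift i to ℕ using h0.le
  exact S.notMem_E (hZ i (by omega) (by omega)) (hx.2.1 i (by omega) (by omega))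

/-- Two points of `W` have the same itinerary up to time `|W|`. -/
theorem same_atom (W : S.Tower n) {x z : X} (hx : x ∈ W.base) (hz : z ∈ W.base) {i : ℕ}
    (hi : i ≤ W.len) :
    ∃ A ∈ insert (S.E n) (S.P n), (S.T ^ (i : ℤ)) x ∈ A ∧ (S.T ^ (i : ℤ)) z ∈ A := by
  obtain ⟨Z, hZ, h⟩ := W.exists_word
  rw [h] at hx hz
  rcases Nat.eq_zero_or_pos i with rfl | h0
  · exact ⟨_, Set.mem_insert _ _, hx.1, hz.1⟩
  · rcases hi.lt_or_eq with h1 | rfl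
    · exact ⟨Z i, Set.mem_insert_of_mem _ (hZ i h0 h1), hx.2.1 i h0 h1, hz.2.1 i h0 h1⟩
    · exact ⟨_, Set.mem_insert _ _, hx.2.2, hz.2.2⟩

theorem mem_atom_of_mem (h : m ≤ n) (W : S.Tower n) {x z : X} (hx : x ∈ W.base)
    (hz : z ∈ W.base) {i : ℕ} (hi : i ≤ W.len) {A : Set X} (hA : A ∈ insert (S.E m) (S.P m))
    (hxA : (S.T ^ (i : ℤ)) x ∈ A) : (S.T ^ (i : ℤ)) z ∈ A := by
  obtain ⟨B, hB, hxB, hzB⟩ := W.same_atom hx hz hi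
  obtain ⟨A', hA', hBA⟩ := S.finer_of_le h B hB
  rw [S.atom_eq hA hA' hxA (hBA hxB)]
  exact hBA hzB

theorem eq_of_mem {W W' : S.Tower n} {x : X} (hx : x ∈ W.base) (hx' : x ∈ W'.base) : W = W' := by
  have hl : W.len = W'.len := by
    rcases lt_trichotomy W.len W'.len with h | h | h
    · exact absurd (W.return_mem hx)
        (W'.notMem_of_lt hx' (by exact_mod_cast W.len_pos) (by exact_mod_cast h))
    · exact h
    · exact absurd (W'.return_mem hx')
        (W.notMem_of_lt hx (by exact_mod_cast W'.len_pos) (by exact_mod_cast h))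
  have key : ∀ {W W' : S.Tower n}, W.len = W'.len → x ∈ W.base → x ∈ W'.base →
      W.base ⊆ W'.base := by
    intro W W' hl hx hx' z hz
    obtain ⟨Z', hZ', h'⟩ := W'.exists_word
    rw [h'] at hx' ⊢
    refine ⟨W.base_subset hz, fun i h0 h1 => ?_, hl ▸ W.return_mem hz⟩
    exact W.mem_atom_of_mem le_rfl hx hz (hl ▸ h1.le)
      (Set.mem_insert_of_mem _ (hZ' i h0 h1)) (hx'.2.1 i h0 h1)
  exact Tower.ext ((key hl hx hx').antisymm (key hl.symm hx' hx)) hl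

/-- `Sub W p W' a` says that level `a` of the tower over `W'` is contained in level `p` of the tower
over `W`, i.e. `T^{a-p}(W') ⊆ W`. -/
def Sub (W : S.Tower m) (p : ℕ) (W' : S.Tower n) (a : ℕ) : Prop :=
  ∀ x ∈ W'.base, (S.T ^ ((a : ℤ) - p)) x ∈ W.base

theorem zpow_zpow (i j : ℤ) (x : X) : (S.T ^ i) ((S.T ^ j) x) = (S.T ^ (i + j)) x := by
  rw [zpow_add]; rfl

theorem Sub.trans {W : S.Tower m} {W' : S.Tower n} {W'' : S.Tower k} {p a c : ℕ}
    (h : Sub W p W' a) (h' : Sub W' a W'' c) : Sub W p W'' c := by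
  intro x hx
  have := h _ (h' x hx)
  rwa [zpow_zpow, show (a : ℤ) - p + (c - a) = c - p by ring] at this

theorem Sub.refl (W : S.Tower n) (p : ℕ) : Sub W p W p := fun x hx => by simpa using hx

theorem Sub.shift {W : S.Tower m} {W' : S.Tower n} {p q a b : ℕ} (h : Sub W p W' a)
    (e : a + q = b + p) : Sub W q W' b := fun x hx => by
  rw [show (b : ℤ) - q = a - p by omega]; exact h x hx

theorem Sub.unique {W W₂ : S.Tower m} {W' : S.Tower n} {p p₂ a : ℕ} (hp : p < W.len)
    (hp₂ : p₂ < W₂.len) (h : Sub W p W' a) (h₂ : Sub W₂ p₂ W' a) : W = W₂ ∧ p = p₂ := by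
  obtain ⟨x, hx⟩ := W'.nonempty
  have key : ∀ {W W₂ : S.Tower m} {p p₂ : ℕ}, p₂ < W₂.len → Sub W p W' a → Sub W₂ p₂ W' a →
      ¬ p < p₂ := by
    intro W W₂ p p₂ hp₂ h h₂ hlt
    refine W₂.notMem_of_lt (h₂ x hx) (i := (p₂ : ℤ) - p) (by omega) (by omega) ?_
    rw [zpow_zpow, show (p₂ : ℤ) - p + (a - p₂) = a - p by ring]
    exact W.base_subset (h x hx)
  have hpp : p = p₂ := le_antisymm (not_lt.1 (key hp h₂ h)) (not_lt.1 (key hp₂ h h₂))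
  subst hpp
  exact ⟨eq_of_mem (h x hx) (h₂ x hx), rfl⟩

theorem Sub.nested (hmn : m ≤ n) {W : S.Tower m} {W' : S.Tower n} {p q a : ℕ} (hp : p < W.len)
    (hq : q < W.len) (ha : a < W'.len) (h : Sub W p W' a) : p ≤ a ∧ a - p + q < W'.len := by
  obtain ⟨x, hx⟩ := W'.nonempty
  have h1 : p ≤ a := by
    by_contra hlt
    refine W.notMem_of_lt (h x hx) (i := (p : ℤ) - a) (by omega) (by omega) ?_
    rw [zpow_zpow, show (p : ℤ) - a + (a - p) = 0 by ring]
    exact S.E_anti hmn (W'.base_subset hx)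
  refine ⟨h1, ?_⟩
  by_contra hlt
  refine W.notMem_of_lt (h x hx) (i := (W'.len : ℤ) - (a - p)) (by omega) (by omega) ?_
  rw [zpow_zpow, show (W'.len : ℤ) - (a - p) + (a - p) = W'.len by ring]
  exact S.E_anti hmn (W'.return_mem hx)

theorem exists_sub (hmn : m ≤ n) (W' : S.Tower n) (a : Fin W'.len) :
    ∃ w : (Σ W : S.Tower m, Fin W.len), Sub w.1 w.2 W' a := by
  classical
  obtain ⟨x, hx⟩ := W'.nonempty
  let Q : ℕ → Prop := fun i => (S.T ^ (i : ℤ)) x ∈ S.E m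
  have hQ0 : Q 0 := by simpa [Q] using S.E_anti hmn (W'.base_subset hx)
  set i := Nat.findGreatest Q a with hi
  have hQi : Q i := Nat.findGreatest_spec (Nat.zero_le _) hQ0
  have hia : i ≤ a := Nat.findGreatest_le _
  have hal := a.2
  have hex : ∃ k, 0 < k ∧ Q (i + k) := ⟨W'.len - i, by omega, by
    have := S.E_anti hmn (W'.return_mem hx)
    simpa [Q, Nat.add_sub_cancel' (show i ≤ W'.len by omega)] using this⟩
  set k := Nat.find hex with hk
  obtain ⟨hk0, hQk⟩ := Nat.find_spec hex
  have hmin : ∀ s, 0 < s → s < k → ¬ Q (i + s) := fun s h0 h1 h2 => Nat.find_min hex h1 ⟨h0, h2⟩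
  have hik : (a : ℕ) < i + k := by
    by_contra hle
    exact Nat.findGreatest_is_greatest (P := Q) (show i < i + k by omega) (by omega) hQk
  have hkl : i + k ≤ W'.len := by
    have := Nat.find_min' hex (m := W'.len - i) ⟨by omega, by
      have := S.E_anti hmn (W'.return_mem hx)
      simpa [Q, Nat.add_sub_cancel' (show i ≤ W'.len by omega)] using this⟩
    omega
  have hZ : ∀ s, 0 < s → s < k → ∃ Z ∈ S.P m, (S.T ^ ((i + s : ℕ) : ℤ)) x ∈ Z := by
    intro s h0 h1
    have : (S.T ^ ((i + s : ℕ) : ℤ)) x ∈ ⋃₀ S.P m := by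
      rw [S.sUnion_P]; exact hmin s h0 h1
    exact this
  choose! Z hZP hZx using hZ
  have hshift : ∀ (z : X) (s : ℕ),
      (S.T ^ (s : ℤ)) ((S.T ^ (i : ℤ)) z) = (S.T ^ ((i + s : ℕ) : ℤ)) z := by
    intro z s
    rw [zpow_zpow, show (s : ℤ) + i = ((i + s : ℕ) : ℤ) by push_cast; ring]
  have hmem : ∀ z ∈ W'.base, (S.T ^ (i : ℤ)) z ∈
      {x | x ∈ S.E m ∧ (∀ s : ℕ, 0 < s → s < k → (S.T ^ (s : ℤ)) x ∈ Z s) ∧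
        (S.T ^ (k : ℤ)) x ∈ S.E m} := by
    intro z hz
    refine ⟨W'.mem_atom_of_mem hmn hx hz (by omega) (Set.mem_insert _ _) hQi,
      fun s h0 h1 => ?_, ?_⟩
    · rw [hshift]
      exact W'.mem_atom_of_mem hmn hx hz (by omega) (Set.mem_insert_of_mem _ (hZP s h0 h1))
        (hZx s h0 h1)
    · rw [hshift]
      exact W'.mem_atom_of_mem hmn hx hz hkl (Set.mem_insert _ _) hQk
  refine ⟨⟨⟨_, k, hk0, ⟨_, hmem x hx⟩, Z, hZP, rfl⟩, ⟨a - i, by simp only; omega⟩⟩, fun z hz => ?_⟩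
  have := hmem z hz
  rwa [show (i : ℤ) = (a : ℕ) - ((a - i : ℕ) : ℤ) by omega] at this

/-- For `m ≤ n`: the level of a tower over some `W ∈ 𝕍_m` which contains the given level of a tower
over an element of `𝕍_n`. -/
def block (hmn : m ≤ n) (W' : S.Tower n) (a : Fin W'.len) : Σ W : S.Tower m, Fin W.len :=
  (exists_sub hmn W' a).choose

theorem block_sub (hmn : m ≤ n) (W' : S.Tower n) (a : Fin W'.len) :
    Sub (block hmn W' a).1 (block hmn W' a).2 W' a := (exists_sub hmn W' a).choose_spec

theorem block_eq (hmn : m ≤ n) {W' : S.Tower n} {a : Fin W'.len} {W : S.Tower m} {p : ℕ}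
    (hp : p < W.len) (h : Sub W p W' a) : block hmn W' a = ⟨W, p, hp⟩ := by
  have hs := block_sub hmn W' a
  generalize block hmn W' a = w at hs
  obtain ⟨W₂, p₂, hp₂⟩ := w
  obtain ⟨rfl, rfl⟩ := hs.unique hp₂ hp h
  rfl

end Tower

/-! ### The algebras `𝕽_n`, their rank functions and the transition maps -/

section Algebras

variable (K : Type*) [Field K] [StarRing K]

/-- `𝕽_n = ∏_{W ∈ 𝕍_n} M_{|W|}(K)`, with the `*`-transpose involution in each factor. -/
abbrev Rn (n : ℕ) : Type _ := ∀ W : S.Tower n, Matrix (Fin W.len) (Fin W.len) K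

variable {S K} {m n k : ℕ}

/-- The entry of the block-diagonal matrix in row `a` and column `b`, where row `a` belongs to a
block `M_W` and is row `p` of that block: it is the `(p, p + b - a)` entry of `M_W` if
`0 ≤ p + b - a < |W|`, and `0` otherwise. -/
def jEntry (M : S.Rn K m) (w : Σ W : S.Tower m, Fin W.len) (a b : ℕ) : K :=
  if hb : a ≤ w.2 + b ∧ (w.2 : ℕ) + b - a < w.1.len then M w.1 w.2 ⟨w.2 + b - a, hb.2⟩ else 0

/-- For `W' ∈ 𝕍_n` the tower over `W'` is cut into consecutive blocks, each contained in the tower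
over some `W ∈ 𝕍_m`, according to the visits to `E_m`; `j` puts the matrices `M_W` on these diagonal
blocks. -/
def jFun (h : m ≤ n) (M : S.Rn K m) : S.Rn K n := fun W' a b =>
  jEntry M (Tower.block h W' a) a b

theorem jFun_of_sub (h : m ≤ n) (M : S.Rn K m) {W' : S.Tower n} {a b : Fin W'.len}
    {W : S.Tower m} {p q : Fin W.len} (hs : Tower.Sub W p W' a) (e : (a : ℕ) + q = b + p) :
    jFun h M W' a b = M W p q := by
  rw [jFun, Tower.block_eq h p.2 hs, jEntry]
  have : (a : ℕ) ≤ p + b ∧ (p : ℕ) + b - a < W.len := by omega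
  rw [dif_pos this]
  congr
  simp only
  omega

theorem jFun_eq_zero (h : m ≤ n) (M : S.Rn K m) {W' : S.Tower n} {a b : Fin W'.len}
    {W : S.Tower m} {p : Fin W.len} (hs : Tower.Sub W p W' a)
    (hn : ∀ q : Fin W.len, (a : ℕ) + q ≠ b + p) : jFun h M W' a b = 0 := by
  rw [jFun, Tower.block_eq h p.2 hs, jEntry]
  refine dif_neg fun hb => ?_
  refine hn ⟨_, hb.2⟩ ?_
  simp only at hb ⊢
  omega

theorem exists_sub' (h : m ≤ n) (W' : S.Tower n) (a : Fin W'.len) :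
    ∃ (W : S.Tower m) (p : Fin W.len), Tower.Sub W p W' a :=
  ⟨_, _, Tower.block_sub h W' a⟩

theorem jFun_entry (h : m ≤ n) {W' : S.Tower n} (a b : Fin W'.len) :
    (∃ (W : S.Tower m) (p q : Fin W.len), Tower.Sub W p W' a ∧ Tower.Sub W q W' b ∧
      (a : ℕ) + q = b + p ∧ ∀ M : S.Rn K m, jFun h M W' a b = M W p q) ∨
    ((a ≠ b) ∧ (∀ M : S.Rn K m, jFun h M W' a b = 0) ∧ ∀ M : S.Rn K m, jFun h M W' b a = 0) := by
  obtain ⟨W, p, hs⟩ := exists_sub' h W' a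
  by_cases hq : ∃ q : Fin W.len, (a : ℕ) + q = b + p
  · obtain ⟨q, e⟩ := hq
    exact Or.inl ⟨W, p, q, hs, hs.shift e, e, fun M => jFun_of_sub h M hs e⟩
  · refine Or.inr ⟨?_, fun M => jFun_eq_zero h M hs fun q e => hq ⟨q, e⟩, fun M => ?_⟩
    · rintro rfl; exact hq ⟨p, rfl⟩
    · obtain ⟨W₂, p₂, hs₂⟩ := exists_sub' h W' b
      refine jFun_eq_zero h M hs₂ fun q e => hq ?_
      obtain ⟨rfl, e₂⟩ := (hs₂.shift e).unique q.2 p.2 hs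
      exact ⟨p₂, by omega⟩

theorem jFun_mul (h : m ≤ n) (M N : S.Rn K m) : jFun h (M * N) = jFun h M * jFun h N := by
  funext W'
  ext a c
  obtain ⟨W, p, hs⟩ := exists_sub' h W' a
  rw [Pi.mul_apply, Matrix.mul_apply]
  have hlt : ∀ q : Fin W.len, (p : ℕ) ≤ a ∧ (a : ℕ) - p + q < W'.len := fun q =>
    hs.nested h p.2 q.2 a.2
  let e : Fin W.len → Fin W'.len := fun q => ⟨a - p + q, (hlt q).2⟩
  have he : ∀ q, (a : ℕ) + q = e q + p := fun q => by
    have := (hlt q).1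
    simp only [e]; omega
  have hinj : Function.Injective e := fun q q' hqq => by
    have h1 := he q
    have h2 := he q'
    rw [hqq] at h1
    ext; omega
  have hsum : ∑ b, jFun h M W' a b * jFun h N W' b c =
      ∑ q, M W p q * jFun h N W' (e q) c := by
    refine (Fintype.sum_of_injective e hinj _ _ (fun b hb => ?_) fun q => ?_).symm
    · rw [jFun_eq_zero h M hs, zero_mul]
      intro q hq
      refine hb ⟨q, ?_⟩
      have := he q
      ext; omega
    · rw [jFun_of_sub h M hs (he q)]
  rw [hsum]
  by_cases hr : ∃ r : Fin W.len, (a : ℕ) + r = c + p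
  · obtain ⟨r, er⟩ := hr
    rw [jFun_of_sub h _ hs er, Pi.mul_apply, Matrix.mul_apply]
    refine Finset.sum_congr rfl fun q _ => ?_
    rw [jFun_of_sub h N (hs.shift (he q)) (q := r) (by have := he q; omega)]
  · rw [jFun_eq_zero h _ hs fun r er => hr ⟨r, er⟩]
    refine (Finset.sum_eq_zero fun q _ => ?_).symm
    rw [jFun_eq_zero h N (hs.shift (he q)), mul_zero]
    intro r er
    exact hr ⟨r, by have := he q; omega⟩

theorem jFun_one (h : m ≤ n) : jFun h (1 : S.Rn K m) = 1 := by
  funext W'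
  ext a b
  rcases jFun_entry (K := K) h a b with ⟨W, p, q, -, -, e, hM⟩ | ⟨hne, hM, -⟩
  · rw [hM, Pi.one_apply, Pi.one_apply, Matrix.one_apply, Matrix.one_apply]
    exact if_congr (by rw [Fin.ext_iff, Fin.ext_iff]; omega) rfl rfl
  · rw [hM, Pi.one_apply, Matrix.one_apply_ne hne]

theorem jFun_star (h : m ≤ n) (M : S.Rn K m) : jFun h (star M) = star (jFun h M) := by
  funext W'
  ext a b
  rw [Pi.star_apply, Matrix.star_apply]
  rcases jFun_entry (K := K) h a b with ⟨W, p, q, -, hs, e, hM⟩ | ⟨-, hM, hM'⟩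
  · rw [hM, jFun_of_sub h M hs e.symm, Pi.star_apply, Matrix.star_apply]
  · rw [hM, hM', star_zero]

theorem jFun_add (h : m ≤ n) (M N : S.Rn K m) : jFun h (M + N) = jFun h M + jFun h N := by
  funext W'
  ext a b
  rcases jFun_entry (K := K) h a b with ⟨W, p, q, -, -, -, hM⟩ | ⟨-, hM, -⟩ <;>
  simp [hM]

theorem jFun_smul (h : m ≤ n) (c : K) (M : S.Rn K m) : jFun h (c • M) = c • jFun h M := by
  funext W'
  ext a b
  rcases jFun_entry (K := K) h a b with ⟨W, p, q, -, -, -, hM⟩ | ⟨-, hM, -⟩ <;>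
  simp [hM]

variable (S K) in
/-- The transition map `𝕽_m → 𝕽_n` for `m ≤ n`. -/
def j (h : m ≤ n) : S.Rn K m →⋆ₐ[K] S.Rn K n :=
  { AlgHom.ofLinearMap ⟨⟨jFun h, jFun_add h⟩, jFun_smul h⟩ (jFun_one h) (jFun_mul h) with
    map_star' := jFun_star h }

theorem j_apply (h : m ≤ n) (M : S.Rn K m) : S.j K h M = jFun h M := rfl

instance : DirectedSystem (S.Rn K) (fun _ _ h => (S.j K h : S.Rn K _ → S.Rn K _)) where
  map_self i M := by
    funext W
    ext a b
    exact jFun_of_sub le_rfl M (Tower.Sub.refl W a) (Nat.add_comm _ _)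
  map_map m n k hmn hnk M := by
    funext W
    ext a b
    simp only [j_apply]
    obtain ⟨W', p', hs'⟩ := exists_sub' hnk W a
    obtain ⟨V, p, hs⟩ := exists_sub' hmn W' p'
    by_cases hq' : ∃ q' : Fin W'.len, (a : ℕ) + q' = b + p'
    · obtain ⟨q', e'⟩ := hq'
      rw [jFun_of_sub hnk _ hs' e']
      by_cases hq : ∃ q : Fin V.len, (p' : ℕ) + q = q' + p
      · obtain ⟨q, e⟩ := hq
        rw [jFun_of_sub hmn M hs e, jFun_of_sub _ M (hs.trans hs') (q := q) (by omega)]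
      · rw [jFun_eq_zero hmn M hs fun q e => hq ⟨q, e⟩, jFun_eq_zero _ M (hs.trans hs')]
        exact fun q e => hq ⟨q, by omega⟩
    · rw [jFun_eq_zero hnk _ hs' fun q e => hq' ⟨q, e⟩, jFun_eq_zero _ M (hs.trans hs')]
      intro q e
      have hn := hs.nested hmn p.2 q.2 p'.2
      exact hq' ⟨⟨p' - p + q, hn.2⟩, by simp only; omega⟩

variable (S) in
/-- The rank function `rk_n(M) = ∑_{W ∈ 𝕍_n} μ(W) Rk(M_W)` of `𝕽_n`. -/
def rkN (n : ℕ) (M : S.Rn K n) : ENNReal := ∑' W : S.Tower n, S.μ W.base * ((M W).rank : ENNReal)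

/-! Basic properties of the rank. -/

theorem rkN_zero : S.rkN n (0 : S.Rn K n) = 0 := by simp [rkN]

theorem rkN_add_le (M N : S.Rn K n) : S.rkN n (M + N) ≤ S.rkN n M + S.rkN n N := by
  rw [rkN, rkN, rkN, ← ENNReal.tsum_add]
  refine ENNReal.tsum_le_tsum fun W => ?_
  rw [← mul_add]
  gcongr
  exact_mod_cast rank_add_le (M W) (N W)

theorem rkN_mul_le_left (M N : S.Rn K n) : S.rkN n (M * N) ≤ S.rkN n M := by
  refine ENNReal.tsum_le_tsum fun W => ?_
  gcongr
  exact Matrix.rank_mul_le_left (M W) (N W)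

theorem rkN_mul_le_right (M N : S.Rn K n) : S.rkN n (M * N) ≤ S.rkN n N := by
  refine ENNReal.tsum_le_tsum fun W => ?_
  gcongr
  exact Matrix.rank_mul_le_right (M W) (N W)

theorem rkN_star (M : S.Rn K n) : S.rkN n (star M) = S.rkN n M :=
  tsum_congr fun W => by rw [Pi.star_apply, rank_star]

theorem rkN_smul_le (c : K) (M : S.Rn K n) : S.rkN n (c • M) ≤ S.rkN n M := by
  refine ENNReal.tsum_le_tsum fun W => ?_
  gcongr
  exact rank_smul_le c (M W)

/-! ### The direct limit `𝕽_∞`, its rank function, and its rank completion `𝕽_rk` -/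

variable (S K) in
/-- `𝕽_∞`, the direct limit of the `𝕽_n`. -/
def RInf : Type _ := DirectLimit (S.Rn K) (fun _ _ h => S.j K h)

instance : Ring (S.RInf K) :=
  inferInstanceAs (Ring (DirectLimit (S.Rn K) (fun _ _ h => S.j K h)))

instance : Algebra K (S.RInf K) :=
  inferInstanceAs (Algebra K (DirectLimit (S.Rn K) (fun _ _ h => S.j K h)))

instance : StarRing (S.RInf K) :=
  inferInstanceAs (StarRing (DirectLimit (S.Rn K) (fun _ _ h => S.j K h)))

instance : StarModule K (S.RInf K) :=
  inferInstanceAs (StarModule K (DirectLimit (S.Rn K) (fun _ _ h => S.j K h)))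

variable (S K) in
/-- The canonical map `𝕽_n → 𝕽_∞`. -/
def iota (n : ℕ) : S.Rn K n →⋆ₐ[K] S.RInf K where
  toFun M := (⟦⟨n, M⟩⟧ : DirectLimit (S.Rn K) (fun _ _ h => S.j K h))
  map_one' := (DirectLimit.one_def (f := fun _ _ h => S.j K h) n).symm
  map_mul' M N := (DirectLimit.mul_def (f := fun _ _ h => S.j K h) n M N).symm
  map_zero' := (DirectLimit.zero_def (f := fun _ _ h => S.j K h) n).symm
  map_add' M N := (DirectLimit.add_def (f := fun _ _ h => S.j K h) n M N).symm
  commutes' c := by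
    rw [Algebra.algebraMap_eq_smul_one, Algebra.algebraMap_eq_smul_one]
    change _ = c • (1 : DirectLimit (S.Rn K) (fun _ _ h => S.j K h))
    rw [DirectLimit.one_def (f := fun _ _ h => S.j K h) n]
    rfl
  map_star' _ := rfl

theorem iota_j (h : m ≤ n) (M : S.Rn K m) : S.iota K n (S.j K h M) = S.iota K m M :=
  DirectLimit.mk_apply (F := S.Rn K) (f := fun _ _ h => S.j K h) m n M h

theorem RInf.induction {p : S.RInf K → Prop} (h : ∀ n M, p (S.iota K n M)) (x : S.RInf K) : p x :=
  DirectLimit.induction (fun _ _ h => S.j K h) h x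

theorem RInf.induction₂ {p : S.RInf K → S.RInf K → Prop}
    (h : ∀ n M N, p (S.iota K n M) (S.iota K n N)) (x z : S.RInf K) : p x z :=
  DirectLimit.induction₂ (fun _ _ h => S.j K h) h x z

/-- The eventual value of `rk_m(j(M))` for `M ∈ 𝕽_n` as `m → ∞`. -/
def rkLim (n : ℕ) (M : S.Rn K n) : ENNReal :=
  limsup (fun m => if h : n ≤ m then S.rkN m (S.j K h M) else 0) atTop

theorem rkLim_j (h : m ≤ n) (M : S.Rn K m) : rkLim n (S.j K h M) = rkLim m M := by
  refine limsup_congr ?_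
  filter_upwards [eventually_ge_atTop n] with k hk
  rw [dif_pos hk, dif_pos (h.trans hk)]
  congr 1
  exact DirectedSystem.map_map (f := fun _ _ h => (S.j K h : S.Rn K _ → S.Rn K _)) h hk M

/-- The rank function `rk_∞` of `𝕽_∞` induced by the `rk_n`, `rk_∞(ι_n(M)) = rk_n(M)`: as the `j`
preserve ranks, the sequence `rk_m(j(M))`, `m ≥ n`, is constant. -/
def rkInf (x : S.RInf K) : ENNReal :=
  DirectLimit.lift (fun _ _ h => S.j K h) (fun n M => rkLim n M)
    (fun _ _ h M => (rkLim_j h M).symm) x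

theorem rkInf_iota (M : S.Rn K n) : rkInf (S.iota K n M) = rkLim n M := rfl

theorem rkLim_mono {M N : S.Rn K n} (H : ∀ m (h : n ≤ m), S.rkN m (S.j K h M) ≤ S.rkN m (S.j K h N)) :
    rkLim n M ≤ rkLim n N := by
  refine limsup_le_limsup (Eventually.of_forall fun m => ?_)
  by_cases h : n ≤ m
  · simpa only [dif_pos h] using H m h
  · simp only [dif_neg h, le_refl]

theorem limsup_add_le_add (u v : ℕ → ENNReal) :
    limsup (u + v) atTop ≤ limsup u atTop + limsup v atTop := by
  rw [limsup_eq_iInf_iSup_of_nat, limsup_eq_iInf_iSup_of_nat, limsup_eq_iInf_iSup_of_nat,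
    ENNReal.iInf_add_iInf]
  · exact iInf_mono fun n => iSup₂_le fun i hi =>
      add_le_add (le_iSup₂ (f := fun i (_ : i ≥ n) => u i) i hi)
        (le_iSup₂ (f := fun i (_ : i ≥ n) => v i) i hi)
  · intro a b
    refine ⟨max a b, add_le_add ?_ ?_⟩
    · exact iSup₂_le fun i hi => le_iSup₂ (f := fun i (_ : i ≥ a) => u i) i (le_of_max_le_left hi)
    · exact iSup₂_le fun i hi => le_iSup₂ (f := fun i (_ : i ≥ b) => v i) i (le_of_max_le_right hi)

theorem rkInf_zero : rkInf (0 : S.RInf K) = 0 := by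
  rw [← map_zero (S.iota K 0), rkInf_iota]
  simp [rkLim, rkN_zero]

theorem rkInf_add_le (x z : S.RInf K) : rkInf (x + z) ≤ rkInf x + rkInf z := by
  induction x, z using RInf.induction₂ with
  | h n M N =>
    rw [← map_add, rkInf_iota, rkInf_iota, rkInf_iota]
    refine le_trans (limsup_le_limsup (Eventually.of_forall fun m => ?_))
      (limsup_add_le_add _ _)
    by_cases h : n ≤ m
    · simpa only [dif_pos h, Pi.add_apply, map_add] using rkN_add_le _ _
    · simp only [dif_neg h, Pi.add_apply, add_zero, le_refl]

theorem rkInf_mul_le_left (x z : S.RInf K) : rkInf (x * z) ≤ rkInf x := by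
  induction x, z using RInf.induction₂ with
  | h n M N =>
    rw [← map_mul, rkInf_iota, rkInf_iota]
    exact rkLim_mono fun m h => by rw [map_mul]; exact rkN_mul_le_left _ _

theorem rkInf_mul_le_right (x z : S.RInf K) : rkInf (x * z) ≤ rkInf z := by
  induction x, z using RInf.induction₂ with
  | h n M N =>
    rw [← map_mul, rkInf_iota, rkInf_iota]
    exact rkLim_mono fun m h => by rw [map_mul]; exact rkN_mul_le_right _ _

theorem rkInf_smul_le (c : K) (x : S.RInf K) : rkInf (c • x) ≤ rkInf x := by
  rw [← smul_one_mul]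
  exact rkInf_mul_le_right _ _

theorem rkInf_neg_le (x : S.RInf K) : rkInf (-x) ≤ rkInf x := by
  rw [← neg_one_mul]
  exact rkInf_mul_le_right _ _

theorem rkInf_star_le (x : S.RInf K) : rkInf (star x) ≤ rkInf x := by
  induction x using RInf.induction with
  | h n M =>
    rw [← map_star, rkInf_iota, rkInf_iota]
    exact rkLim_mono fun m h => by rw [map_star, rkN_star]

/-- The rank distance `d(x, z) = rk_∞(x - z)` on `𝕽_∞`. -/
instance : PseudoEMetricSpace (S.RInf K) where
  edist x z := rkInf (x - z)
  edist_self x := by rw [sub_self, rkInf_zero]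
  edist_comm x z := le_antisymm (by rw [← neg_sub]; exact rkInf_neg_le _)
    (by rw [← neg_sub]; exact rkInf_neg_le _)
  edist_triangle x z w := by
    rw [show x - w = (x - z) + (z - w) by abel]
    exact rkInf_add_le _ _

theorem edist_def (x z : S.RInf K) : edist x z = rkInf (x - z) := rfl

instance : IsUniformAddGroup (S.RInf K) where
  uniformContinuous_sub := by
    refine LipschitzWith.uniformContinuous (K := 2) fun p q => ?_
    rw [edist_def, show p.1 - p.2 - (q.1 - q.2) = (p.1 - q.1) + -(p.2 - q.2) by abel]
    refine (rkInf_add_le _ _).trans ?_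
    rw [show ((2 : NNReal) : ENNReal) = 2 from rfl, two_mul]
    exact add_le_add (le_max_left (edist p.1 q.1) (edist p.2 q.2))
      ((rkInf_neg_le _).trans (le_max_right (edist p.1 q.1) (edist p.2 q.2)))

instance : IsTopologicalRing (S.RInf K) where
  continuous_mul := by
    refine LipschitzWith.continuous (K := 2) fun p q => ?_
    rw [edist_def, show p.1 * p.2 - q.1 * q.2 = (p.1 - q.1) * p.2 + q.1 * (p.2 - q.2) by
      noncomm_ring]
    refine (rkInf_add_le _ _).trans ?_
    rw [show ((2 : NNReal) : ENNReal) = 2 from rfl, two_mul]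
    exact add_le_add
      ((rkInf_mul_le_left _ _).trans (le_max_left (edist p.1 q.1) (edist p.2 q.2)))
      ((rkInf_mul_le_right _ _).trans (le_max_right (edist p.1 q.1) (edist p.2 q.2)))

instance : UniformContinuousConstSMul K (S.RInf K) where
  uniformContinuous_const_smul c := by
    refine LipschitzWith.uniformContinuous (K := 1) fun x z => ?_
    rw [edist_def, edist_def, ← smul_sub, ENNReal.coe_one, one_mul]
    exact rkInf_smul_le _ _

theorem uniformContinuous_star : UniformContinuous (star : S.RInf K → S.RInf K) := by
  refine LipschitzWith.uniformContinuous (K := 1) fun x z => ?_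
  rw [edist_def, edist_def, ← star_sub, ENNReal.coe_one, one_mul]
  exact rkInf_star_le _

variable (S K) in
/-- `𝕽_rk`, the completion of `𝕽_∞` with respect to `rk_∞`. -/
abbrev RRk : Type _ := UniformSpace.Completion (S.RInf K)

open UniformSpace in
/-- The involution of `𝕽_rk`, obtained by continuous extension. -/
instance : Star (S.RRk K) := ⟨Completion.map star⟩

open UniformSpace in
theorem star_coe (a : S.RInf K) : star (a : S.RRk K) = ((star a : S.RInf K) : S.RRk K) :=
  Completion.map_coe uniformContinuous_star a

open UniformSpace in
instance : ContinuousStar (S.RRk K) := ⟨Completion.continuous_map⟩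

open UniformSpace in
instance : StarRing (S.RRk K) where
  star_involutive x := Completion.induction_on x
    (isClosed_eq (by fun_prop) continuous_id)
    fun a => by rw [star_coe, star_coe, star_star]
  star_mul x z := Completion.induction_on₂ x z
    (isClosed_eq (by fun_prop) (by fun_prop))
    fun a b => by
      rw [← Completion.coe_mul, star_coe, star_coe, star_coe, star_mul, Completion.coe_mul]
  star_add x z := Completion.induction_on₂ x z
    (isClosed_eq (by fun_prop) (by fun_prop))
    fun a b => by
      rw [← Completion.coe_add, star_coe, star_coe, star_coe, star_add, Completion.coe_add]

open UniformSpace in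
instance : StarModule K (S.RRk K) where
  star_smul c x := Completion.induction_on x
    (isClosed_eq (continuous_star.comp (Completion.uniformContinuous_map.continuous))
      ((UniformContinuousConstSMul.uniformContinuous_const_smul (star c)).continuous.comp
        continuous_star))
    fun a => by rw [← Completion.coe_smul, star_coe, star_coe, star_smul, Completion.coe_smul]

/-! ### The algebras `A_n`, `R_n`, `A_∞`, `R_∞` and the ideals `I`, `Ĩ` -/

open Crossed

variable (S K)

/-- `A_n = A(E_n, P_n)`: the unital `*`-subalgebra of `A` generated by the `χ_Z t`, `Z ∈ P_n`. -/
def An (n : ℕ) : StarSubalgebra K (Crossed S.T K) :=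
  StarAlgebra.adjoin K
    {a | ∃ (Z : Set X) (hZ : Z ∈ S.P n), a = C (chi S.T K (S.isClopen_P n Z hZ)) * t S.T K}

/-- `A_∞ = ⋃ A_n`. -/
def AInf : Set (Crossed S.T K) := ⋃ n, (S.An K n : Set (Crossed S.T K))

variable {S} in
/-- The matrix units `e_{ab}(W) = (χ_{X∖E_n} t)^a χ_W (t⁻¹ χ_{X∖E_n})^b`, `0 ≤ a, b < |W|`. -/
def e (W : S.Tower n) (a b : Fin W.len) : Crossed S.T K :=
  (C (chi S.T K (S.isClopen_E n).compl) * t S.T K) ^ (a : ℕ) * C (chi S.T K W.isClopen) *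
    (tInv S.T K * C (chi S.T K (S.isClopen_E n).compl)) ^ (b : ℕ)

variable {S} in
/-- `h_W = e_{00}(W) + ⋯ + e_{|W|-1,|W|-1}(W)`. -/
def hW (W : S.Tower n) : Crossed S.T K := ∑ a, e K W a a

/-- The representation `π_n : A_n → 𝕽_n`, `π_n(a) = (h_W a)_W`, with `h_W A_n` identified with
`M_{|W|}(K)` by means of the matrix units `e_{ij}(W) = χ_{T^i(W)} t^{i-j}`. For `a = ∑ f_k t^k` in
`A_n` the function `f_{i-j}` is constant on `T^i(W)`, and its value there is the coefficient of
`e_{ij}(W)` in `h_W a`. The formula makes sense for all `a ∈ A`, but is only meant for `a ∈ A_n`. -/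
def piN (n : ℕ) (a : Crossed S.T K) : S.Rn K n := fun W i k =>
  (a.coeff (Multiplicative.ofAdd ((i : ℤ) - k))) ((S.T ^ (i : ℤ)) W.nonempty.some)

/-- The image of `B ∩ A_∞` under the embedding `π_∞ : A_∞ → 𝕽_∞`, which is given by `π_n` on
each `A_n`. -/
def piInfImage (B : Set (Crossed S.T K)) : Set (S.RInf K) :=
  {r | ∃ (n : ℕ) (a : Crossed S.T K), a ∈ S.An K n ∧ a ∈ B ∧ r = S.iota K n (S.piN K n a)}

/-- `R_n`, the `*`-regular closure of `A_n` in `𝕽_n`. -/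
def RegN (n : ℕ) : StarSubalgebra K (S.Rn K n) :=
  starRegularClosure K (S.piN K n '' (S.An K n : Set (Crossed S.T K)))

/-- `R_∞`, the `*`-regular closure of `A_∞` in `𝕽_∞`. -/
def RegInf : StarSubalgebra K (S.RInf K) := starRegularClosure K (S.piInfImage K Set.univ)

/-- The ideal `I` of `A` generated by `C_{c,K}(X ∖ {y, T y, …, T^{l-1} y})`. -/
def idealI (l : ℕ) : TwoSidedIdeal (Crossed S.T K) :=
  TwoSidedIdeal.span
    (C '' (Cc S.T K {x | ∀ i : ℕ, i < l → x ≠ (S.T ^ (i : ℤ)) S.y} : Set (CK S.T K)))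

/-- The ideal `Ĩ` of `R_∞` generated by `I`. -/
def idealItilde (l : ℕ) : TwoSidedIdeal (S.RegInf K) :=
  TwoSidedIdeal.span {r | (r : S.RInf K) ∈ S.piInfImage K (S.idealI K l)}

/-- The image of `Ĩ` in `𝕽_rk`. -/
def itildeRk (l : ℕ) : Set (S.RRk K) :=
  {x | ∃ r ∈ S.idealItilde K l, x = ((r : S.RInf K) : S.RRk K)}

variable {S K}

/-- `Φ` is the canonical embedding `A → 𝕽_rk`: an injective `*`-homomorphism that extends the
embeddings `A_n → 𝕽_n → 𝕽_∞ → 𝕽_rk` and sends `t` to `lim_n π_n(χ_{X∖E_n} t)`. Such a `Φ` is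
unique, since `A` is generated by `t`, `t⁻¹` and `C_K(X) ⊆ ⋃ A_n`. -/
structure IsCanonicalEmbedding (Φ : Crossed S.T K →⋆ₐ[K] S.RRk K) : Prop where
  injective : Function.Injective Φ
  extends_pi : ∀ n, ∀ a ∈ S.An K n, Φ a = ((S.iota K n (S.piN K n a) : S.RInf K) : S.RRk K)
  map_t : Tendsto (fun n => ((S.iota K n (S.piN K n
    (C (chi S.T K (S.isClopen_E n).compl) * t S.T K)) : S.RInf K) : S.RRk K)) atTop (𝓝 (Φ (t S.T K)))

/-- `R_A`, the `*`-regular closure of `A` in `𝕽_rk`. -/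
def RegA (Φ : Crossed S.T K →⋆ₐ[K] S.RRk K) : StarSubalgebra K (S.RRk K) :=
  starRegularClosure K (Set.range Φ)

variable (S K) in
/-- `K[t^d, t^{-d}]`, the `*`-subalgebra of `A` generated by `t^d`. -/
def laurent (d : ℕ) : StarSubalgebra K (Crossed S.T K) := StarAlgebra.adjoin K {t S.T K ^ d}

/-- For `W ∈ 𝕍_n`: the `*`-subalgebra `R` generated by `Ĩ`, `h_W A_n` and `K[t, t⁻¹]`. -/
def algR (Φ : Crossed S.T K →⋆ₐ[K] S.RRk K) (l : ℕ) (W : S.Tower n) :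
    StarSubalgebra K (S.RRk K) :=
  StarAlgebra.adjoin K
    (S.itildeRk K l ∪ Φ '' {b | ∃ a ∈ S.An K n, b = hW K W * a} ∪
      Φ '' (S.laurent K 1 : Set (Crossed S.T K)))

end Algebras

end ApproxSystem

end

end CrossedApprox

/-! Everything is governed by the orbit of `y`. Each `a` in the crossed product acts along the orbit
of a point `x` by the row-finite matrix `ent a x`. This assignment is multiplicative and compatible
with the involution. `A_n` consists of elements whose orbit matrices respect the towers over `𝕍_n`
(`An_subset_blockAlg`), and `π_n` reads off the blocks. For a general `a` the compression `π_n(a)`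
is still defined. It fails to be multiplicative, or compatible with the transition maps, only in
rows within bounded distance of `E_n`. Such rows contribute rank at most a constant times `μ(E_n)`,
which tends to `μ({y}) = 0`: the orbit of `y` is finite, so positive mass would make it all of the
infinite space `X`. Hence `Φ(a) = lim π_n(a)` exists and is a `*`-homomorphism. It is injective
because a nonzero `a` can be cut down to some `χ_U` with `U` nonempty (`exists_cut_down`), and `χ_U`
has rank at least `μ(U) > 0`.

The ideal `I` consists of the elements whose orbit matrix at `y` vanishes (`idealI_eq`). A locally
constant function vanishing on the orbit also vanishes on the first few translates of a small `E_n`.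
There `t` can be replaced by `χ_{X∖E_n} t`, so `I ⊆ A_∞`. For large `n` the first return of `y` to
`E_n` takes time `l`. This gives the tower `W_n`, whose components fit together to a
`*`-homomorphism `θ : 𝕽_∞ → M_l(K)` (`exists_character`).

For (i), positive definiteness provides Moore–Penrose inverses in `𝕽_n`. As they are unique and
preserved by `*`-homomorphisms, `R_∞` is the union of the `R_n`. If `θ(r) = 0`, then `r = (1 -
h_{W_n}) r` for some `n`, and `1 - h_{W_n}` lies in `I`. Therefore `Ĩ` is the kernel of `θ` on
`R_∞`, and `θ` is onto because of the matrix units `e_{ij}(W_M)`.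

For (ii), the same factorisation `x = (1 - h)x` shows that `Ĩ` absorbs multiplication by `A`, so `R
= Ĩ + A`. Moreover `A ∩ Ĩ = I`, whence `R/Ĩ ≅ A/I`. Finally `A/I ≅ M_l(K[t^l, t^{-l}])` through the
representation `orbitRep`, which folds the `l`-periodic orbit matrix at `y` into an `l × l` matrix
of Laurent polynomials. -/

namespace CrossedApprox

noncomputable section

/-! ### Moore–Penrose inverses and `*`-regular closures -/

/-- `z` is the Moore–Penrose inverse of `x`. -/
structure IsMoorePenrose {R : Type*} [Mul R] [Star R] (x z : R) : Prop where
  mul_mul : x * z * x = x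
  mul_mul' : z * x * z = z
  star_left : star (x * z) = x * z
  star_right : star (z * x) = z * x

namespace IsMoorePenrose

variable {R R' : Type*} [Ring R] [StarRing R] [Ring R'] [StarRing R'] {x z z' : R}

theorem unique (h : IsMoorePenrose x z) (h' : IsMoorePenrose x z') : z = z' := by
  have h1 : x * z = x * z' := by
    calc x * z = star (x * z) := h.star_left.symm
      _ = star ((x * z') * (x * z)) := by rw [← mul_assoc, h'.mul_mul]
      _ = (x * z) * (x * z') := by rw [star_mul, h.star_left, h'.star_left]
      _ = x * z' := by rw [← mul_assoc, h.mul_mul]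
  have h2 : z * x = z' * x := by
    calc z * x = star (z * x) := h.star_right.symm
      _ = star ((z * x) * (z' * x)) := by
          rw [mul_assoc z x, ← mul_assoc x z', h'.mul_mul]
      _ = (z' * x) * (z * x) := by rw [star_mul, h.star_right, h'.star_right]
      _ = z' * x := by rw [mul_assoc z' x, ← mul_assoc x z, h.mul_mul]
  calc z = z * x * z := h.mul_mul'.symm
    _ = z' * x * z' := by rw [h2, mul_assoc, h1, ← mul_assoc]
    _ = z' := h'.mul_mul'

theorem map {F : Type*} [FunLike F R R'] [MulHomClass F R R'] [StarHomClass F R R'] (f : F)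
    (h : IsMoorePenrose x z) : IsMoorePenrose (f x) (f z) where
  mul_mul := by rw [← map_mul, ← map_mul, h.mul_mul]
  mul_mul' := by rw [← map_mul, ← map_mul, h.mul_mul']
  star_left := by rw [← map_mul, ← map_star, h.star_left]
  star_right := by rw [← map_mul, ← map_star, h.star_right]

theorem star (h : IsMoorePenrose x z) : IsMoorePenrose (star x) (star z) where
  mul_mul := by rw [← star_mul, ← star_mul, ← mul_assoc, h.mul_mul]
  mul_mul' := by rw [← star_mul, ← star_mul, ← mul_assoc, h.mul_mul']
  star_left := by rw [← star_mul, h.star_right, h.star_right]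
  star_right := by rw [← star_mul, h.star_left, h.star_left]

/-- Taking adjoints in `x = a x* x` gives `a x* = a x* x a*`, so `a x*` is self-adjoint and equals
`x a*`. Symmetrically `x* b = b* x`. The products of `x` with `b* x a*` therefore collapse to these
two projections. -/
theorem of_factors {a b : R} (ha : x = a * Star.star x * x) (hb : x = x * Star.star x * b) :
    IsMoorePenrose x (Star.star b * x * Star.star a) := by
  have hpa : Star.star (a * Star.star x) = a * Star.star x := by
    have h1 : a * Star.star x = a * (Star.star x * x * Star.star a) := by
      conv_lhs => rw [ha]
      simp only [star_mul, star_star, mul_assoc]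
    conv_rhs => rw [h1]
    conv_lhs => rw [h1]
    simp only [star_mul, star_star, mul_assoc]
  have hpb : Star.star (Star.star x * b) = Star.star x * b := by
    have h1 : Star.star x * b = (Star.star b * x * Star.star x) * b := by
      conv_lhs => rw [hb]
      simp only [star_mul, star_star, mul_assoc]
    conv_rhs => rw [h1]
    conv_lhs => rw [h1]
    simp only [star_mul, star_star, mul_assoc]
  have ea : x * Star.star a = a * Star.star x := by rw [← hpa, star_mul, star_star]
  have eb : Star.star b * x = Star.star x * b := by rw [← hpb, star_mul, star_star]
  have h1 : x * (Star.star b * x * Star.star a) = a * Star.star x := by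
    rw [eb, ← mul_assoc, ← mul_assoc, ← hb, ea]
  have h2 : Star.star b * x * Star.star a * x = Star.star x * b := by
    rw [mul_assoc (Star.star b), ea, mul_assoc, ← ha, eb]
  refine ⟨by rw [h1, ← ha], ?_, by rw [h1, hpa], by rw [h2, hpb]⟩
  rw [h2, eb, ← mul_assoc]
  congr 1
  calc Star.star x * b * (Star.star x * b) = Star.star b * (x * Star.star x * b) := by
        rw [← eb]; simp only [mul_assoc]; rw [eb]
    _ = Star.star x * b := by rw [← hb, eb]

/-- A von Neumann regular `*`-subalgebra contains the Moore–Penrose inverses of its elements. -/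
theorem mem {K : Type*} [Field K] [StarRing K] [Algebra K R] [StarModule K R]
    {B : StarSubalgebra K R} (hB : ∀ x ∈ B, ∃ z ∈ B, x * z * x = x) (hx : x ∈ B)
    (h : IsMoorePenrose x z) : z ∈ B := by
  have key : ∀ {x z : R}, x ∈ B → IsMoorePenrose x z →
      ∃ a ∈ B, x = a * Star.star x * x := by
    intro x z hx h
    -- Regularity is used for `x* x`, so `w` lies in `B`. The inverse `z`, not yet known to lie in
    -- `B`, only serves to cancel `x*` through `x = z* (x* x)`.
    obtain ⟨w, hw, e⟩ := hB (Star.star x * x) (mul_mem (star_mem hx) hx)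
    refine ⟨x * w, mul_mem hx hw, ?_⟩
    have hxs : x = Star.star z * (Star.star x * x) := by
      rw [← mul_assoc, ← star_mul, h.star_left, h.mul_mul]
    calc x = Star.star z * (Star.star x * x) := hxs
      _ = Star.star z * (Star.star x * x * w * (Star.star x * x)) := by rw [e]
      _ = (Star.star z * (Star.star x * x)) * w * (Star.star x * x) := by
        simp only [mul_assoc]
      _ = _ := by rw [← hxs]; simp only [mul_assoc]
  obtain ⟨a, ha, ea⟩ := key hx h
  obtain ⟨b, hb, eb⟩ := key (star_mem hx) h.star
  have eb' : x = x * Star.star x * Star.star b := by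
    have := congrArg Star.star eb
    simpa [star_mul, mul_assoc] using this
  rw [h.unique (of_factors ea eb')]
  exact mul_mem (mul_mem (star_mem (star_mem hb)) hx) (star_mem ha)

/-- If `w` is a quasi-inverse of `x* x`, the defect `d = x - x w x* x` satisfies `d* d = 0`, so
properness turns regularity of `x* x` into `x = a x* x`. The same for `x*` gives the other
factorisation required by `of_factors`. -/
theorem exists_of_regular_of_proper (hreg : ∀ x : R, ∃ z, x * z * x = x)
    (hprop : ∀ x : R, Star.star x * x = 0 → x = 0) (x : R) : ∃ z, IsMoorePenrose x z := by
  have key : ∀ x : R, ∃ a, x = a * Star.star x * x := by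
    intro x
    obtain ⟨w, e⟩ := hreg (Star.star x * x)
    refine ⟨x * w, ?_⟩
    rw [← sub_eq_zero]
    refine hprop _ ?_
    rw [show x - x * w * Star.star x * x = x * (1 - w * Star.star x * x) by
      simp only [mul_sub, mul_one, mul_assoc], star_mul, mul_assoc, ← mul_assoc (Star.star x),
      mul_sub, mul_one, show Star.star x * x * (w * Star.star x * x) =
        Star.star x * x * w * (Star.star x * x) by simp only [mul_assoc], e, sub_self, mul_zero]
  obtain ⟨a, ha⟩ := key x
  obtain ⟨b, hb⟩ := key (Star.star x)
  refine ⟨_, of_factors ha (b := Star.star b) ?_⟩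
  have := congrArg Star.star hb
  simpa [star_mul, mul_assoc] using this

end IsMoorePenrose

section Closure

variable {K R R' : Type*} [Field K] [StarRing K] [Ring R] [StarRing R] [Algebra K R]
  [StarModule K R] [Ring R'] [StarRing R'] [Algebra K R'] [StarModule K R']

theorem subset_starRegularClosure (s : Set R) : s ⊆ (starRegularClosure K s : Set R) := by
  intro x hx
  rw [SetLike.mem_coe, starRegularClosure, StarSubalgebra.mem_sInf]
  exact fun B hB => hB.1 hx

theorem starRegularClosure_le {s : Set R} {B : StarSubalgebra K R} (hs : s ⊆ (B : Set R))
    (hB : ∀ x ∈ B, ∃ z ∈ B, x * z * x = x) : starRegularClosure K s ≤ B :=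
  sInf_le ⟨hs, hB⟩

/-- Moore–Penrose inverses are unique, so all regular `*`-subalgebras in the intersection contain
the same one. For arbitrary quasi-inverses the argument would fail. -/
theorem IsMoorePenrose.mem_starRegularClosure {s : Set R} {x z : R}
    (hx : x ∈ starRegularClosure K s) (h : IsMoorePenrose x z) : z ∈ starRegularClosure K s := by
  rw [starRegularClosure, StarSubalgebra.mem_sInf] at hx ⊢
  exact fun B hB => h.mem hB.2 (hx B hB)

/-- The preimage of the closure is itself regular, because `f` carries the Moore–Penrose inverse of
`x` to that of `f x`. -/
theorem map_mem_starRegularClosure (hR : ∀ x : R, ∃ z, IsMoorePenrose x z) (f : R →⋆ₐ[K] R')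
    {s : Set R} {s' : Set R'} (hs : ∀ x ∈ s, f x ∈ starRegularClosure K s') {x : R}
    (hx : x ∈ starRegularClosure K s) : f x ∈ starRegularClosure K s' := by
  refine starRegularClosure_le (B := (starRegularClosure K s').comap f) hs (fun x hx => ?_) hx
  obtain ⟨z, hz⟩ := hR x
  exact ⟨z, (hz.map f).mem_starRegularClosure hx, hz.mul_mul⟩

end Closure

/-! ### Regularity and properness of matrix algebras; comparison of quotients -/

/-- A quasi-inverse is a linear section of `A` over its range, extended arbitrarily to the whole
space. -/
theorem Matrix.exists_mul_mul_eq {K ι : Type*} [Field K] [Fintype ι] [DecidableEq ι]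
    (A : Matrix ι ι K) : ∃ B : Matrix ι ι K, A * B * A = A := by
  set f := Matrix.toLin' A with hf
  obtain ⟨g, hg⟩ := f.rangeRestrict.exists_rightInverse_of_surjective
    (LinearMap.range_eq_top.2 f.surjective_rangeRestrict)
  obtain ⟨g', hg'⟩ := g.exists_extend
  refine ⟨LinearMap.toMatrix' g', Matrix.toLin'.injective ?_⟩
  rw [Matrix.toLin'_mul, Matrix.toLin'_mul, Matrix.toLin'_toMatrix', ← hf]
  ext1 i
  refine LinearMap.ext fun v => ?_
  have h1 : g' (f (LinearMap.single K (fun _ => K) i v)) =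
      g (f.rangeRestrict (LinearMap.single K (fun _ => K) i v)) := by
    rw [← hg']; rfl
  have h2 := congrArg Subtype.val (LinearMap.congr_fun hg
    (f.rangeRestrict (LinearMap.single K (fun _ => K) i v)))
  simp only [LinearMap.comp_apply, h1]
  exact h2

/-- The involution of `K` is positive definite. -/
def IsPositiveDefinite (K : Type*) [Field K] [StarRing K] : Prop :=
  ∀ (N : ℕ) (c : Fin N → K), ∑ i, star (c i) * c i = 0 → ∀ i, c i = 0

/-- The `k`-th diagonal entry of `A* A` is the sum of `star c * c` over the entries `c` of column
`k`. -/
theorem Matrix.eq_zero_of_star_mul_self_eq_zero {K ι : Type*} [Field K] [StarRing K] [Fintype ι]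
    (hK : IsPositiveDefinite K)
    (A : Matrix ι ι K) (h : star A * A = 0) : A = 0 := by
  ext i k
  have h1 := congrFun (congrFun h k) k
  rw [Matrix.mul_apply] at h1
  simp only [Matrix.star_apply, Matrix.zero_apply] at h1
  let e := Fintype.equivFin ι
  have := hK _ (fun s => A (e.symm s) k)
    ((Equiv.sum_comp e.symm fun i => star (A i k) * A i k).trans h1) (e i)
  simpa using this

/-- Two surjective homomorphisms with the same kernel have isomorphic targets. -/
theorem exists_algEquiv_of_surjective {K A B C : Type*} [Field K] [Ring A] [Ring B] [Ring C]
    [Algebra K A] [Algebra K B] [Algebra K C] (f : A →ₐ[K] B) (g : A →ₐ[K] C)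
    (hf : Function.Surjective f) (hg : Function.Surjective g) (h : ∀ a, f a = 0 ↔ g a = 0) :
    ∃ φ : B ≃ₐ[K] C, ∀ a, φ (f a) = g a := by
  have key : ∀ a b, f a = f b ↔ g a = g b := fun a b => by
    rw [← sub_eq_zero, ← map_sub, h, map_sub, sub_eq_zero]
  have hs : ∀ a, g (Function.surjInv hf (f a)) = g a := fun a =>
    (key _ _).1 (Function.surjInv_eq hf _)
  let φ : B →ₐ[K] C :=
    { toFun := fun b => g (Function.surjInv hf b)
      map_one' := by rw [← map_one f, hs, map_one]
      map_zero' := by rw [← map_zero f, hs, map_zero]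
      map_mul' := fun b b' => by
        obtain ⟨a, rfl⟩ := hf b
        obtain ⟨a', rfl⟩ := hf b'
        rw [← map_mul, hs, hs, hs, map_mul]
      map_add' := fun b b' => by
        obtain ⟨a, rfl⟩ := hf b
        obtain ⟨a', rfl⟩ := hf b'
        rw [← map_add, hs, hs, hs, map_add]
      commutes' := fun c => by rw [← f.commutes, hs, g.commutes] }
  have hφ : ∀ a, φ (f a) = g a := hs
  refine ⟨AlgEquiv.ofBijective φ ⟨fun b b' hb => ?_, fun c => ?_⟩, hφ⟩
  · obtain ⟨a, rfl⟩ := hf b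
    obtain ⟨a', rfl⟩ := hf b'
    rw [hφ, hφ] at hb
    exact (key _ _).2 hb
  · obtain ⟨a, rfl⟩ := hg c
    exact ⟨f a, hφ a⟩

end

end CrossedApprox

namespace CrossedApprox

noncomputable section

/-! ### Monomials and orbit matrices of the crossed product -/

namespace Crossed

variable {X : Type*} [TopologicalSpace X] {T : X ≃ₜ X} {K : Type*} [Field K]

theorem zpow_zpow_apply (i k : ℤ) (x : X) : (T ^ i) ((T ^ k) x) = (T ^ (i + k)) x := by
  rw [zpow_add]; rfl

/-- The monomial `f t^k`. -/
def mono (k : ℤ) (f : CK T K) : Crossed T K := SkewMonoidAlgebra.single (Multiplicative.ofAdd k) f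

/-- The translate `f ∘ T^k` of `f`. -/
def shift (k : ℤ) (f : CK T K) : CK T K := Multiplicative.ofAdd (-k) • f

theorem shift_apply (k : ℤ) (f : CK T K) (x : X) : shift k f x = f ((T ^ k) x) := by
  rw [shift, CK.act_apply, toAdd_ofAdd, neg_neg]

theorem mono_mul_mono (k m : ℤ) (f g : CK T K) :
    mono k f * mono m g = mono (k + m) (f * shift (-k) g) := by
  rw [mono, mono, SkewMonoidAlgebra.single_mul_single, shift, neg_neg]; rfl

theorem C_eq_mono (f : CK T K) : C f = mono 0 f := rfl

theorem t_eq_mono : t T K = mono 1 1 := rfl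

theorem one_eq_mono : (1 : Crossed T K) = mono 0 1 := rfl

theorem mono_add (k : ℤ) (f g : CK T K) : mono k (f + g) = mono k f + mono k g :=
  SkewMonoidAlgebra.single_add _ _ _

theorem mono_smul (k : ℤ) (c : K) (f : CK T K) : mono k (c • f) = c • mono k f :=
  (SkewMonoidAlgebra.smul_single _ _ _).symm

theorem t_pow (n : ℕ) : t T K ^ n = mono n 1 := by
  induction n with
  | zero => simp [one_eq_mono]
  | succ n ih =>
    rw [pow_succ, ih, t_eq_mono, mono_mul_mono]
    congr 1
    ext x; rw [CK.mul_apply, shift_apply, CK.one_apply, CK.one_apply, mul_one]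

theorem C_mul_mono (f g : CK T K) (k : ℤ) : C f * mono k g = mono k (f * g) := by
  rw [C_eq_mono, mono_mul_mono, zero_add]
  congr 1

theorem mono_mul_C (f g : CK T K) (k : ℤ) : mono k f * C g = mono k (f * shift (-k) g) := by
  rw [C_eq_mono, mono_mul_mono, add_zero]

/-- The `(i, k)` entry of the action of `a` along the orbit of `x`. -/
def ent (a : Crossed T K) (x : X) (i k : ℤ) : K :=
  (a.coeff (Multiplicative.ofAdd (i - k))) ((T ^ i) x)

theorem ent_add (a b : Crossed T K) (x : X) (i k : ℤ) :
    ent (a + b) x i k = ent a x i k + ent b x i k := by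
  simp [ent, SkewMonoidAlgebra.coeff_add]

theorem ent_zero (x : X) (i k : ℤ) : ent (0 : Crossed T K) x i k = 0 := by
  simp [ent, SkewMonoidAlgebra.coeff_zero]

theorem ent_smul (c : K) (a : Crossed T K) (x : X) (i k : ℤ) :
    ent (c • a) x i k = c * ent a x i k := by
  simp [ent, SkewMonoidAlgebra.coeff_smul]

theorem ent_shift (a : Crossed T K) (x : X) (s i k : ℤ) :
    ent a ((T ^ s) x) i k = ent a x (i + s) (k + s) := by
  rw [ent, ent, zpow_zpow_apply, add_sub_add_right_eq_sub]

/-- Row `0` of the orbit matrices at all points already lists every coefficient of `a`, so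
identities in the crossed product can be checked entrywise. -/
theorem ext_ent {a b : Crossed T K} (h : ∀ x i k, ent a x i k = ent b x i k) : a = b := by
  refine SkewMonoidAlgebra.ext fun g => CK.ext fun x => ?_
  have := h x 0 (-Multiplicative.toAdd g)
  simpa [ent] using this

theorem ent_mono (s : ℤ) (f : CK T K) (x : X) (i k : ℤ) :
    ent (mono s f) x i k = if i - k = s then f ((T ^ i) x) else 0 := by
  classical
  rw [ent, mono, SkewMonoidAlgebra.coeff_single_apply]
  by_cases h : i - k = s
  · rw [if_pos h, if_pos (by rw [h])]
  · rw [if_neg h, if_neg fun e => h (Multiplicative.ofAdd.injective e).symm]; rfl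

theorem ent_C (f : CK T K) (x : X) (i k : ℤ) :
    ent (C f) x i k = if i = k then f ((T ^ i) x) else 0 := by
  rw [C_eq_mono, ent_mono]; simp only [sub_eq_zero]

theorem ent_one (x : X) (i k : ℤ) : ent (1 : Crossed T K) x i k = if i = k then 1 else 0 := by
  rw [one_eq_mono, ← C_eq_mono, ent_C]; rfl

theorem ent_mono_mul (s : ℤ) (f : CK T K) (b : Crossed T K) (x : X) (i k : ℤ) :
    ent (mono s f * b) x i k = f ((T ^ i) x) * ent b x (i - s) k := by
  rw [ent, mono, SkewMonoidAlgebra.coeff_single_mul, CK.mul_apply, CK.act_apply, zpow_zpow_apply,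
    ent, ← ofAdd_neg, ← ofAdd_add, toAdd_ofAdd]
  congr 3
  · rw [show -s + (i - k) = i - s - k by ring]
  · rw [show -s + i = i - s by ring]

theorem ent_C_mul (f : CK T K) (b : Crossed T K) (x : X) (i k : ℤ) :
    ent (C f * b) x i k = f ((T ^ i) x) * ent b x i k := by
  rw [C_eq_mono, ent_mono_mul, sub_zero]

theorem induction_mono {p : Crossed T K → Prop} (a : Crossed T K)
    (h : ∀ k f, p (mono k f)) (hadd : ∀ a b, p a → p b → p (a + b)) : p a :=
  SkewMonoidAlgebra.induction_on' a h fun _ _ => hadd _ _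

theorem finite_support_ent (a : Crossed T K) (x : X) (i : ℤ) :
    (Function.support fun k => ent a x i k).Finite := by
  refine (a.support.finite_toSet.image fun g => i - Multiplicative.toAdd g).subset fun k hk => ?_
  refine ⟨Multiplicative.ofAdd (i - k), ?_, by simp⟩
  rw [Finset.mem_coe, SkewMonoidAlgebra.mem_support_iff]
  intro h0
  exact hk (show ent a x i k = 0 by rw [ent, h0]; rfl)

/-- A monomial `f t^m` has at most one nonzero entry in row `i`, in column `i - m`, so for monomials
the sum has one term. Rows are finite, which makes both sides additive in `a`. -/
theorem ent_mul (a b : Crossed T K) (x : X) (i k : ℤ) :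
    ent (a * b) x i k = ∑ᶠ s, ent a x i s * ent b x s k := by
  induction a using induction_mono with
  | h m f =>
    rw [ent_mono_mul, finsum_eq_single _ (i - m)]
    · rw [ent_mono, if_pos (by ring)]
    · intro s hs
      rw [ent_mono, if_neg (by omega), zero_mul]
  | hadd a a' h h' =>
    have hf : ∀ a : Crossed T K, (Function.support fun s => ent a x i s * ent b x s k).Finite :=
      fun a => (finite_support_ent a x i).subset fun s hs h0 => hs (by simp only [h0, zero_mul])
    rw [add_mul, ent_add, h, h', ← finsum_add_distrib (hf a) (hf a')]
    exact finsum_congr fun s => by rw [ent_add, add_mul]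

theorem ent_mul_fin (a b : Crossed T K) (x : X) (i k : ℤ) (N : ℕ)
    (h : ∀ s : ℤ, ¬ (0 ≤ s ∧ s < N) → ent a x i s * ent b x s k = 0) :
    ent (a * b) x i k = ∑ s : Fin N, ent a x i s * ent b x s k := by
  rw [ent_mul, ← Finset.sum_range fun s : ℕ => ent a x i s * ent b x s k,
    finsum_eq_sum_of_support_subset (s := (Finset.range N).map Nat.castEmbedding),
    Finset.sum_map]
  · rfl
  · intro s hs
    by_contra hn
    refine hs (h s fun h0 => hn ?_)
    rw [Finset.mem_coe, Finset.mem_map]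
    refine ⟨s.toNat, ?_, ?_⟩
    · rw [Finset.mem_range]; omega
    · simp [h0.1]

variable [StarRing K]

theorem star_mono (k : ℤ) (f : CK T K) : star (mono k f) = mono (-k) (shift k (star f)) :=
  star_single _ _

theorem ent_star (a : Crossed T K) (x : X) (i k : ℤ) : ent (star a) x i k = star (ent a x k i) := by
  induction a using induction_mono with
  | h m f =>
    rw [star_mono, ent_mono, ent_mono, shift_apply, zpow_zpow_apply, CK.star_apply]
    by_cases h : k - i = m
    · rw [if_pos (by omega), if_pos h, show m + i = k by omega]
    · rw [if_neg (by omega), if_neg h, star_zero]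
  | hadd a b ha hb => rw [star_add, ent_add, ha, hb, ent_add, star_add]

theorem star_C (f : CK T K) : star (C f : Crossed T K) = C (star f) := by
  rw [C_eq_mono, star_mono]; rfl

theorem C_add (f g : CK T K) : (C (f + g) : Crossed T K) = C f + C g := mono_add _ _ _

theorem C_mul (f g : CK T K) : (C (f * g) : Crossed T K) = C f * C g := (C_mul_mono f g 0).symm

theorem chi_apply {U : Set X} (hU : IsClopen U) (x : X) [Decidable (x ∈ U)] :
    chi T K hU x = if x ∈ U then 1 else 0 := by
  change LocallyConstant.charFn K hU x = _
  rw [LocallyConstant.coe_charFn, Set.indicator_apply]; congr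

theorem chi_of_mem {U : Set X} (hU : IsClopen U) {x : X} (hx : x ∈ U) : chi T K hU x = 1 := by
  classical rw [chi_apply, if_pos hx]

theorem chi_of_notMem {U : Set X} (hU : IsClopen U) {x : X} (hx : x ∉ U) : chi T K hU x = 0 := by
  classical rw [chi_apply, if_neg hx]

theorem isLocallyConstant (f : CK T K) : IsLocallyConstant f := LocallyConstant.isLocallyConstant f

theorem star_chi {U : Set X} (hU : IsClopen U) : star (chi T K hU) = chi T K hU := by
  classical
  ext x
  rw [CK.star_apply, chi_apply]
  split_ifs <;> simp

end Crossed

end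

end CrossedApprox

namespace CrossedApprox

noncomputable section

namespace ApproxSystem

variable {X : Type*} [TopologicalSpace X] [MeasurableSpace X] {S : ApproxSystem X}

open Crossed

/-! ### Atoms and towers -/

theorem y_mem_E (n : ℕ) : S.y ∈ S.E n := by
  have : S.y ∈ ⋂ n, S.E n := by rw [S.iInter_E]; rfl
  exact Set.mem_iInter.1 this n

theorem exists_atom (n : ℕ) (x : X) : ∃ A ∈ insert (S.E n) (S.P n), x ∈ A := by
  by_cases h : x ∈ S.E n
  · exact ⟨_, Set.mem_insert _ _, h⟩
  · have : x ∈ ⋃₀ S.P n := by rw [S.sUnion_P]; exact h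
    obtain ⟨Z, hZ, hx⟩ := this
    exact ⟨Z, Set.mem_insert_of_mem _ hZ, hx⟩

/-- The levels of all towers are pairwise disjoint: if `a < b`, then `T^{b-a} z = x` would be a
return of `z` to `E_n` before the end of its tower. -/
theorem Tower.level_unique {n : ℕ} {W W' : S.Tower n} {x z : X} (hx : x ∈ W.base)
    (hz : z ∈ W'.base) {a b : ℤ} (ha : 0 ≤ a) (ha' : a < W.len) (hb : 0 ≤ b) (hb' : b < W'.len)
    (h : (S.T ^ a) x = (S.T ^ b) z) : W = W' ∧ a = b ∧ x = z := by
  have key : ∀ {W W' : S.Tower n} {x z : X} {a b : ℤ}, x ∈ W.base → z ∈ W'.base → 0 ≤ a →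
      b < W'.len → (S.T ^ a) x = (S.T ^ b) z → ¬ a < b := by
    intro W W' x z a b hx hz ha hb' h hlt
    refine W'.notMem_of_lt hz (i := b - a) (by omega) (by omega) ?_
    rw [show b - a = -a + b by ring, ← zpow_zpow_apply, ← h, zpow_zpow_apply, neg_add_cancel,
      zpow_zero]
    exact W.base_subset hx
  have hab : a = b := le_antisymm (not_lt.1 (key hz hx hb ha' h.symm)) (not_lt.1 (key hx hz ha hb' h))
  subst hab
  have hxz : x = z := (S.T ^ a).injective h
  subst hxz
  exact ⟨Tower.eq_of_mem hx hz, rfl, rfl⟩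

theorem Tower.some_mem {n : ℕ} (W : S.Tower n) : W.nonempty.some ∈ W.base := W.nonempty.some_mem

variable {K : Type*} [Field K] [StarRing K]

/-- `f` is constant on the atoms of `P_n ∪ {E_n}`. -/
def IsAtomic (n : ℕ) (f : CK S.T K) : Prop :=
  ∀ A ∈ insert (S.E n) (S.P n), ∀ x ∈ A, ∀ z ∈ A, f x = f z

theorem IsAtomic.of_le {m n : ℕ} (h : m ≤ n) {f : CK S.T K} (hf : IsAtomic m f) : IsAtomic n f := by
  intro A hA x hx z hz
  obtain ⟨B, hB, hAB⟩ := S.finer_of_le h A hA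
  exact hf B hB x (hAB hx) z (hAB hz)

theorem isAtomic_chi {n : ℕ} {Z : Set X} (hZ : Z ∈ insert (S.E n) (S.P n)) (hc : IsClopen Z) :
    IsAtomic n (chi S.T K hc) := by
  classical
  intro A hA x hx z hz
  rw [chi_apply, chi_apply]
  refine if_congr ⟨fun h => ?_, fun h => ?_⟩ rfl rfl
  · rw [S.atom_eq hZ hA h hx]; exact hz
  · rw [S.atom_eq hZ hA h hz]; exact hx

theorem IsAtomic.tower {m n : ℕ} (h : m ≤ n) {f : CK S.T K} (hf : IsAtomic m f) (W : S.Tower n)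
    {x z : X} (hx : x ∈ W.base) (hz : z ∈ W.base) {i : ℕ} (hi : i ≤ W.len) :
    f ((S.T ^ (i : ℤ)) x) = f ((S.T ^ (i : ℤ)) z) := by
  obtain ⟨A, hA, h1, h2⟩ := W.same_atom hx hz hi
  exact hf.of_le h A hA _ h1 _ h2

/-! ### The representation `π_n` on `A_n` -/

theorem piN_apply (n : ℕ) (a : Crossed S.T K) (W : S.Tower n) (i k : Fin W.len) :
    S.piN K n a W i k = ent a W.nonempty.some i k := rfl

theorem piN_add (n : ℕ) (a b : Crossed S.T K) :
    S.piN K n (a + b) = S.piN K n a + S.piN K n b := by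
  funext W; ext i k; exact ent_add _ _ _ _ _

theorem piN_smul (n : ℕ) (c : K) (a : Crossed S.T K) : S.piN K n (c • a) = c • S.piN K n a := by
  funext W; ext i k; exact ent_smul _ _ _ _ _

theorem piN_sub (n : ℕ) (a b : Crossed S.T K) :
    S.piN K n (a - b) = S.piN K n a - S.piN K n b := by
  rw [eq_sub_iff_add_eq, ← piN_add, sub_add_cancel]

theorem piN_one (n : ℕ) : S.piN K n 1 = 1 := by
  funext W; ext i k
  rw [piN_apply, ent_one, Pi.one_apply, Matrix.one_apply]
  exact if_congr (by rw [Fin.ext_iff, Nat.cast_inj]) rfl rfl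

theorem piN_star (n : ℕ) (a : Crossed S.T K) : S.piN K n (star a) = star (S.piN K n a) := by
  funext W; ext i k
  exact ent_star _ _ _ _

variable (S K) in
/-- The elements of the crossed product which act along every tower over `W ∈ 𝕍_n` by a matrix that
only depends on `W`. -/
def blockAlg (n : ℕ) : Subalgebra K (Crossed S.T K) where
  carrier := {a | ∀ (W : S.Tower n), ∀ x ∈ W.base, ∀ z ∈ W.base, ∀ i k : ℤ, 0 ≤ i → i < W.len →
    (¬ (0 ≤ k ∧ k < W.len) → ent a x i k = 0) ∧ ent a x i k = ent a z i k}
  -- Rows of `a` inside a tower have no entries outside it, so the orbit product is a product of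
  -- `|W| × |W|` blocks.
  mul_mem' {a b} ha hb W x hx z hz i k h0 h1 := by
    have hs : ∀ x ∈ W.base, ∀ s : ℤ, ¬ (0 ≤ s ∧ s < W.len) → ent a x i s * ent b x s k = 0 :=
      fun x hx s h => by rw [(ha W x hx x hx i s h0 h1).1 h, zero_mul]
    rw [ent_mul_fin a b x i k W.len (hs x hx), ent_mul_fin a b z i k W.len (hs z hz)]
    refine ⟨fun h => Finset.sum_eq_zero fun s _ => ?_, Finset.sum_congr rfl fun s _ => ?_⟩
    · rw [(hb W x hx x hx s k (by omega) (by omega)).1 h, mul_zero]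
    · rw [(ha W x hx z hz i s h0 h1).2, (hb W x hx z hz s k (by omega) (by omega)).2]
  add_mem' {a b} ha hb W x hx z hz i k h0 h1 := by
    refine ⟨fun h => ?_, ?_⟩
    · rw [ent_add, (ha W x hx z hz i k h0 h1).1 h, (hb W x hx z hz i k h0 h1).1 h, add_zero]
    · rw [ent_add, ent_add, (ha W x hx z hz i k h0 h1).2, (hb W x hx z hz i k h0 h1).2]
  algebraMap_mem' c W x hx z hz i k h0 h1 := by
    rw [Algebra.algebraMap_eq_smul_one, ent_smul, ent_smul, ent_one, ent_one]
    refine ⟨fun h => ?_, rfl⟩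
    rw [if_neg (by rintro rfl; exact h ⟨h0, h1⟩), mul_zero]

theorem An_subset_blockAlg {n : ℕ} {a : Crossed S.T K} (ha : a ∈ S.An K n) :
    a ∈ blockAlg S K n := by
  revert a
  suffices h : (S.An K n).toSubalgebra ≤ blockAlg S K n from fun {a} ha => h ha
  rw [An, StarAlgebra.adjoin_toSubalgebra, Algebra.adjoin_le_iff]
  -- Rows and columns are treated together, since the adjoint of a generator is also a generator and
  -- interchanges them.
  have key : ∀ (Z : Set X) (hZ : Z ∈ S.P n), ∀ (W : S.Tower n), ∀ x ∈ W.base, ∀ z ∈ W.base,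
      ∀ i k : ℤ, (0 ≤ i ∧ i < W.len ∨ 0 ≤ k ∧ k < W.len) →
        (¬ ((0 ≤ i ∧ i < W.len) ∧ 0 ≤ k ∧ k < W.len) →
          ent (C (chi S.T K (S.isClopen_P n Z hZ)) * t S.T K) x i k = 0) ∧
        ent (C (chi S.T K (S.isClopen_P n Z hZ)) * t S.T K) x i k =
          ent (C (chi S.T K (S.isClopen_P n Z hZ)) * t S.T K) z i k := by
    intro Z hZ W x hx z hz i k hik
    rw [t_eq_mono, C_mul_mono, mul_one, ent_mono, ent_mono]
    by_cases h : i - k = 1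
    · rw [if_pos h, if_pos h]
      -- An entry leaving the tower lies in row `0` or row `|W|`; the corresponding point belongs to
      -- `E_n`, where `χ_Z` vanishes.
      refine ⟨fun hn => chi_of_notMem _ fun hm => S.notMem_E hZ hm ?_, ?_⟩
      · rcases (by omega : i = 0 ∨ i = W.len) with rfl | rfl
        · exact W.base_subset hx
        · exact W.return_mem hx
      · obtain ⟨i, rfl⟩ := Int.eq_ofNat_of_zero_le (show 0 ≤ i by omega)
        exact (isAtomic_chi (Set.mem_insert_of_mem _ hZ) _).tower le_rfl W hx hz (by omega)
    · rw [if_neg h, if_neg h]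
      exact ⟨fun _ => rfl, rfl⟩
  rintro a (⟨Z, hZ, rfl⟩ | ⟨Z, hZ, h⟩) W x hx z hz i k h0 h1
  · have := key Z hZ W x hx z hz i k (Or.inl ⟨h0, h1⟩)
    exact ⟨fun hn => this.1 fun h => hn h.2, this.2⟩
  · have := key Z hZ W x hx z hz k i (Or.inr ⟨h0, h1⟩)
    rw [← star_star a, h, ent_star, ent_star]
    exact ⟨fun hn => by rw [this.1 fun h => hn h.1, star_zero], by rw [this.2]⟩

/-- If level `a'` of `W'` lies in level `p` of `W`, row `a'` of the orbit matrix is row `p` at a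
point of `W`, translated by `a' - p`. It depends only on `W` and stays in the block, which is what
the block diagonal embedding records. -/
theorem j_piN {m n : ℕ} (h : m ≤ n) {a : Crossed S.T K} (ha : a ∈ blockAlg S K m) :
    S.j K h (S.piN K m a) = S.piN K n a := by
  funext W'; ext a' b
  obtain ⟨W, p, hs⟩ := exists_sub' h W' a'
  have hz := hs _ W'.some_mem
  have he : ent a W'.nonempty.some a' b =
      ent a ((S.T ^ ((a' : ℤ) - p)) W'.nonempty.some) p (b + p - a') := by
    rw [ent_shift]; congr 1 <;> ring
  rw [j_apply, piN_apply, he]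
  by_cases hq : ∃ q : Fin W.len, (a' : ℕ) + q = b + p
  · obtain ⟨q, e⟩ := hq
    rw [jFun_of_sub h _ hs e, piN_apply, show (b : ℤ) + p - a' = q by omega]
    exact (ha W _ W.some_mem _ hz p q (by omega) (by omega)).2
  · rw [jFun_eq_zero h _ hs fun q e => hq ⟨q, e⟩]
    refine ((ha W _ hz _ hz p _ (by omega) (by omega)).1 fun hn => hq ?_).symm
    exact ⟨⟨b + p - a', by omega⟩, by simp only; omega⟩

theorem iota_piN {m n : ℕ} (h : m ≤ n) {a : Crossed S.T K} (ha : a ∈ S.An K m) :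
    S.iota K n (S.piN K n a) = S.iota K m (S.piN K m a) := by
  rw [← j_piN h (An_subset_blockAlg ha), iota_j]

/-! ### Elements of `A_n` -/

variable (S K) in
/-- The partial isometry `χ_{X∖E_n} t`. -/
def u (n : ℕ) : Crossed S.T K := C (chi S.T K (S.isClopen_E n).compl) * t S.T K

/-- Since `f` vanishes on `E_n`, it is a linear combination of the `χ_Z` with `Z ∈ P_n`. -/
theorem IsAtomic.C_mul_t_mem {n : ℕ} {f : CK S.T K} (hf : IsAtomic n f)
    (h0 : ∀ x ∈ S.E n, f x = 0) : C f * t S.T K ∈ S.An K n := by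
  have : Fintype (S.P n) := (S.finite_P n).fintype
  have hsum : C f * t S.T K = ∑ Z : S.P n, f (S.nonempty_P n Z Z.2).some •
      (C (chi S.T K (S.isClopen_P n Z Z.2)) * t S.T K) := by
    have hterm : ∀ (s : Finset (S.P n)) x i k, ent (∑ Z ∈ s, f (S.nonempty_P n Z Z.2).some •
        (C (chi S.T K (S.isClopen_P n Z Z.2)) * t S.T K)) x i k = ∑ Z ∈ s, ent
        (f (S.nonempty_P n Z Z.2).some • (C (chi S.T K (S.isClopen_P n Z Z.2)) * t S.T K)) x i k := by
      classical
      intro s x i k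
      induction s using Finset.induction_on with
      | empty => simp [ent_zero]
      | insert a s ha ih => rw [Finset.sum_insert ha, Finset.sum_insert ha, ent_add, ih]
    refine ext_ent fun x i k => ?_
    rw [hterm, t_eq_mono, C_mul_mono, mul_one, ent_mono]
    simp only [C_mul_mono, mul_one, ent_mono, ent_smul]
    by_cases hik : i - k = 1
    · simp only [if_pos hik]
      obtain ⟨A, hA, hx⟩ := exists_atom (S := S) n ((S.T ^ i) x)
      rcases hA with rfl | hA
      · rw [h0 _ hx]
        refine (Finset.sum_eq_zero fun Z _ => ?_).symm
        rw [chi_of_notMem _ fun h => S.notMem_E Z.2 h hx, mul_zero]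
      · rw [Finset.sum_eq_single ⟨A, hA⟩]
        · rw [chi_of_mem _ hx, mul_one]
          exact hf A (Set.mem_insert_of_mem _ hA) _ hx _ (S.nonempty_P n A hA).some_mem
        · intro Z _ hne
          rw [chi_of_notMem, mul_zero]
          exact fun h => hne (Subtype.ext (S.atom_eq (Set.mem_insert_of_mem _ Z.2)
            (Set.mem_insert_of_mem _ hA) h hx))
        · exact fun h => absurd (Finset.mem_univ _) h
    · simp only [if_neg hik, mul_zero, Finset.sum_const_zero]
  rw [hsum]
  exact sum_mem fun Z _ => (S.An K n).smul_mem (StarAlgebra.subset_adjoin K _ ⟨Z, Z.2, rfl⟩) _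

theorem isAtomic_chi_compl_E (n : ℕ) : IsAtomic n (chi S.T K (S.isClopen_E n).compl) := by
  classical
  intro A hA x hx z hz
  rw [chi_apply, chi_apply]
  refine if_congr (not_congr ?_) rfl rfl
  rcases hA with rfl | hA
  · exact ⟨fun _ => hz, fun _ => hx⟩
  · exact ⟨fun h => absurd h (S.notMem_E hA hx), fun h => absurd h (S.notMem_E hA hz)⟩

theorem u_mem (n : ℕ) : u S K n ∈ S.An K n :=
  (isAtomic_chi_compl_E n).C_mul_t_mem fun _ hx => chi_of_notMem _ fun h => h hx

/-- The product `(f t)(t⁻¹ χ_{X∖E_n})` is `f χ_{X∖E_n} = f`. -/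
theorem IsAtomic.C_mem_of_vanish {n : ℕ} {f : CK S.T K} (hf : IsAtomic n f)
    (h0 : ∀ x ∈ S.E n, f x = 0) : C f ∈ S.An K n := by
  have h : C f = C f * t S.T K * star (u S K n) := by
    refine ext_ent fun x i k => ?_
    rw [u, t_eq_mono, C_mul_mono, C_mul_mono, star_mono, star_mul, star_one, mul_one, star_chi,
      one_mul, ent_C, ent_mono_mul, ent_mono, shift_apply, zpow_zpow_apply]
    by_cases hik : i = k
    · rw [if_pos hik, if_pos (by omega), show 1 + (i - 1) = i by ring]
      by_cases hx : (S.T ^ i) x ∈ S.E n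
      · rw [h0 _ hx, zero_mul]
      · rw [chi_of_mem _ hx, mul_one]
    · rw [if_neg hik, if_neg (by omega), mul_zero]
  rw [h]
  exact mul_mem (hf.C_mul_t_mem h0) (star_mem (u_mem n))

theorem C_smul_one (c : K) : (C (c • 1) : Crossed S.T K) = c • 1 := mono_smul _ _ _

theorem C_sub (f g : CK S.T K) : (C (f - g) : Crossed S.T K) = C f - C g := by
  rw [eq_sub_iff_add_eq, ← C_add, sub_add_cancel]

theorem CK_sub_apply (f g : CK S.T K) (x : X) : (f - g) x = f x - g x := rfl

/-- Subtracting the constant `f(y)`, the value of `f` on `E_n`, reduces to functions that vanish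
there. -/
theorem IsAtomic.C_mem {n : ℕ} {f : CK S.T K} (hf : IsAtomic n f) : C f ∈ S.An K n := by
  have h : IsAtomic n (f - f S.y • 1) := fun A hA x hx z hz => by
    rw [CK_sub_apply, CK_sub_apply, hf A hA x hx z hz]; rfl
  have := h.C_mem_of_vanish fun x hx => by
    rw [CK_sub_apply, hf _ (Set.mem_insert _ _) x hx _ (y_mem_E n), CK.smul_apply, CK.one_apply,
      mul_one, sub_self]
  rw [C_sub, C_smul_one] at this
  simpa using add_mem this ((S.An K n).smul_mem (one_mem _) (f S.y))

/-- The power `u^k` is `t^k` cut by the complements of `T^s(E_n)`, `0 ≤ s < k`. The cut is invisible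
to an `f` vanishing on these sets. -/
theorem C_mul_u_pow {n : ℕ} {f : CK S.T K} {k : ℕ}
    (h0 : ∀ s : ℕ, s < k → ∀ x ∈ S.E n, f ((S.T ^ (s : ℤ)) x) = 0) :
    C f * u S K n ^ k = mono k f := by
  induction k with
  | zero => simp [C_eq_mono]
  | succ k ih =>
    rw [pow_succ, ← mul_assoc, ih fun s hs => h0 s (by omega), u, t_eq_mono, C_mul_mono, mul_one,
      mono_mul_mono]
    push_cast
    congr 1
    ext x
    rw [CK.mul_apply, shift_apply]
    by_cases hx : (S.T ^ (-(k : ℤ))) x ∈ S.E n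
    · have := h0 k (by omega) _ hx
      rw [zpow_zpow_apply, add_neg_cancel, zpow_zero] at this
      rw [show f x = 0 from this, zero_mul]
    · rw [chi_of_mem _ hx, mul_one]

theorem IsAtomic.mono_mem {n : ℕ} {f : CK S.T K} (hf : IsAtomic n f) {k : ℕ}
    (h0 : ∀ s : ℕ, s < k → ∀ x ∈ S.E n, f ((S.T ^ (s : ℤ)) x) = 0) :
    mono k f ∈ S.An K n := by
  rw [← C_mul_u_pow h0]
  exact mul_mem hf.C_mem (pow_mem (u_mem n) k)

/-- The function `g` is the indicator of the part of a word of `𝕍_n` after time `0`. For length one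
it is `1 - u* u = χ_{T⁻¹(E_n)}`; a letter is prepended by `g ↦ (χ_Z t)* g (χ_Z t) = (χ_Z g) ∘ T`. -/
theorem exists_itinerary_mem (n : ℕ) (k : ℕ) (hk : 0 < k) (Z : ℕ → Set X)
    (hZ : ∀ i, 0 < i → i < k → Z i ∈ S.P n) :
    ∃ g : CK S.T K, C g ∈ S.An K n ∧
      (∀ x, ((∀ i : ℕ, 0 < i → i < k → (S.T ^ (i : ℤ)) x ∈ Z i) ∧ (S.T ^ (k : ℤ)) x ∈ S.E n) →
        g x = 1) ∧
      ∀ x, ¬ ((∀ i : ℕ, 0 < i → i < k → (S.T ^ (i : ℤ)) x ∈ Z i) ∧ (S.T ^ (k : ℤ)) x ∈ S.E n) →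
        g x = 0 := by
  induction k, hk using Nat.le_induction generalizing Z with
  | base =>
    refine ⟨1 - shift 1 (chi S.T K (S.isClopen_E n).compl), ?_, ?_, ?_⟩
    · have h : C (1 - shift 1 (chi S.T K (S.isClopen_E n).compl)) =
          1 - star (u S K n) * u S K n := by
        rw [C_sub, u, t_eq_mono, C_mul_mono, mul_one, star_mono, mono_mul_mono, star_chi]
        rw [neg_add_cancel, C_eq_mono, C_eq_mono, one_eq_mono]
        congr 2
        ext x
        rw [CK.mul_apply, shift_apply, shift_apply, neg_neg]
        classical
        rw [chi_apply]
        split_ifs <;> simp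
      rw [h]
      exact sub_mem (one_mem _) (mul_mem (star_mem (u_mem n)) (u_mem n))
    · rintro x ⟨-, hx⟩
      rw [CK_sub_apply, shift_apply, chi_of_notMem _ (not_not.2 hx), CK.one_apply, sub_zero]
    · intro x hx
      rw [CK_sub_apply, shift_apply, chi_of_mem, CK.one_apply, sub_self]
      exact fun h => hx ⟨fun i h0 h1 => absurd h0 (by omega), h⟩
  | succ k hk ih =>
    -- The induction hypothesis is applied to the word with its first letter removed, as seen from
    -- `T x`.
    obtain ⟨g, hg, h1, h0⟩ := ih (fun i => Z (i + 1)) fun i hi hi' => hZ (i + 1) (by omega) (by omega)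
    have hk' : 0 < k := hk
    have hZ1 := hZ 1 (by omega) (by omega)
    have hiff : ∀ x, ((∀ i : ℕ, 0 < i → i < k + 1 → (S.T ^ (i : ℤ)) x ∈ Z i) ∧
        (S.T ^ ((k + 1 : ℕ) : ℤ)) x ∈ S.E n) ↔ (S.T ^ (1 : ℤ)) x ∈ Z 1 ∧
        (∀ i : ℕ, 0 < i → i < k → (S.T ^ (i : ℤ)) ((S.T ^ (1 : ℤ)) x) ∈ Z (i + 1)) ∧
        (S.T ^ (k : ℤ)) ((S.T ^ (1 : ℤ)) x) ∈ S.E n := by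
      intro x
      simp only [zpow_zpow_apply]
      constructor
      · rintro ⟨h, h'⟩
        exact ⟨by simpa using h 1 (by omega) (by omega), fun i hi hi' => by
          simpa using h (i + 1) (by omega) (by omega), by simpa using h'⟩
      · rintro ⟨h, h', h''⟩
        refine ⟨fun i hi hi' => ?_, by simpa using h''⟩
        rcases (by omega : i = 1 ∨ 1 < i) with rfl | hi1
        · simpa using h
        · obtain ⟨i, rfl⟩ := Nat.exists_eq_add_of_lt hi1
          have := h' (1 + i) (by omega) (by omega)
          rw [show 1 + i + 1 = (1 + i) + 1 by ring]
          simpa using this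
    have hmem : star (C (chi S.T K (S.isClopen_P n _ hZ1)) * t S.T K) * C g *
        (C (chi S.T K (S.isClopen_P n _ hZ1)) * t S.T K) ∈ S.An K n := by
      have : C (chi S.T K (S.isClopen_P n _ hZ1)) * t S.T K ∈ S.An K n :=
        StarAlgebra.subset_adjoin K _ ⟨_, hZ1, rfl⟩
      exact mul_mem (mul_mem (star_mem this) hg) this
    refine ⟨shift 1 (chi S.T K (S.isClopen_P n _ hZ1) * g), ?_, fun x hx => ?_, fun x hx => ?_⟩
    · convert hmem using 1
      rw [t_eq_mono, C_mul_mono, mul_one, star_mono, mono_mul_C, mono_mul_mono, star_chi,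
        neg_add_cancel, C_eq_mono]
      congr 1
      classical
      ext x
      simp only [CK.mul_apply, shift_apply, neg_neg]
      rw [chi_apply]
      split_ifs <;> simp
    · rw [hiff] at hx
      rw [shift_apply, CK.mul_apply, chi_of_mem _ hx.1, h1 _ hx.2, mul_one]
    · rw [hiff] at hx
      rw [shift_apply, CK.mul_apply]
      by_cases h : (S.T ^ (1 : ℤ)) x ∈ Z 1
      · rw [h0 _ fun h' => hx ⟨h, h'⟩, mul_zero]
      · rw [chi_of_notMem _ h, zero_mul]

theorem C_chi_tower_mem {n : ℕ} (W : S.Tower n) : C (chi S.T K W.isClopen) ∈ S.An K n := by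
  classical
  obtain ⟨Z, hZ, hW⟩ := W.exists_word
  obtain ⟨g, hg, h1, h0⟩ := exists_itinerary_mem (K := K) n W.len W.len_pos Z hZ
  have : chi S.T K W.isClopen = chi S.T K (S.isClopen_E n) * g := by
    ext x
    rw [CK.mul_apply]
    by_cases hx : x ∈ W.base
    · rw [chi_of_mem _ hx, chi_of_mem _ (W.base_subset hx), h1 x, mul_one]
      rw [hW] at hx
      exact hx.2
    · rw [chi_of_notMem _ hx]
      by_cases hE : x ∈ S.E n
      · rw [h0 x, mul_zero]
        intro h
        rw [hW] at hx
        exact hx ⟨hE, h⟩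
      · rw [chi_of_notMem _ hE, zero_mul]
  rw [this, C_mul]
  exact mul_mem (isAtomic_chi (Set.mem_insert _ _) _).C_mem hg

/-- Points of `W` stay outside `E_n` at times strictly between `0` and `|W|`, so `u` acts like `t`
on every level but the last. -/
theorem u_pow_mul_C_chi {n : ℕ} (W : S.Tower n) {a : ℕ} (ha : a < W.len) :
    u S K n ^ a * C (chi S.T K W.isClopen) = mono a (shift (-a) (chi S.T K W.isClopen)) := by
  induction a with
  | zero =>
    rw [pow_zero, one_mul, C_eq_mono]
    rfl
  | succ a ih =>
    rw [pow_succ', mul_assoc, ih (by omega), u, t_eq_mono, C_mul_mono, mul_one, mono_mul_mono,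
      add_comm]
    push_cast
    congr 1
    ext x
    rw [CK.mul_apply]
    simp only [shift_apply, zpow_zpow_apply]
    rw [show -(a : ℤ) + -1 = -(a + 1) by ring]
    by_cases hx : (S.T ^ (-((a : ℤ) + 1))) x ∈ W.base
    · have := W.notMem_of_lt hx (i := a + 1) (by omega) (by omega)
      rw [zpow_zpow_apply, add_neg_cancel, zpow_zero] at this
      rw [chi_of_mem (x := x) _ this, one_mul]
    · rw [chi_of_notMem _ hx, mul_zero]

theorem e_eq {n : ℕ} (W : S.Tower n) (a b : Fin W.len) :
    e K W a b = mono ((a : ℤ) - b) (shift (-a) (chi S.T K W.isClopen)) := by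
  have h : (tInv S.T K * C (chi S.T K (S.isClopen_E n).compl)) = star (u S K n) := by
    rw [u, star_mul, star_t, star_C, star_chi]
  have hb : C (chi S.T K W.isClopen) * star (u S K n) ^ (b : ℕ) =
      star (u S K n ^ (b : ℕ) * C (chi S.T K W.isClopen)) := by
    rw [star_mul, star_pow, star_C, star_chi]
  -- Doubling the idempotent `χ_W` writes `e_{ab}` as `(u^a χ_W)(u^b χ_W)*`, to which
  -- `u_pow_mul_C_chi` applies twice.
  have hc : C (chi S.T K W.isClopen) = C (chi S.T K W.isClopen) * C (chi S.T K W.isClopen) := by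
    classical
    rw [← C_mul]
    congr 1
    ext x
    rw [CK.mul_apply, chi_apply]
    split_ifs <;> simp
  rw [e, h, hc, ← mul_assoc, mul_assoc, hb]
  change u S K n ^ (a : ℕ) * _ * _ = _
  rw [u_pow_mul_C_chi W a.2, u_pow_mul_C_chi W b.2, star_mono, mono_mul_mono]
  congr 1
  classical
  ext x
  simp only [CK.mul_apply, CK.star_apply, shift_apply, zpow_zpow_apply]
  rw [show -(b : ℤ) + (b + -a) = -a by ring, chi_apply]
  split_ifs <;> simp

theorem e_mem {n : ℕ} (W : S.Tower n) (a b : Fin W.len) : e K W a b ∈ S.An K n := by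
  have h : (tInv S.T K * C (chi S.T K (S.isClopen_E n).compl)) = star (u S K n) := by
    rw [u, star_mul, star_t, star_C, star_chi]
  rw [e, h]
  exact mul_mem (mul_mem (pow_mem (u_mem n) _) (C_chi_tower_mem W)) (pow_mem (star_mem (u_mem n)) _)

theorem hW_mem {n : ℕ} (W : S.Tower n) : hW K W ∈ S.An K n := sum_mem fun a _ => e_mem W a a

variable (S K) in
/-- `π_n` as an additive homomorphism. -/
def piNHom (n : ℕ) : Crossed S.T K →+ S.Rn K n := AddMonoidHom.mk' (S.piN K n) (piN_add n)

theorem piN_sum {ι : Type*} (n : ℕ) (s : Finset ι) (f : ι → Crossed S.T K) :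
    S.piN K n (∑ i ∈ s, f i) = ∑ i ∈ s, S.piN K n (f i) := map_sum (piNHom S K n) f s

theorem piN_e_self {n : ℕ} (W : S.Tower n) (a b : Fin W.len) :
    S.piN K n (e K W a b) W = Matrix.single a b 1 := by
  ext i k
  rw [piN_apply, e_eq, ent_mono, shift_apply, zpow_zpow_apply, Matrix.single_apply]
  by_cases h : a = i ∧ b = k
  · obtain ⟨rfl, rfl⟩ := h
    rw [if_pos rfl, if_pos ⟨rfl, rfl⟩, chi_of_mem]
    rw [neg_add_cancel, zpow_zero]
    exact W.some_mem
  · rw [if_neg h]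
    by_cases hik : (i : ℤ) - k = a - b
    · rw [if_pos hik, chi_of_notMem]
      intro hx
      have := W.level_unique hx W.some_mem (a := a) (b := i) (by omega) (by omega) (by omega)
        (by omega) (by rw [zpow_zpow_apply]; congr 2; ring)
      exact h ⟨Fin.ext (by omega), Fin.ext (by omega)⟩
    · rw [if_neg hik]

theorem piN_e_of_ne {n : ℕ} {W W' : S.Tower n} (hne : W' ≠ W) (a b : Fin W.len) :
    S.piN K n (e K W a b) W' = 0 := by
  ext i k
  rw [piN_apply, e_eq, ent_mono, shift_apply, zpow_zpow_apply, Matrix.zero_apply, ite_eq_right_iff]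
  intro _
  refine chi_of_notMem _ fun hx => hne ?_
  exact (W.level_unique hx W'.some_mem (a := a) (b := i) (by omega) (by omega) (by omega)
    (by omega) (by rw [zpow_zpow_apply]; congr 2; ring)).1.symm

theorem piN_hW_self {n : ℕ} (W : S.Tower n) : S.piN K n (hW K W) W = 1 := by
  rw [hW, piN_sum, Finset.sum_apply]
  simp only [piN_e_self]
  exact Matrix.sum_single_one

theorem piN_hW_of_ne {n : ℕ} {W W' : S.Tower n} (hne : W' ≠ W) : S.piN K n (hW K W) W' = 0 := by
  rw [hW, piN_sum, Finset.sum_apply]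
  exact Finset.sum_eq_zero fun a _ => piN_e_of_ne hne a a

end ApproxSystem

end

end CrossedApprox

namespace CrossedApprox

noncomputable section

namespace ApproxSystem

variable {X : Type*} [TopologicalSpace X] [MeasurableSpace X] {S : ApproxSystem X}

open Crossed

/-! ### Approximation by atoms -/

/-- The cells containing `x` decrease with `n`, and a generating set that contains `x` is the cell
of `x` at its stage. Hence these cells form a neighbourhood basis of `x`. -/
theorem exists_atom_subset {x : X} {U : Set X} (hU : U ∈ 𝓝 x) :
    ∃ n, ∀ A ∈ insert (S.E n) (S.P n), x ∈ A → A ⊆ U := by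
  have h0 : 𝓝 x = @nhds X (TopologicalSpace.generateFrom (⋃ n, insert (S.E n) (S.P n))) x :=
    congrArg (fun τ => @nhds X τ x) S.generates
  choose cell hcell hx using fun n => exists_atom (S := S) n x
  have hanti : Antitone cell := by
    intro m n h
    obtain ⟨B, hB, hAB⟩ := S.finer_of_le h _ (hcell n)
    rw [S.atom_eq (hcell m) hB (hx m) (hAB (hx n))]
    exact hAB
  have h1 : ⨅ n, 𝓟 (cell n) ≤ 𝓝 x := by
    rw [h0, TopologicalSpace.nhds_generateFrom]
    refine le_iInf₂ fun s hs => ?_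
    obtain ⟨n, hn⟩ := Set.mem_iUnion.1 hs.2
    rw [S.atom_eq hn (hcell n) hs.1 (hx n)]
    exact iInf_le _ n
  obtain ⟨n, hn⟩ := (mem_iInf_of_directed (f := fun n => 𝓟 (cell n))
    (directed_of_isDirected_le fun m n h => principal_mono.2 (hanti h)) U).1 (h1 hU)
  refine ⟨n, fun A hA hxA => ?_⟩
  rw [S.atom_eq hA (hcell n) hxA (hx n)]
  exact hn

theorem exists_E_subset {U : Set X} (hU : U ∈ 𝓝 S.y) : ∃ N, ∀ n ≥ N, S.E n ⊆ U := by
  obtain ⟨N, hN⟩ := S.exists_atom_subset hU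
  exact ⟨N, fun n hn => (S.E_anti hn).trans (hN _ (Set.mem_insert _ _) (y_mem_E N))⟩

section Crossed

variable {K : Type*} [Field K] [StarRing K]

/-- Around each point `f` is constant on an atom. By compactness finitely many of these atoms cover
`X`, and the largest stage involved refines them all. -/
theorem exists_isAtomic [CompactSpace X] (f : CK S.T K) : ∃ n, IsAtomic n f := by
  have h : ∀ x : X, ∃ n, ∀ A ∈ insert (S.E n) (S.P n), x ∈ A → ∀ z ∈ A, f z = f x := by
    intro x
    obtain ⟨n, hn⟩ := S.exists_atom_subset
      (((isLocallyConstant f).isOpen_fiber (f x)).mem_nhds rfl)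
    exact ⟨n, fun A hA hx z hz => hn A hA hx hz⟩
  choose n hn using h
  choose A hA hx using fun x => exists_atom (S := S) (n x) x
  have hopen : ∀ x, A x ∈ 𝓝 x := by
    intro x
    refine IsOpen.mem_nhds ?_ (hx x)
    rcases hA x with h | h
    · rw [h]; exact (S.isClopen_E _).isOpen
    · exact (S.isClopen_P _ _ h).isOpen
  obtain ⟨s, -, hs⟩ := isCompact_univ.elim_nhds_subcover A fun x _ => hopen x
  refine ⟨s.sup n, fun B hB w hw z hz => ?_⟩
  obtain ⟨x, hxs, hwx⟩ := Set.mem_iUnion₂.1 (hs (Set.mem_univ w))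
  obtain ⟨B', hB', hBB'⟩ := S.finer_of_le (Finset.le_sup (f := n) hxs) B hB
  have := S.atom_eq hB' (hA x) (hBB' hw) hwx
  subst this
  rw [hn x _ (hA x) (hx x) w hwx, hn x _ (hA x) (hx x) z (hBB' hz)]

theorem exists_forall_isAtomic_coeff [CompactSpace X] (a : Crossed S.T K) :
    ∃ N, ∀ n ≥ N, ∀ g, IsAtomic n (a.coeff g) := by
  induction a using induction_mono with
  | h k f =>
    obtain ⟨N, hN⟩ := exists_isAtomic f
    refine ⟨N, fun n hn g => ?_⟩
    classical
    rw [Crossed.mono, SkewMonoidAlgebra.coeff_single_apply]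
    split_ifs
    · exact hN.of_le hn
    · exact fun A hA x hx z hz => rfl
  | hadd a b ha hb =>
    obtain ⟨N, hN⟩ := ha
    obtain ⟨M, hM⟩ := hb
    refine ⟨max N M, fun n hn g A hA x hx z hz => ?_⟩
    rw [SkewMonoidAlgebra.coeff_add, Finsupp.add_apply, CK.add_apply, CK.add_apply,
      hN n (le_of_max_le_left hn) g A hA x hx z hz, hM n (le_of_max_le_right hn) g A hA x hx z hz]

/-- Orbit matrices are band matrices, with a width independent of the point; this `d` measures how
far edge effects reach into a tower. -/
theorem exists_degree (a : Crossed S.T K) :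
    ∃ d : ℕ, ∀ x i k, ent a x i k ≠ 0 → |i - k| ≤ d := by
  induction a using induction_mono with
  | h m f =>
    refine ⟨m.natAbs, fun x i k h => ?_⟩
    rw [ent_mono] at h
    by_cases hik : i - k = m
    · rw [hik, Int.natCast_natAbs]
    · rw [if_neg hik] at h
      exact absurd rfl h
  | hadd a b ha hb =>
    obtain ⟨N, hN⟩ := ha
    obtain ⟨M, hM⟩ := hb
    refine ⟨max N M, fun x i k h => ?_⟩
    rw [ent_add] at h
    rw [Nat.cast_max, le_max_iff]
    by_cases h0 : ent a x i k = 0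
    · exact Or.inr (hM x i k fun h1 => h (by rw [h0, h1, add_zero]))
    · exact Or.inl (hN x i k h0)

end Crossed

/-! ### Ergodicity -/

instance : IsProbabilityMeasure S.μ := S.isProbabilityMeasure

variable [BorelSpace X]

theorem measurable_zpow (i : ℤ) : Measurable (S.T ^ i : X ≃ₜ X) := (S.T ^ i).continuous.measurable

theorem measure_zpow_preimage (i : ℤ) {A : Set X} (hA : MeasurableSet A) :
    S.μ ((S.T ^ i) ⁻¹' A) = S.μ A := by
  have h1 : ∀ i : ℤ, S.μ ((S.T ^ (i + 1)) ⁻¹' A) = S.μ ((S.T ^ i) ⁻¹' A) := by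
    intro i
    rw [← S.ergodic.toMeasurePreserving.measure_preimage
      (measurable_zpow i hA).nullMeasurableSet]
    congr 1
    ext x
    rw [Set.mem_preimage, Set.mem_preimage, Set.mem_preimage, zpow_add, zpow_one]; rfl
  induction i with
  | zero => rfl
  | succ i ih => rw [h1, ih]
  | pred i ih => rw [← ih, ← h1 (-(i : ℤ) - 1), sub_add_cancel]

theorem measure_zpow_image (i : ℤ) {A : Set X} (hA : MeasurableSet A) :
    S.μ ((S.T ^ i) '' A) = S.μ A := by
  rw [← measure_zpow_preimage (-i) hA]
  congr 1
  ext x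
  constructor
  · rintro ⟨z, hz, rfl⟩
    rw [Set.mem_preimage, zpow_zpow_apply, neg_add_cancel, zpow_zero]; exact hz
  · intro hx
    exact ⟨_, hx, by rw [zpow_zpow_apply, add_neg_cancel, zpow_zero]; rfl⟩

/-- By ergodicity the complement is null; being open, it is empty because `μ` is full. -/
theorem eq_univ_of_isClosed {A : Set X} (hA : IsClosed A) (hT : S.T ⁻¹' A = A) (h0 : S.μ A ≠ 0) :
    A = Set.univ := by
  by_contra hne
  have hpos := S.full Aᶜ hA.isOpen_compl (Set.nonempty_compl.2 hne)
  rcases S.ergodic.toPreErgodic.ae_empty_or_univ hA.measurableSet hT with h | h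
  · exact h0 (by rw [measure_congr h, measure_empty])
  · rw [ae_eq_univ] at h
    exact hpos.ne' h

variable [T2Space X] [Infinite X]

/-- The orbit of `y` is finite, closed and invariant. With positive mass it would be the whole of
`X`, which is infinite. -/
theorem measure_singleton_y {l : ℕ} (hl : 0 < l) (hy : S.T^[l] S.y = S.y) : S.μ {S.y} = 0 := by
  set A : Set X := (fun i : ℕ => S.T^[i] S.y) '' Set.Iio l
  have hfin : A.Finite := (Set.finite_Iio l).image _
  have hsub : S.T '' A ⊆ A := by
    rintro _ ⟨_, ⟨i, hi, rfl⟩, rfl⟩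
    rw [Set.mem_Iio] at hi
    simp only [← Function.iterate_succ_apply' S.T]
    rcases (by omega : i + 1 = l ∨ i + 1 < l) with h | h
    · rw [Nat.succ_eq_add_one, h, hy]
      exact ⟨0, hl, rfl⟩
    · exact ⟨i + 1, h, rfl⟩
  have himg : S.T '' A = A := ((hfin.image _).eq_of_subset_of_encard_le hsub
    (S.T.injective.encard_image A).ge)
  have hinv : S.T ⁻¹' A = A := by
    conv_lhs => rw [← himg]
    exact Set.preimage_image_eq _ S.T.injective
  by_contra h0
  have := eq_univ_of_isClosed hfin.isClosed hinv fun hA =>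
    h0 (measure_mono_null (Set.singleton_subset_iff.2 (show S.y ∈ A from ⟨0, hl, rfl⟩)) hA)
  exact Set.infinite_univ (this ▸ hfin)

theorem tendsto_measure_E {l : ℕ} (hl : 0 < l) (hy : S.T^[l] S.y = S.y) :
    Tendsto (fun n => S.μ (S.E n)) atTop (𝓝 0) := by
  have := tendsto_measure_iInter_atTop (μ := S.μ) (s := S.E)
    (fun n => (S.isClopen_E n).isOpen.measurableSet.nullMeasurableSet) S.E_anti
    ⟨0, measure_ne_top _ _⟩
  rwa [S.iInter_E, measure_singleton_y hl hy] at this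

theorem measure_E_pos (n : ℕ) : 0 < S.μ (S.E n) :=
  S.full _ (S.isClopen_E n).isOpen ⟨S.y, y_mem_E n⟩

/-- The fixed points of `T^r` form a closed invariant set, so otherwise `T^r = 1`. Then all orbits
are finite and the saturation of each `E_n` is a finite union, hence clopen, hence `X`. Shrinking
`E_n` to `y` puts every point on the orbit of `y`, contradicting that `X` is infinite. -/
theorem measure_periodic {r : ℤ} (hr : r ≠ 0) :
    S.μ {x | (S.T ^ r) x = x} = 0 := by
  by_contra h0
  have hall : {x | (S.T ^ r) x = x} = Set.univ := by
    refine eq_univ_of_isClosed (isClosed_eq (S.T ^ r).continuous continuous_id) ?_ h0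
    ext x
    have : (S.T ^ r) (S.T x) = S.T ((S.T ^ r) x) := by
      have h1 := zpow_zpow_apply (T := S.T) r 1 x
      have h2 := zpow_zpow_apply (T := S.T) 1 r x
      rw [zpow_one] at h1 h2
      rw [h1, h2, add_comm]
    rw [Set.mem_preimage, Set.mem_ofPred_eq, Set.mem_ofPred_eq, this]
    exact S.T.injective.eq_iff
  have hmod : ∀ (k : ℤ) (x : X), (S.T ^ k) x = (S.T ^ (k % r)) x := by
    have hmul : ∀ (q : ℤ) (x : X), (S.T ^ (r * q)) x = x := by
      intro q x
      have h1 : S.T ^ r = 1 := Homeomorph.ext fun x => by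
        have : x ∈ {x | (S.T ^ r) x = x} := hall ▸ Set.mem_univ x
        exact this
      rw [zpow_mul, h1, one_zpow]; rfl
    intro k x
    conv_lhs => rw [← Int.emod_add_mul_ediv k r, ← zpow_zpow_apply, hmul]
  -- Restricting `s` to residues below `|r|` keeps the saturation closed, as `eq_univ_of_isClosed`
  -- requires.
  have hcover : ∀ n x, ∃ s ∈ Finset.Ico (0 : ℤ) |r|, (S.T ^ s) x ∈ S.E n := by
    intro n x
    have hB : ⋃ s ∈ Finset.Ico (0 : ℤ) |r|, (S.T ^ s) ⁻¹' S.E n = Set.univ := by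
      have hB' : ∀ x, x ∈ ⋃ s ∈ Finset.Ico (0 : ℤ) |r|, (S.T ^ s) ⁻¹' S.E n ↔
          ∃ k : ℤ, (S.T ^ k) x ∈ S.E n := by
        intro x
        simp only [Set.mem_iUnion, Set.mem_preimage, exists_prop]
        refine ⟨fun ⟨s, _, h⟩ => ⟨s, h⟩, fun ⟨k, h⟩ => ⟨k % r, ?_, hmod k x ▸ h⟩⟩
        rw [Finset.mem_Ico]
        exact ⟨Int.emod_nonneg _ hr, Int.emod_lt_abs _ hr⟩
      refine eq_univ_of_isClosed (S := S) ?_ ?_ ?_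
      · exact (isClopen_biUnion_finset fun s _ =>
          (S.isClopen_E n).preimage (S.T ^ s).continuous).isClosed
      · ext x
        rw [Set.mem_preimage, hB', hB']
        constructor
        · rintro ⟨k, hk⟩
          refine ⟨k + 1, ?_⟩
          rw [zpow_add, zpow_one]; exact hk
        · rintro ⟨k, hk⟩
          refine ⟨k - 1, ?_⟩
          have := zpow_zpow_apply (T := S.T) (k - 1) 1 x
          rw [zpow_one, sub_add_cancel] at this
          rwa [this]
      · refine ne_of_gt ((measure_E_pos (S := S) n).trans_le (measure_mono fun x hx => ?_))
        rw [hB']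
        exact ⟨0, by rw [zpow_zero]; exact hx⟩
    have hx : x ∈ ⋃ s ∈ Finset.Ico (0 : ℤ) |r|, (S.T ^ s) ⁻¹' S.E n := hB ▸ Set.mem_univ x
    simpa using hx
  -- If none of the finitely many `T^s x` is `y`, a single `E_n` avoids them all, against `hcover`.
  have horb : ∀ x, ∃ s ∈ Finset.Ico (0 : ℤ) |r|, (S.T ^ s) x = S.y := by
    intro x
    by_contra! hne
    have : ∀ s : ℤ, ∃ n, s ∈ Finset.Ico (0 : ℤ) |r| → (S.T ^ s) x ∉ S.E n := by
      intro s
      by_contra! h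
      refine hne s (h 0).1 ?_
      have : (S.T ^ s) x ∈ ⋂ n, S.E n := Set.mem_iInter.2 fun n => (h n).2
      rw [S.iInter_E] at this
      exact this
    choose n hn using this
    obtain ⟨s, hs, h⟩ := hcover ((Finset.Ico (0 : ℤ) |r|).sup n) x
    exact hn s hs (S.E_anti (Finset.le_sup hs) h)
  refine Set.infinite_univ ((((Finset.Ico (0 : ℤ) |r|).finite_toSet).image
    fun s => (S.T ^ (-s)) S.y).subset fun x _ => ?_)
  obtain ⟨s, hs, h⟩ := horb x
  refine ⟨s, hs, ?_⟩
  simp only [← h]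
  rw [zpow_zpow_apply, neg_add_cancel, zpow_zero]; rfl

/-- Almost every point lies on a level of a tower. -/
theorem ae_mem_level (n : ℕ) : ∀ᵐ x ∂S.μ, ∃ (W : S.Tower n) (i : Fin W.len), ∃ z ∈ W.base,
    x = (S.T ^ (i : ℤ)) z := by
  have hmeas : ∀ i : ℤ, MeasurableSet ((S.T ^ i) ⁻¹' S.E n) := fun i =>
    measurable_zpow i (S.isClopen_E n).isOpen.measurableSet
  -- The set of points with a strictly future visit to `E_n` contains its preimage; this one-sided
  -- invariance and positive measure make it conull. For past visits the inclusion is reversed.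
  have hfwd : ∀ᵐ x ∂S.μ, ∃ k : ℕ, (S.T ^ ((k : ℤ) + 1)) x ∈ S.E n := by
    set G : Set X := ⋃ k : ℕ, (S.T ^ ((k : ℤ) + 1)) ⁻¹' S.E n with hG
    have hGm : MeasurableSet G := MeasurableSet.iUnion fun k => hmeas _
    have hinv : S.T ⁻¹' G ⊆ G := by
      intro x hx
      obtain ⟨k, hk⟩ := Set.mem_iUnion.1 hx
      refine Set.mem_iUnion.2 ⟨k + 1, ?_⟩
      have := zpow_zpow_apply (T := S.T) (k + 1) 1 x
      rw [zpow_one] at this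
      rw [Set.mem_preimage, this] at hk
      exact_mod_cast hk
    have hpos : S.μ G ≠ 0 := by
      refine ne_of_gt ((measure_E_pos (S := S) n).trans_le ?_)
      rw [← measure_zpow_preimage ((0 : ℕ) + 1) (S.isClopen_E n).isOpen.measurableSet]
      exact measure_mono (Set.subset_iUnion (fun k : ℕ => (S.T ^ ((k : ℤ) + 1)) ⁻¹' S.E n) 0)
    rcases S.ergodic.ae_empty_or_univ_of_preimage_ae_le' hGm.nullMeasurableSet
      hinv.eventuallyLE (measure_ne_top _ _) with h | h
    · exact absurd (by rw [measure_congr h, measure_empty]) hpos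
    · filter_upwards [eventuallyEq_univ.1 h] with x hx
      exact Set.mem_iUnion.1 hx
  have hbwd : ∀ᵐ x ∂S.μ, ∃ k : ℕ, (S.T ^ (-(k : ℤ))) x ∈ S.E n := by
    set G : Set X := ⋃ k : ℕ, (S.T ^ (-(k : ℤ))) ⁻¹' S.E n with hG
    have hGm : MeasurableSet G := MeasurableSet.iUnion fun k => hmeas _
    have hinv : G ⊆ S.T ⁻¹' G := by
      intro x hx
      obtain ⟨k, hk⟩ := Set.mem_iUnion.1 hx
      refine Set.mem_iUnion.2 ⟨k + 1, ?_⟩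
      have := zpow_zpow_apply (T := S.T) (-((k + 1 : ℕ) : ℤ)) 1 x
      rw [zpow_one] at this
      rw [Set.mem_preimage, this, show -((k + 1 : ℕ) : ℤ) + 1 = -k by push_cast; ring]
      exact hk
    have hpos : S.μ G ≠ 0 := by
      refine ne_of_gt ((measure_E_pos (S := S) n).trans_le ?_)
      rw [← measure_zpow_preimage (-(0 : ℕ)) (S.isClopen_E n).isOpen.measurableSet]
      exact measure_mono (Set.subset_iUnion (fun k : ℕ => (S.T ^ (-(k : ℤ))) ⁻¹' S.E n) 0)
    rcases S.ergodic.ae_empty_or_univ_of_ae_le_preimage' hGm.nullMeasurableSet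
      hinv.eventuallyLE (measure_ne_top _ _) with h | h
    · exact absurd (by rw [measure_congr h, measure_empty]) hpos
    · filter_upwards [eventuallyEq_univ.1 h] with x hx
      exact Set.mem_iUnion.1 hx
  filter_upwards [hfwd, hbwd] with x hf hb
  classical
  -- Time `-i` is the last visit to `E_n`, possibly the present one, and time `k + 1` is the next.
  -- The tower through `x` therefore has height `i + k + 1`.
  set i := Nat.find hb with hi
  set k := Nat.find hf with hk
  have hiE := Nat.find_spec hb
  have hkE := Nat.find_spec hf
  have hmin : ∀ s : ℤ, -(i : ℤ) < s → s < k + 1 → (S.T ^ s) x ∉ S.E n := by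
    intro s h1 h2 hs
    rcases le_or_gt s 0 with h | h
    · refine Nat.find_min hb (m := s.natAbs) (by omega) ?_
      rwa [show -(s.natAbs : ℤ) = s by omega]
    · refine Nat.find_min hf (m := (s - 1).natAbs) (by omega) ?_
      rwa [show ((s - 1).natAbs : ℤ) + 1 = s by omega]
  set z := (S.T ^ (-(i : ℤ))) x with hz
  have hZ : ∀ s : ℕ, 0 < s → s < i + k + 1 → ∃ Z ∈ S.P n, (S.T ^ (s : ℤ)) z ∈ Z := by
    intro s h0 h1
    have : (S.T ^ (s : ℤ)) z ∈ ⋃₀ S.P n := by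
      rw [S.sUnion_P, hz, zpow_zpow_apply]
      exact hmin _ (by omega) (by omega)
    exact this
  choose! Z hZP hZx using hZ
  have hzW : z ∈ {x | x ∈ S.E n ∧ (∀ s : ℕ, 0 < s → s < i + k + 1 → (S.T ^ (s : ℤ)) x ∈ Z s) ∧
      (S.T ^ ((i + k + 1 : ℕ) : ℤ)) x ∈ S.E n} := by
    refine ⟨hiE, hZx, ?_⟩
    rw [hz, zpow_zpow_apply, show ((i + k + 1 : ℕ) : ℤ) + -i = k + 1 by push_cast; ring]
    exact hkE
  have hxz : x = (S.T ^ (i : ℤ)) z := by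
    rw [hz, zpow_zpow_apply, add_neg_cancel, zpow_zero]; rfl
  exact ⟨⟨_, i + k + 1, by omega, ⟨z, hzW⟩, Z, hZP, rfl⟩, ⟨i, by simp only; omega⟩, z, hzW, hxz⟩

end ApproxSystem

end

end CrossedApprox

namespace CrossedApprox

noncomputable section

namespace ApproxSystem

variable {X : Type*} [TopologicalSpace X] [MeasurableSpace X] {S : ApproxSystem X}

open Crossed

/-! ### Rank estimates -/

variable (S) in
/-- The points that come within time `d` of `E_n`. -/
def near (n d : ℕ) : Set X := {x | ∃ s : ℤ, |s| ≤ d ∧ (S.T ^ s) x ∈ S.E n}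

/-- Nearness to `E_n` is a property of a level of the tower, not of the point on it. Visits inside
the tower are dictated by the itinerary. A visit beyond an end is replaced by that end, which lies
in `E_m ⊆ E_n` and is closer. -/
theorem near_tower {m n d : ℕ} (h : n ≤ m) (W : S.Tower m) {x z : X} (hx : x ∈ W.base)
    (hz : z ∈ W.base) {i : ℕ} (hi : i ≤ W.len) (hD : (S.T ^ (i : ℤ)) x ∈ near S n d) :
    (S.T ^ (i : ℤ)) z ∈ near S n d := by
  obtain ⟨s, hs, hE⟩ := hD
  rw [zpow_zpow_apply] at hE
  rcases lt_or_ge (s + i) 0 with h1 | h1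
  · refine ⟨-i, by rw [abs_le] at hs ⊢; omega, ?_⟩
    rw [zpow_zpow_apply, neg_add_cancel, zpow_zero]
    exact S.E_anti h (W.base_subset hz)
  · rcases le_or_gt (s + i) W.len with h2 | h2
    · refine ⟨s, hs, ?_⟩
      rw [zpow_zpow_apply]
      obtain ⟨p, hp⟩ := Int.eq_ofNat_of_zero_le h1
      rw [hp] at hE ⊢
      exact W.mem_atom_of_mem h hx hz (by omega) (Set.mem_insert _ _) hE
    · refine ⟨W.len - i, by rw [abs_le] at hs ⊢; omega, ?_⟩
      rw [zpow_zpow_apply, sub_add_cancel]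
      exact S.E_anti h (W.return_mem hz)

variable {K : Type*} [Field K] [StarRing K]

/-- The rows of `M` outside of `D` vanish. -/
def RowsIn {n : ℕ} (M : S.Rn K n) (D : Set X) : Prop :=
  ∀ (W : S.Tower n) (a : Fin W.len), (S.T ^ (a : ℤ)) W.nonempty.some ∉ D → ∀ b, M W a b = 0

theorem RowsIn.j {m n k d : ℕ} (hnm : n ≤ m) (hmk : m ≤ k) {M : S.Rn K m}
    (hM : RowsIn M (near S n d)) : RowsIn (S.j K hmk M) (near S n d) := by
  intro W' a ha b
  obtain ⟨W, p, hs⟩ := exists_sub' hmk W' a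
  rw [j_apply]
  by_cases hq : ∃ q : Fin W.len, (a : ℕ) + q = b + p
  · obtain ⟨q, e⟩ := hq
    rw [jFun_of_sub hmk M hs e]
    refine hM W p (fun hD => ha ?_) q
    have := near_tower hnm W W.some_mem (hs _ W'.some_mem) p.2.le hD
    rwa [zpow_zpow_apply, add_sub_cancel] at this
  · exact jFun_eq_zero hmk M hs fun q e => hq ⟨q, e⟩

variable [BorelSpace X]

theorem measure_near_le (n d : ℕ) : S.μ (near S n d) ≤ (2 * d + 1) * S.μ (S.E n) := by
  have : near S n d ⊆ ⋃ s ∈ Finset.Icc (-(d : ℤ)) d, (S.T ^ s) ⁻¹' S.E n := by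
    rintro x ⟨s, hs, hE⟩
    exact Set.mem_iUnion₂.2 ⟨s, Finset.mem_Icc.2 (abs_le.1 hs), hE⟩
  refine (measure_mono this).trans ((measure_biUnion_finset_le _ _).trans ?_)
  simp only [measure_zpow_preimage _ (S.isClopen_E n).isOpen.measurableSet, Finset.sum_const,
    Int.card_Icc, nsmul_eq_mul]
  gcongr
  rw [show ((d : ℤ) + 1 - -d).toNat = 2 * d + 1 by omega]
  push_cast
  rfl

/-- The part of `D` formed by the levels of towers whose base point lies in `D`. -/
def levelIn (D : Set X) {n : ℕ} (w : Σ W : S.Tower n, Fin W.len) : Set X :=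
  {x | (S.T ^ (w.2 : ℤ)) w.1.nonempty.some ∈ D ∧ ∃ z ∈ w.1.base, x = (S.T ^ (w.2 : ℤ)) z}

open Classical in
theorem measure_levelIn (D : Set X) {n : ℕ} (W : S.Tower n) (a : Fin W.len) :
    S.μ (levelIn D ⟨W, a⟩) =
      if (S.T ^ (a : ℤ)) W.nonempty.some ∈ D then S.μ W.base else 0 := by
  split_ifs with h
  · rw [← measure_zpow_image (a : ℤ) W.isClopen.isOpen.measurableSet]
    congr 1
    ext x
    exact ⟨fun ⟨_, z, hz, e⟩ => ⟨z, hz, e.symm⟩, fun ⟨z, hz, e⟩ => ⟨h, z, hz, e.symm⟩⟩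
  · rw [show levelIn D ⟨W, a⟩ = ∅ from Set.eq_empty_of_forall_notMem fun x hx => h hx.1,
      measure_empty]

theorem measurableSet_levelIn (D : Set X) {n : ℕ} (w : Σ W : S.Tower n, Fin W.len) :
    MeasurableSet (levelIn D w) := by
  by_cases h : (S.T ^ (w.2 : ℤ)) w.1.nonempty.some ∈ D
  · have : levelIn D w = (S.T ^ (w.2 : ℤ)) '' w.1.base := by
      ext x
      exact ⟨fun ⟨_, z, hz, e⟩ => ⟨z, hz, e.symm⟩, fun ⟨z, hz, e⟩ => ⟨h, z, hz, e.symm⟩⟩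
    rw [this]
    exact ((S.T ^ (w.2 : ℤ)).isOpen_image.2 w.1.isClopen.isOpen).measurableSet
  · rw [show levelIn D w = ∅ from Set.eq_empty_of_forall_notMem fun x hx => h hx.1]
    exact MeasurableSet.empty

theorem pairwise_disjoint_levelIn (D : Set X) (n : ℕ) :
    Pairwise (Function.onFun Disjoint
      (levelIn D : (Σ W : S.Tower n, Fin W.len) → Set X)) := by
  rintro ⟨W, a⟩ ⟨W', a'⟩ hne
  rw [Function.onFun, Set.disjoint_left]
  rintro x ⟨-, z, hz, e⟩ ⟨-, z', hz', e'⟩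
  refine hne ?_
  have := W.level_unique hz hz' (a := a) (b := a') (Int.natCast_nonneg _) (by omega)
    (Int.natCast_nonneg _) (Nat.cast_lt.2 a'.2) (e.symm.trans e')
  obtain ⟨rfl, h, -⟩ := this
  congr
  exact Fin.ext (by omega)

open Classical in
theorem tsum_measure_levelIn (D : Set X) (n : ℕ) :
    ∑' w : Σ W : S.Tower n, Fin W.len, S.μ (levelIn D w) = ∑' W : S.Tower n, S.μ W.base *
      (Fintype.card {a : Fin W.len // (S.T ^ (a : ℤ)) W.nonempty.some ∈ D} : ENNReal) := by
  rw [ENNReal.tsum_sigma']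
  refine tsum_congr fun W => ?_
  rw [tsum_fintype]
  simp only [measure_levelIn]
  rw [← Finset.sum_filter, Finset.sum_const, nsmul_eq_mul, mul_comm, Fintype.card_subtype]

/-- The rank of `M W` is at most the number of its admissible rows. The weighted count is the total
measure of the corresponding levels, which are disjoint and contained in `near S n d`. -/
theorem rkN_le_of_rowsIn {m n d : ℕ} (h : n ≤ m) {M : S.Rn K m} (hM : RowsIn M (near S n d)) :
    S.rkN m M ≤ S.μ (near S n d) := by
  classical
  have h1 : S.rkN m M ≤ ∑' w : Σ W : S.Tower m, Fin W.len, S.μ (levelIn (near S n d) w) := by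
    rw [tsum_measure_levelIn]
    refine ENNReal.tsum_le_tsum fun W => ?_
    gcongr
    set w : Fin W.len → K := fun a =>
      if (S.T ^ (a : ℤ)) W.nonempty.some ∈ near S n d then 1 else 0 with hw
    -- Multiplying by this diagonal projection does not change `M W`, so its rank is bounded by that
    -- of the projection.
    have hMw : M W = Matrix.diagonal w * M W := by
      ext a b
      rw [Matrix.diagonal_mul]
      by_cases ha : (S.T ^ (a : ℤ)) W.nonempty.some ∈ near S n d
      · simp only [hw, if_pos ha, one_mul]
      · rw [hM W a ha b, mul_zero]
    rw [hMw]
    refine (Matrix.rank_mul_le_left _ _).trans ?_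
    rw [Matrix.rank_diagonal]
    refine (Fintype.card_congr (Equiv.subtypeEquivRight fun a => ?_)).le
    simp [hw]
  refine h1.trans ((tsum_meas_le_meas_iUnion_of_disjoint S.μ
    (measurableSet_levelIn _) (pairwise_disjoint_levelIn _ _)).trans
      (measure_mono (Set.iUnion_subset fun w x hx => ?_)))
  obtain ⟨hD, z, hz, rfl⟩ := hx
  exact near_tower h w.1 w.1.some_mem hz w.2.2.le hD

theorem rkInf_le_of_rowsIn {m n d : ℕ} (h : n ≤ m) {M : S.Rn K m} (hM : RowsIn M (near S n d)) :
    rkInf (S.iota K m M) ≤ S.μ (near S n d) := by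
  rw [rkInf_iota, rkLim]
  refine limsup_le_of_le (by isBoundedDefault) (Eventually.of_forall fun k => ?_)
  split_ifs with hk
  · exact rkN_le_of_rowsIn (h.trans hk) (hM.j h hk)
  · exact zero_le

/-! ### Approximation of the crossed product by the `𝕽_n` -/

/-- Compressing to a tower loses only the terms in which `a` leaves it. By the band condition this
happens only in rows within `d` of an end, and both ends are in `E_n`. -/
theorem rowsIn_piN_mul {n d : ℕ} {a : Crossed S.T K} (b : Crossed S.T K)
    (ha : ∀ x i k, ent a x i k ≠ 0 → |i - k| ≤ d) :
    RowsIn (S.piN K n (a * b) - S.piN K n a * S.piN K n b) (near S n d) := by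
  intro W i hi k
  rw [Pi.sub_apply, Matrix.sub_apply, sub_eq_zero, Pi.mul_apply, Matrix.mul_apply, piN_apply,
    ent_mul_fin a b _ i k W.len]
  · rfl
  · intro s hs
    by_contra hne
    have h := abs_le.1 (ha _ _ _ (left_ne_zero_of_mul hne))
    refine hi ?_
    rcases (by omega : s < 0 ∨ (W.len : ℤ) ≤ s) with h1 | h1
    · refine ⟨-i, by rw [abs_le]; omega, ?_⟩
      rw [zpow_zpow_apply, neg_add_cancel, zpow_zero]
      exact W.base_subset W.some_mem
    · refine ⟨W.len - i, by rw [abs_le]; omega, ?_⟩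
      rw [zpow_zpow_apply, sub_add_cancel]
      exact W.return_mem W.some_mem

/-- Coarse and fine compressions agree on entries inside a block of stage `n`. The entries of the
fine one that cross blocks have length at most `d`, hence start near an end of a block. -/
theorem rowsIn_j_piN_sub {m n d : ℕ} (h : n ≤ m) {a : Crossed S.T K}
    (ha : ∀ x i k, ent a x i k ≠ 0 → |i - k| ≤ d) (hat : ∀ g, IsAtomic n (a.coeff g)) :
    RowsIn (S.j K h (S.piN K n a) - S.piN K m a) (near S n d) := by
  intro W' i hi k
  obtain ⟨W, p, hs⟩ := exists_sub' h W' i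
  have hz := hs _ W'.some_mem
  rw [Pi.sub_apply, Matrix.sub_apply, sub_eq_zero, j_apply, piN_apply]
  by_cases hq : ∃ q : Fin W.len, (i : ℕ) + q = k + p
  · obtain ⟨q, e⟩ := hq
    rw [jFun_of_sub h _ hs e, piN_apply, ent, ent, show (i : ℤ) - k = p - q by omega,
      (hat _).tower le_rfl W W.some_mem hz p.2.le, zpow_zpow_apply, add_sub_cancel]
  · rw [jFun_eq_zero h _ hs fun q e => hq ⟨q, e⟩]
    by_contra hne
    have hd := abs_le.1 (ha _ _ _ (Ne.symm hne))
    refine hi ?_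
    have : ¬ (0 ≤ (k : ℤ) + p - i ∧ (k : ℤ) + p - i < W.len) := fun hn =>
      hq ⟨⟨k + p - i, by omega⟩, by simp only; omega⟩
    rcases (by omega : (k : ℤ) + p - i < 0 ∨ (W.len : ℤ) ≤ k + p - i) with h1 | h1
    · refine ⟨-p, by rw [abs_le]; omega, ?_⟩
      rw [zpow_zpow_apply, neg_add_eq_sub]
      exact W.base_subset hz
    · refine ⟨W.len - p, by rw [abs_le]; omega, ?_⟩
      have := W.return_mem hz
      rwa [zpow_zpow_apply, show (W.len : ℤ) + (i - p) = W.len - p + i by ring,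
        ← zpow_zpow_apply] at this

/-- Each level is inside `U` or disjoint from it, and almost every point is on a level. The diagonal
matrix of `χ_U` thus has weighted rank accounting for all of `U`. -/
theorem le_rkN_piN_C_chi [SecondCountableTopology X] [T2Space X] [Infinite X] {m : ℕ} {U : Set X}
    (hU : IsClopen U)
    (hat : IsAtomic m (chi S.T K hU)) : S.μ U ≤ S.rkN m (S.piN K m (C (chi S.T K hU))) := by
  classical
  have hiff : ∀ (W : S.Tower m) (i : Fin W.len), ∀ z ∈ W.base, (S.T ^ (i : ℤ)) z ∈ U →
      (S.T ^ (i : ℤ)) W.nonempty.some ∈ U := by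
    intro W i z hz hzU
    by_contra hn
    have := hat.tower le_rfl W hz W.some_mem i.2.le
    rw [chi_of_mem _ hzU, chi_of_notMem _ hn] at this
    exact one_ne_zero this
  -- Countable subadditivity needs countably many towers; their bases are disjoint nonempty open
  -- sets in a second countable space.
  have hcount : Countable (Σ W : S.Tower m, Fin W.len) := by
    have : Countable (S.Tower m) := by
      refine Pairwise.countable_of_isOpen_disjoint (s := Tower.base) (fun W W' hne => ?_)
        (fun W => W.isClopen.isOpen) (fun W => W.nonempty)
      exact Set.disjoint_left.2 fun x hx hx' => hne (Tower.eq_of_mem hx hx')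
    infer_instance
  have h1 : S.μ U ≤ ∑' w : Σ W : S.Tower m, Fin W.len, S.μ (levelIn U w) := by
    refine le_trans (measure_mono_ae ?_) (measure_iUnion_le _)
    filter_upwards [ae_mem_level (S := S) m] with x hx hxU
    obtain ⟨W, i, z, hz, rfl⟩ := hx
    exact Set.mem_iUnion.2 ⟨⟨W, i⟩, hiff W i z hz hxU, z, hz, rfl⟩
  refine h1.trans (le_of_eq ?_)
  rw [tsum_measure_levelIn]
  refine tsum_congr fun W => ?_
  congr 1
  rw [Nat.cast_inj]
  have : S.piN K m (C (chi S.T K hU)) W =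
      Matrix.diagonal fun i : Fin W.len => chi S.T K hU ((S.T ^ (i : ℤ)) W.nonempty.some) := by
    ext i k
    rw [piN_apply, ent_C, Matrix.diagonal_apply]
    exact if_congr (by rw [Fin.ext_iff, Nat.cast_inj]) rfl rfl
  rw [this, Matrix.rank_diagonal]
  refine Fintype.card_congr (Equiv.subtypeEquivRight fun a => ?_)
  rw [chi_apply]
  simp

theorem le_rkInf_of_eventually {n : ℕ} {M : S.Rn K n} {c : ENNReal}
    (h : ∀ m (h : n ≤ m), c ≤ S.rkN m (S.j K h M)) : c ≤ rkInf (S.iota K n M) := by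
  rw [rkInf_iota, rkLim]
  refine le_limsup_of_le (by isBoundedDefault) fun b hb => ?_
  obtain ⟨m, hm, hn⟩ := (hb.and (eventually_ge_atTop n)).exists
  rw [dif_pos hn] at hm
  exact (h m hn).trans hm

/-! ### The embedding of the crossed product into `𝕽_rk` -/

variable (S K) in
/-- The canonical map `𝕽_∞ → 𝕽_rk`. -/
def toRk : S.RInf K →⋆ₐ[K] S.RRk K where
  toFun x := x
  map_one' := rfl
  map_mul' := UniformSpace.Completion.coe_mul
  map_zero' := rfl
  map_add' := UniformSpace.Completion.coe_add
  commutes' _ := rfl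
  map_star' x := (star_coe x).symm

theorem continuous_toRk : Continuous (toRk S K) := UniformSpace.Completion.continuous_coe _

theorem toRk_eq_zero_iff (x : S.RInf K) : toRk S K x = 0 ↔ rkInf x = 0 := by
  rw [← map_zero (toRk S K), ← inseparable_iff_eq]
  change Inseparable (x : S.RRk K) ((0 : S.RInf K) : S.RRk K) ↔ _
  rw [(UniformSpace.Completion.isUniformInducing_coe (S.RInf K)).isInducing.inseparable_iff,
    EMetric.inseparable_iff, edist_def, sub_zero]

variable (S K) in
/-- The sequence of approximations of `a` in `𝕽_∞`. -/
def approx (a : Crossed S.T K) (n : ℕ) : S.RInf K := S.iota K n (S.piN K n a)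

theorem tendsto_near (hE : Tendsto (fun n => S.μ (S.E n)) atTop (𝓝 0)) (d : ℕ) :
    Tendsto (fun n => S.μ (near S n d)) atTop (𝓝 0) := by
  have : Tendsto (fun n => (2 * d + 1 : ENNReal) * S.μ (S.E n)) atTop (𝓝 0) := by
    have := ENNReal.Tendsto.const_mul (a := (2 * d + 1 : ENNReal)) hE
      (Or.inr (by finiteness))
    rwa [mul_zero] at this
  exact tendsto_of_tendsto_of_tendsto_of_le_of_le tendsto_const_nhds this (fun _ => zero_le)
    fun n => measure_near_le n d

theorem cauchySeq_approx [CompactSpace X] (hE : Tendsto (fun n => S.μ (S.E n)) atTop (𝓝 0))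
    (a : Crossed S.T K) : CauchySeq (approx S K a) := by
  obtain ⟨N, hN⟩ := exists_forall_isAtomic_coeff a
  obtain ⟨d, hd⟩ := exists_degree a
  rw [EMetric.cauchySeq_iff]
  intro ε hε
  obtain ⟨N', hN'⟩ := eventually_atTop.1 ((tendsto_near hE d).eventually (gt_mem_nhds hε))
  have key : ∀ n ≥ max N N', ∀ m ≥ n, edist (approx S K a n) (approx S K a m) < ε := by
    intro n hn m hm
    refine lt_of_le_of_lt ?_ (hN' n (le_of_max_le_right hn))
    rw [edist_def, approx, approx, ← iota_j hm, ← map_sub]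
    exact rkInf_le_of_rowsIn hm (rowsIn_j_piN_sub hm hd (hN n (le_of_max_le_left hn)))
  refine ⟨max N N', fun m hm n hn => ?_⟩
  rcases le_total m n with h | h
  · exact key m hm n h
  · rw [edist_comm]; exact key n hn m h

theorem tendsto_approx_mul_sub (hE : Tendsto (fun n => S.μ (S.E n)) atTop (𝓝 0))
    (a b : Crossed S.T K) :
    Tendsto (fun n => approx S K (a * b) n - approx S K a n * approx S K b n) atTop (𝓝 0) := by
  obtain ⟨d, hd⟩ := exists_degree a
  rw [EMetric.tendsto_atTop]
  intro ε hε
  obtain ⟨N', hN'⟩ := eventually_atTop.1 ((tendsto_near hE d).eventually (gt_mem_nhds hε))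
  refine ⟨N', fun n hn => lt_of_le_of_lt ?_ (hN' n hn)⟩
  rw [edist_def, sub_zero, approx, approx, approx, ← map_mul, ← map_sub]
  exact rkInf_le_of_rowsIn le_rfl (rowsIn_piN_mul b hd)

theorem approx_of_mem {n : ℕ} {a : Crossed S.T K} (ha : a ∈ S.An K n) {m : ℕ} (h : n ≤ m) :
    approx S K a m = S.iota K n (S.piN K n a) := iota_piN h ha

/-- The map is `a ↦ lim π_n(a)`. Linearity and the involution hold at each stage, whereas
multiplicativity appears only in the limit. -/
theorem exists_starAlgHom [CompactSpace X] (hE : Tendsto (fun n => S.μ (S.E n)) atTop (𝓝 0)) :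
    ∃ Φ : Crossed S.T K →⋆ₐ[K] S.RRk K, ∀ a,
      Tendsto (fun n => toRk S K (approx S K a n)) atTop (𝓝 (Φ a)) := by
  have h : ∀ a : Crossed S.T K, ∃ x : S.RRk K,
      Tendsto (fun n => toRk S K (approx S K a n)) atTop (𝓝 x) := fun a =>
    cauchySeq_tendsto_of_complete ((UniformSpace.Completion.uniformContinuous_coe
      (S.RInf K)).comp_cauchySeq (cauchySeq_approx hE a))
  choose φ hφ using h
  have huniq : ∀ {a : Crossed S.T K} {x : S.RRk K},
      Tendsto (fun n => toRk S K (approx S K a n)) atTop (𝓝 x) → φ a = x := fun h =>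
    tendsto_nhds_unique (hφ _) h
  have halg : ∀ c : K, φ (algebraMap K _ c) = algebraMap K _ c := by
    intro c
    refine huniq (tendsto_const_nhds.congr fun n => ?_)
    rw [approx, Algebra.algebraMap_eq_smul_one (A := Crossed S.T K), piN_smul, piN_one, map_smul, map_smul, map_one,
      map_one, Algebra.algebraMap_eq_smul_one]
  refine ⟨{
    toFun := φ
    map_one' := by simpa using halg 1
    map_mul' := fun a b => huniq ?_
    map_zero' := by simpa using halg 0
    map_add' := fun a b => huniq ?_
    commutes' := halg
    map_star' := fun a => huniq ?_ }, hφ⟩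
  · have h1 := (continuous_toRk.tendsto _).comp (tendsto_approx_mul_sub hE a b)
    rw [map_zero] at h1
    have h2 := h1.add ((hφ a).mul (hφ b))
    rw [zero_add] at h2
    refine h2.congr fun n => ?_
    simp only [Function.comp_apply, map_sub, map_mul, sub_add_cancel]
  · refine ((hφ a).add (hφ b)).congr fun n => ?_
    rw [approx, approx, approx, piN_add, map_add, map_add]
  · refine (((continuous_star.tendsto _).comp (hφ a))).congr fun n => ?_
    rw [Function.comp_apply, approx, approx, piN_star, map_star, map_star]

/-- An entry of `t` inside a tower lies in a row `i ≥ 1`, that is, off `E_n`, where the cut does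
nothing. -/
theorem piN_u (n : ℕ) : S.piN K n (u S K n) = S.piN K n (t S.T K) := by
  funext W; ext i k
  rw [piN_apply, piN_apply, u, t_eq_mono, C_mul_mono, mul_one, ent_mono, ent_mono]
  split_ifs with h
  · exact chi_of_mem _ (W.notMem_of_lt W.some_mem (by omega) (by omega))
  · rfl

/-! ### Injectivity of the embedding by cutting down to characteristic functions -/

theorem exists_aperiodic [T2Space X] [Infinite X] {U : Set X} (hU : IsOpen U) (hne : U.Nonempty)
    (s : Finset ℤ) : ∃ x ∈ U, ∀ r ∈ s, r ≠ 0 → (S.T ^ r) x ≠ x := by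
  by_contra! h
  have hsub : U ⊆ ⋃ r ∈ s.filter (· ≠ 0), {x | (S.T ^ r) x = x} := by
    intro x hx
    obtain ⟨r, hr, h0, e⟩ := h x hx
    exact Set.mem_iUnion₂.2 ⟨r, Finset.mem_filter.2 ⟨hr, h0⟩, e⟩
  refine (S.full U hU hne).ne' (measure_mono_null hsub ?_)
  exact (measure_biUnion_null_iff (Finset.countable_toSet (s.filter (· ≠ 0)))).2
    fun r hr => measure_periodic (Finset.mem_filter.1 hr).2

/-- Let the coefficient `f` of `t^m` be nonzero. By aperiodicity there is a small `V` disjoint from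
`T^r V` for the other relative exponents `r`. Compressing `a t^{-m}` by `χ_V` then leaves only `f`.
Where `f` takes one nonzero value, dividing by it gives `χ_U`. -/
theorem exists_cut_down [T2Space X] [CompactSpace X] [TotallyDisconnectedSpace X] [Infinite X]
    {a : Crossed S.T K} (ha : a ≠ 0) :
    ∃ (U : Set X) (hU : IsClopen U) (b c : Crossed S.T K), U.Nonempty ∧
      b * a * c = C (chi S.T K hU) := by
  classical
  obtain ⟨x, i, k, hik⟩ : ∃ x i k, ent a x i k ≠ 0 := by
    by_contra! h
    exact ha (ext_ent fun x i k => by rw [h, ent_zero])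
  set z := (S.T ^ i) x with hz
  set m := i - k with hm
  -- The point `z` may itself be periodic; it is replaced by an aperiodic `w` in the open set where
  -- `f` has the same value.
  obtain ⟨w, hw, hper⟩ := exists_aperiodic (S := S)
    ((isLocallyConstant (a.coeff (Multiplicative.ofAdd m))).isOpen_fiber (ent a x i k)) ⟨z, rfl⟩
    (a.support.image fun g => Multiplicative.toAdd g - m)
  set f := a.coeff (Multiplicative.ofAdd m) with hf
  have hw : f w = ent a x i k := hw
  obtain ⟨V, hV, hwV, hVdisj⟩ : ∃ V : Set X, IsClopen V ∧ w ∈ V ∧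
      ∀ r ∈ a.support.image fun g => Multiplicative.toAdd g - m, r ≠ 0 →
        ∀ v ∈ V, (S.T ^ (-r)) v ∉ V := by
    have h1 : ∀ r : ℤ, ∃ V : Set X, IsClopen V ∧ w ∈ V ∧
        ((r ∈ a.support.image fun g => Multiplicative.toAdd g - m) → r ≠ 0 →
          ∀ v ∈ V, (S.T ^ (-r)) v ∉ V) := by
      intro r
      by_cases hr : (r ∈ a.support.image fun g => Multiplicative.toAdd g - m) ∧ r ≠ 0
      · have hne := hper r hr.1 hr.2
        have hne' : (S.T ^ (-r)) w ≠ w := fun e => hne (by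
          conv_lhs => rw [← e]
          rw [zpow_zpow_apply, add_neg_cancel, zpow_zero]; rfl)
        obtain ⟨A, hA, hwA, hwA'⟩ := exists_isClopen_of_totally_separated hne'.symm
        refine ⟨A ∩ (S.T ^ (-r)) ⁻¹' Aᶜ, hA.inter (hA.compl.preimage (S.T ^ (-r)).continuous),
          ⟨hwA, hwA'⟩, fun _ _ v hv hv' => hv.2 hv'.1⟩
      · exact ⟨Set.univ, isClopen_univ, trivial, fun h h' => absurd ⟨h, h'⟩ hr⟩
    choose V hV hwV hVd using h1
    refine ⟨⋂ r ∈ a.support.image fun g => Multiplicative.toAdd g - m, V r,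
      isClopen_biInter_finset fun r _ => hV r, Set.mem_iInter₂.2 fun r _ => hwV r,
      fun r hr h0 v hv hv' => hVd r hr h0 v (Set.mem_iInter₂.1 hv r hr)
        (Set.mem_iInter₂.1 hv' r hr)⟩
  set U : Set X := V ∩ f ⁻¹' {ent a x i k} with hUdef
  have hU : IsClopen U := hV.inter ⟨(isLocallyConstant f).isClosed_fiber _,
    (isLocallyConstant f).isOpen_fiber _⟩
  refine ⟨U, hU, (ent a x i k)⁻¹ • C (chi S.T K hU), mono (-m) 1 * C (chi S.T K hU),
    ⟨w, hwV, hw⟩, ?_⟩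
  refine ext_ent fun x' p q => ?_
  rw [mono_mul_C, one_mul, neg_neg, ent_mul, finsum_eq_single _ (q - m), smul_mul_assoc, ent_smul,
    ent_C_mul, ent_mono, ent_C, shift_apply, zpow_zpow_apply, if_pos (by ring), add_sub_cancel]
  · by_cases hpq : p = q
    · subst hpq
      rw [if_pos rfl]
      by_cases hx : (S.T ^ p) x' ∈ U
      · have hv : ent a x' p (p - m) = ent a x i k := by
          rw [← show f ((S.T ^ p) x') = ent a x i k from hx.2, ent, sub_sub_cancel]
        rw [chi_of_mem _ hx, hv, one_mul, mul_one, inv_mul_cancel₀ hik]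
      · rw [chi_of_notMem _ hx]; simp
    · rw [if_neg hpq]
      by_contra hne
      have hpU : (S.T ^ p) x' ∈ U := by
        by_contra hn; rw [chi_of_notMem _ hn] at hne; simp at hne
      have hqU : (S.T ^ q) x' ∈ U := by
        by_contra hn; rw [chi_of_notMem _ hn] at hne; simp at hne
      have hent : ent a x' p (q - m) ≠ 0 := by
        intro h0; rw [h0] at hne; simp at hne
      refine hVdisj (p - q) (Finset.mem_image.2 ⟨Multiplicative.ofAdd (p - (q - m)), ?_, ?_⟩)
        (sub_ne_zero.2 hpq) _ hpU.1 ?_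
      · rw [SkewMonoidAlgebra.mem_support_iff]
        intro h0
        exact hent (by rw [ent, h0]; rfl)
      · rw [toAdd_ofAdd]; ring
      · rw [zpow_zpow_apply, show -(p - q) + p = q by ring]
        exact hqU.1
  · intro s hs
    rw [ent_mono, if_neg (by omega), mul_zero]

theorem toRk_iota_piN_C_chi_ne_zero [SecondCountableTopology X] [T2Space X] [Infinite X] {n : ℕ}
    {U : Set X} (hU : IsClopen U) (hne : U.Nonempty) (hat : IsAtomic n (chi S.T K hU)) :
    toRk S K (S.iota K n (S.piN K n (C (chi S.T K hU)))) ≠ 0 := by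
  rw [Ne, toRk_eq_zero_iff]
  refine ne_of_gt ((S.full U hU.isOpen hne).trans_le (le_rkInf_of_eventually fun m h => ?_))
  rw [j_piN h (An_subset_blockAlg hat.C_mem)]
  exact le_rkN_piN_C_chi hU (hat.of_le h)

theorem exists_isCanonicalEmbedding [SecondCountableTopology X] [T2Space X] [CompactSpace X]
    [TotallyDisconnectedSpace X] [Infinite X]
    (hE : Tendsto (fun n => S.μ (S.E n)) atTop (𝓝 0)) :
    ∃ Φ : Crossed S.T K →⋆ₐ[K] S.RRk K, IsCanonicalEmbedding Φ := by
  obtain ⟨Φ, hΦ⟩ := exists_starAlgHom (K := K) hE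
  have hext : ∀ n, ∀ a ∈ S.An K n, Φ a = toRk S K (S.iota K n (S.piN K n a)) := by
    intro n a ha
    refine tendsto_nhds_unique (hΦ a) (tendsto_const_nhds.congr' ?_)
    filter_upwards [eventually_ge_atTop n] with m hm
    rw [approx_of_mem ha hm]
  refine ⟨Φ, ⟨?_, hext, ?_⟩⟩
  · rw [injective_iff_map_eq_zero]
    intro a h0
    by_contra ha
    obtain ⟨U, hU, b, c, hne, e⟩ := exists_cut_down ha
    obtain ⟨n, hn⟩ := exists_isAtomic (chi S.T K hU)
    refine toRk_iota_piN_C_chi_ne_zero hU hne hn ?_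
    rw [← hext n _ hn.C_mem, ← e, map_mul, map_mul, h0, mul_zero, zero_mul]
  · refine (hΦ (t S.T K)).congr fun n => ?_
    rw [approx, ← piN_u]; rfl

end ApproxSystem

end

end CrossedApprox

namespace CrossedApprox

noncomputable section

namespace ApproxSystem

variable {X : Type*} [TopologicalSpace X] [MeasurableSpace X] {S : ApproxSystem X}

open Crossed

/-! ### The ideal `I` -/

theorem zpow_natCast_apply (i : ℕ) (x : X) : (S.T ^ (i : ℤ)) x = S.T^[i] x := by
  induction i generalizing x with
  | zero => rfl
  | succ i ih =>
    rw [Nat.cast_succ, ← zpow_zpow_apply, zpow_one, ih, Function.iterate_succ_apply]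

theorem zpow_y_add_mul {l : ℕ} (hy : S.T^[l] S.y = S.y) (i q : ℤ) :
    (S.T ^ (i + l * q)) S.y = (S.T ^ i) S.y := by
  have h1 : ∀ i : ℤ, (S.T ^ (i + l)) S.y = (S.T ^ i) S.y := fun i => by
    rw [← zpow_zpow_apply, zpow_natCast_apply, hy]
  induction q with
  | zero => rw [mul_zero, add_zero]
  | succ q ih => rw [← ih, ← h1 (i + l * q)]; congr 2; ring
  | pred q ih => rw [← ih, ← h1 (i + l * (-q - 1))]; congr 2; ring

theorem zpow_y_eq_emod {l : ℕ} (hy : S.T^[l] S.y = S.y) (i : ℤ) :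
    (S.T ^ i) S.y = (S.T ^ (i % l)) S.y := by
  conv_lhs => rw [← Int.emod_add_mul_ediv i l, zpow_y_add_mul hy]

/-- Minimality of the period enters here: the remainder of `i - k` modulo `l` is a period smaller
than `l`, hence zero. -/
theorem dvd_of_zpow_y_eq {l : ℕ} (hl : 0 < l) (hy : Function.minimalPeriod S.T S.y = l) {i k : ℤ}
    (h : (S.T ^ i) S.y = (S.T ^ k) S.y) : (l : ℤ) ∣ i - k := by
  have hper : S.T^[l] S.y = S.y := hy ▸ Function.iterate_minimalPeriod
  have h1 : (S.T ^ (i - k)) S.y = S.y := by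
    rw [show i - k = -k + i by ring, ← zpow_zpow_apply, h, zpow_zpow_apply, neg_add_cancel,
      zpow_zero]; rfl
  rw [zpow_y_eq_emod hper] at h1
  obtain ⟨m, hm⟩ := Int.eq_ofNat_of_zero_le (Int.emod_nonneg (i - k) (by omega : (l : ℤ) ≠ 0))
  have hlt := Int.emod_lt_of_pos (i - k) (by omega : 0 < (l : ℤ))
  rw [hm, zpow_natCast_apply] at h1
  refine Int.dvd_of_emod_eq_zero ?_
  have : Function.minimalPeriod S.T S.y ∣ m := Function.IsPeriodicPt.minimalPeriod_dvd h1
  rw [hy] at this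
  rw [hm] at hlt ⊢
  have := Nat.eq_zero_of_dvd_of_lt this (by omega)
  omega

variable {K : Type*} [Field K] [StarRing K]

theorem ent_y_add {l : ℕ} (hy : S.T^[l] S.y = S.y) (a : Crossed S.T K) (i k q : ℤ) :
    ent a S.y (i + l * q) (k + l * q) = ent a S.y i k := by
  rw [ent, ent, zpow_y_add_mul hy, add_sub_add_right_eq_sub]

variable (S K) in
/-- The elements of the crossed product which vanish on the orbit of `y`. -/
def orbitIdeal : TwoSidedIdeal (Crossed S.T K) :=
  TwoSidedIdeal.mk' {a | ∀ i k, ent a S.y i k = 0} (fun i k => ent_zero _ _ _)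
    (fun {a b} ha hb i k => by rw [ent_add, ha, hb, add_zero])
    (fun {a} ha i k => by rw [← neg_one_smul K a, ent_smul, ha, mul_zero])
    (fun {a b} hb i k => by
      rw [ent_mul, finsum_eq_zero_of_forall_eq_zero]
      exact fun s => by rw [hb, mul_zero])
    (fun {a b} ha i k => by
      rw [ent_mul, finsum_eq_zero_of_forall_eq_zero]
      exact fun s => by rw [ha, zero_mul])

theorem mem_orbitIdeal {a : Crossed S.T K} : a ∈ orbitIdeal S K ↔ ∀ i k, ent a S.y i k = 0 :=
  TwoSidedIdeal.mem_mk' _ _ _ _ _ _ _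

theorem coeff_sum_single (a : Crossed S.T K) :
    a = ∑ g ∈ a.support, mono (Multiplicative.toAdd g) (a.coeff g) := a.sum_single.symm

theorem coeff_apply_zpow_y (a : Crossed S.T K) (ha : a ∈ orbitIdeal S K) (g : Multiplicative ℤ)
    (i : ℤ) : a.coeff g ((S.T ^ i) S.y) = 0 := by
  have := mem_orbitIdeal.1 ha i (i - Multiplicative.toAdd g)
  rwa [ent, sub_sub_cancel, ofAdd_toAdd] at this

/-- The generators vanish on the orbit. Conversely, each coefficient of an element vanishing there
is a multiple of the characteristic function of its support, which is clopen and misses the orbit.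
-/
theorem idealI_eq {l : ℕ} (hl : 0 < l) (hy : S.T^[l] S.y = S.y) :
    S.idealI K l = orbitIdeal S K := by
  refine le_antisymm (TwoSidedIdeal.span_le.2 ?_) fun a ha => ?_
  · rintro _ ⟨f, hf, rfl⟩
    rw [SetLike.mem_coe, mem_orbitIdeal]
    intro i k
    rw [ent_C]
    split_ifs
    swap
    · rfl
    refine Submodule.span_induction (p := fun f _ => f ((S.T ^ i) S.y) = 0) ?_ rfl ?_ ?_ hf
    · rintro _ ⟨V, hV, hVU, rfl⟩
      refine chi_of_notMem _ fun h => ?_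
      have h1 := hVU h
      obtain ⟨s, hs⟩ := Int.eq_ofNat_of_zero_le (Int.emod_nonneg i (by omega : (l : ℤ) ≠ 0))
      have hlt := Int.emod_lt_of_pos i (by omega : 0 < (l : ℤ))
      refine h1 s (by omega) ?_
      rw [zpow_y_eq_emod hy, hs]
    · intro f g _ _ hf hg
      rw [CK.add_apply, hf, hg, add_zero]
    · intro c f _ hf
      rw [smul_eq_mul, CK.mul_apply, hf, mul_zero]
  · rw [coeff_sum_single a]
    refine sum_mem fun g _ => ?_
    set f := a.coeff g
    have hV : IsClopen {x | f x ≠ 0} :=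
      ⟨((isLocallyConstant f).isOpen_fiber 0).isClosed_compl,
        (((isLocallyConstant f).isClosed_fiber 0)).isOpen_compl⟩
    have hf : f = f * chi S.T K hV := by
      ext x
      rw [CK.mul_apply]
      by_cases hx : f x = 0
      · rw [hx, zero_mul]
      · rw [chi_of_mem hV hx, mul_one]
    have hfC : C f ∈ S.idealI K l := by
      refine TwoSidedIdeal.subset_span ⟨f, ?_, rfl⟩
      rw [hf]
      refine Ideal.mul_mem_left _ _ (Ideal.subset_span ⟨_, hV, fun x hx i _ e => hx ?_, rfl⟩)
      rw [e]
      exact coeff_apply_zpow_y a ha g i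
    rw [← mul_one f, ← C_mul_mono]
    exact TwoSidedIdeal.mul_mem_right _ _ _ hfC

theorem An_mono {m n : ℕ} (h : m ≤ n) : S.An K m ≤ S.An K n := by
  rw [An, StarAlgebra.adjoin_le_iff]
  rintro _ ⟨Z, hZ, rfl⟩
  exact ((isAtomic_chi (Set.mem_insert_of_mem _ hZ) _).of_le h).C_mul_t_mem fun x hx =>
    chi_of_notMem _ fun hxZ => S.notMem_E hZ hxZ (S.E_anti h hx)

/-- Vanishing at `y, …, T^{k-1} y` persists on `T^s(E_n)` for `s < k` and large `n`, since `f` is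
locally constant. This is the condition for `f t^k = f u^k`. -/
theorem mono_nat_mem_An [CompactSpace X] {f : CK S.T K} (hf : ∀ i : ℤ, f ((S.T ^ i) S.y) = 0)
    (k : ℕ) : ∃ N, ∀ n ≥ N, mono k f ∈ S.An K n := by
  obtain ⟨N, hN⟩ := exists_isAtomic f
  have hU : (⋂ s ∈ Finset.range k, {x | f ((S.T ^ (s : ℤ)) x) = 0}) ∈ 𝓝 S.y := by
    rw [biInter_finset_mem]
    intro s _
    refine IsOpen.mem_nhds ?_ (hf s)
    exact ((isLocallyConstant f).isOpen_fiber 0).preimage (S.T ^ (s : ℤ)).continuous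
  obtain ⟨M, hM⟩ := exists_E_subset hU
  refine ⟨max N M, fun n hn => (hN.of_le (le_of_max_le_left hn)).mono_mem fun s hs x hx => ?_⟩
  exact Set.mem_iInter₂.1 (hM n (le_of_max_le_right hn) hx) s (Finset.mem_range.2 hs)

theorem mono_mem_An [CompactSpace X] {f : CK S.T K} (hf : ∀ i : ℤ, f ((S.T ^ i) S.y) = 0)
    (k : ℤ) : ∃ N, ∀ n ≥ N, mono k f ∈ S.An K n := by
  rcases le_total 0 k with hk | hk
  · lift k to ℕ using hk
    exact mono_nat_mem_An hf k
  · obtain ⟨m, rfl⟩ : ∃ m : ℕ, k = -m := ⟨k.natAbs, by omega⟩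
    obtain ⟨N, hN⟩ := mono_nat_mem_An (f := shift (-m) (star f)) (fun i => by
      rw [shift_apply, zpow_zpow_apply, CK.star_apply, hf, star_zero]) m
    refine ⟨N, fun n hn => ?_⟩
    rw [← star_star (mono (-(m : ℤ)) f), star_mono, neg_neg]
    exact star_mem (hN n hn)

theorem mem_An_of_mem_orbitIdeal [CompactSpace X] {a : Crossed S.T K} (ha : a ∈ orbitIdeal S K) :
    ∃ N, ∀ n ≥ N, a ∈ S.An K n := by
  choose N hN using fun g => mono_mem_An (fun i => coeff_apply_zpow_y a ha g i)
    (Multiplicative.toAdd g)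
  refine ⟨a.support.sup N, fun n hn => ?_⟩
  rw [coeff_sum_single a]
  exact sum_mem fun g hg => hN g n ((Finset.le_sup hg).trans hn)

/-- As soon as `E_n` avoids `T y, …, T^{l-1} y`, the point `y` first returns to `E_n` at time `l`,
and its itinerary defines the tower. -/
theorem exists_tower_y [T1Space X] {l : ℕ} (hl : 0 < l)
    (hy : Function.minimalPeriod S.T S.y = l) :
    ∃ M : ℕ, ∀ n ≥ M, ∃! W : S.Tower n, W.len = l ∧ S.y ∈ W.base := by
  have hper : S.T^[l] S.y = S.y := hy ▸ Function.iterate_minimalPeriod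
  have hU : (⋂ s ∈ Finset.Ioo 0 l, {x | x ≠ (S.T ^ (s : ℤ)) S.y}) ∈ 𝓝 S.y := by
    rw [biInter_finset_mem]
    intro s hs
    rw [Finset.mem_Ioo] at hs
    refine isOpen_ne.mem_nhds fun e => ?_
    have e' : (S.T ^ (s : ℤ)) S.y = (S.T ^ (0 : ℤ)) S.y := e.symm
    have := Int.le_of_dvd (by omega) (dvd_of_zpow_y_eq hl hy e')
    omega
  obtain ⟨M, hM⟩ := exists_E_subset hU
  refine ⟨M, fun n hn => ?_⟩
  have hZ : ∀ s : ℕ, 0 < s → s < l → ∃ Z ∈ S.P n, (S.T ^ (s : ℤ)) S.y ∈ Z := by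
    intro s h0 h1
    have : (S.T ^ (s : ℤ)) S.y ∈ ⋃₀ S.P n := by
      rw [S.sUnion_P]
      exact fun hE => Set.mem_iInter₂.1 (hM n hn hE) s (Finset.mem_Ioo.2 ⟨h0, h1⟩) rfl
    exact this
  choose! Z hZP hZy using hZ
  have hmem : S.y ∈ {x | x ∈ S.E n ∧ (∀ s : ℕ, 0 < s → s < l → (S.T ^ (s : ℤ)) x ∈ Z s) ∧
      (S.T ^ (l : ℤ)) x ∈ S.E n} := by
    refine ⟨y_mem_E n, hZy, ?_⟩
    rw [zpow_natCast_apply, hper]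
    exact y_mem_E n
  exact ⟨⟨_, l, hl, ⟨_, hmem⟩, Z, hZP, rfl⟩, ⟨rfl, hmem⟩, fun W hW => Tower.eq_of_mem hW.2 hmem⟩

/-! ### Regularity of `𝕽_n` and `𝕽_∞` -/

theorem exists_isMoorePenrose_Rn (hK : IsPositiveDefinite K) (n : ℕ) (x : S.Rn K n) :
     ∃ z, IsMoorePenrose x z := by
  refine IsMoorePenrose.exists_of_regular_of_proper (fun x => ?_) (fun x hx => ?_) x
  · choose z hz using fun W => CrossedApprox.Matrix.exists_mul_mul_eq (x W)
    exact ⟨z, funext hz⟩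
  · funext W
    exact CrossedApprox.Matrix.eq_zero_of_star_mul_self_eq_zero hK (x W) (congrFun hx W)

theorem exists_isMoorePenrose_RInf (hK : IsPositiveDefinite K) (x : S.RInf K) :
     ∃ z, IsMoorePenrose x z := by
  induction x using RInf.induction with
  | h n M =>
    obtain ⟨z, hz⟩ := exists_isMoorePenrose_Rn hK n M
    exact ⟨_, hz.map (S.iota K n)⟩

theorem j_mem_RegN (hK : IsPositiveDefinite K) {m n : ℕ} (h : m ≤ n) {r : S.Rn K m}
    (hr : r ∈ S.RegN K m) :
    S.j K h r ∈ S.RegN K n := by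
  refine map_mem_starRegularClosure (exists_isMoorePenrose_Rn hK m) (S.j K h) ?_ hr
  rintro _ ⟨a, ha, rfl⟩
  rw [j_piN h (An_subset_blockAlg ha)]
  exact subset_starRegularClosure _ ⟨a, An_mono h ha, rfl⟩

theorem iota_mem_RegInf (hK : IsPositiveDefinite K) {n : ℕ} {r : S.Rn K n} (hr : r ∈ S.RegN K n) :
    S.iota K n r ∈ S.RegInf K := by
  refine map_mem_starRegularClosure (exists_isMoorePenrose_Rn hK n) (S.iota K n) ?_ hr
  rintro _ ⟨a, ha, rfl⟩
  exact subset_starRegularClosure _ ⟨n, a, ha, trivial, rfl⟩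

/-- The images of the `R_n` form an increasing union that is a regular `*`-subalgebra containing
`A_∞`, so it contains `R_∞`. Monotonicity allows any stage beyond `M`. -/
theorem exists_of_mem_RegInf (hK : IsPositiveDefinite K) {x : S.RInf K} (hx : x ∈ S.RegInf K)
    (M : ℕ) :
    ∃ n ≥ M, ∃ r ∈ S.RegN K n, x = S.iota K n r := by
  have hdir : ∀ {n} {r : S.Rn K n}, r ∈ S.RegN K n → ∀ m ≥ n,
      ∃ s ∈ S.RegN K m, S.iota K n r = S.iota K m s := fun hr m hm =>
    ⟨_, j_mem_RegN hK hm hr, (iota_j hm _).symm⟩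
  let B : StarSubalgebra K (S.RInf K) :=
    { carrier := {x | ∃ n, ∃ r ∈ S.RegN K n, x = S.iota K n r}
      mul_mem' := by
        rintro _ _ ⟨n, r, hr, rfl⟩ ⟨m, s, hs, rfl⟩
        obtain ⟨r', hr', e⟩ := hdir hr _ (le_max_left n m)
        obtain ⟨s', hs', e'⟩ := hdir hs _ (le_max_right n m)
        exact ⟨_, _, mul_mem hr' hs', by rw [e, e', map_mul]⟩
      add_mem' := by
        rintro _ _ ⟨n, r, hr, rfl⟩ ⟨m, s, hs, rfl⟩
        obtain ⟨r', hr', e⟩ := hdir hr _ (le_max_left n m)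
        obtain ⟨s', hs', e'⟩ := hdir hs _ (le_max_right n m)
        exact ⟨_, _, add_mem hr' hs', by rw [e, e', map_add]⟩
      algebraMap_mem' := fun c => ⟨0, _, (S.RegN K 0).algebraMap_mem c,
        ((S.iota K 0).toAlgHom.commutes c).symm⟩
      star_mem' := by
        rintro _ ⟨n, r, hr, rfl⟩
        exact ⟨n, _, star_mem hr, (map_star _ _).symm⟩ }
  have hle : S.RegInf K ≤ B := by
    refine starRegularClosure_le ?_ ?_
    · rintro _ ⟨n, a, ha, -, rfl⟩
      exact ⟨n, _, subset_starRegularClosure _ ⟨a, ha, rfl⟩, rfl⟩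
    · rintro _ ⟨n, r, hr, rfl⟩
      obtain ⟨z, hz⟩ := exists_isMoorePenrose_Rn hK n r
      exact ⟨_, ⟨n, z, hz.mem_starRegularClosure hr, rfl⟩, (hz.map (S.iota K n)).mul_mul⟩
  obtain ⟨n, r, hr, rfl⟩ := hle hx
  obtain ⟨s, hs, e⟩ := hdir hr _ (le_max_left n M)
  exact ⟨_, le_max_right n M, s, hs, e⟩

/-! ### The character of `𝕽_∞` at the periodic orbit -/

/-- The component of `𝕽_n` at a tower of height `l`, as an `l × l`-matrix. -/
def component {n l : ℕ} (W : S.Tower n) (h : W.len = l) :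
    S.Rn K n →⋆ₐ[K] Matrix (Fin l) (Fin l) K where
  toFun r := (r W).submatrix (Fin.cast h.symm) (Fin.cast h.symm)
  map_one' := by subst h; rfl
  map_mul' _ _ := by subst h; rfl
  map_zero' := by subst h; rfl
  map_add' _ _ := by subst h; rfl
  commutes' _ := by subst h; rfl
  map_star' _ := by subst h; rfl

theorem component_apply {n l : ℕ} (W : S.Tower n) (h : W.len = l) (r : S.Rn K n) (i k : Fin l) :
    component W h r i k = r W (Fin.cast h.symm i) (Fin.cast h.symm k) := rfl

theorem component_eq_zero_iff {n l : ℕ} (W : S.Tower n) (h : W.len = l) (r : S.Rn K n) :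
    component W h r = 0 ↔ r W = 0 := by subst h; exact Iff.rfl

/-- Both towers have height `l` and contain `y` in the base, so the tower over `W'` is cut into just
one block, the one of `W`. -/
theorem component_j {m n l : ℕ} (hmn : m ≤ n) {W : S.Tower m} {W' : S.Tower n} (h : W.len = l)
    (h' : W'.len = l) (hy : S.y ∈ W.base) (hy' : S.y ∈ W'.base) (r : S.Rn K m) :
    component W' h' (S.j K hmn r) = component W h r := by
  -- The block containing level `0` must begin there, because blocks do not extend below the tower.
  have hs : Tower.Sub W 0 W' 0 := by
    obtain ⟨V, p, hs⟩ := exists_sub' hmn W' ⟨0, W'.len_pos⟩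
    have hp := (hs.nested hmn p.2 p.2 W'.len_pos).1
    simp only [nonpos_iff_eq_zero] at hp
    rw [hp] at hs
    have hyV : S.y ∈ V.base := by simpa using hs _ hy'
    rwa [Tower.eq_of_mem hy hyV]
  ext i k
  rw [component_apply, component_apply, j_apply]
  exact jFun_of_sub hmn r (p := Fin.cast h.symm i) (q := Fin.cast h.symm k)
    (hs.shift (by simp)) (by simp [Nat.add_comm])

theorem exists_j_eq_of_iota_eq {m n : ℕ} {r : S.Rn K m} {s : S.Rn K n}
    (h : S.iota K m r = S.iota K n s) :
    ∃ k, ∃ (hm : m ≤ k) (hn : n ≤ k), S.j K hm r = S.j K hn s := by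
  obtain ⟨k, hm, hn, e⟩ := Quotient.exact h
  exact ⟨k, hm, hn, e⟩

theorem exists_character {l M : ℕ} (W : ∀ n, S.Tower n)
    (hW : ∀ n ≥ M, (W n).len = l ∧ S.y ∈ (W n).base) :
    ∃ θ : S.RInf K →⋆ₐ[K] Matrix (Fin l) (Fin l) K,
      ∀ n (hn : n ≥ M) (r : S.Rn K n), θ (S.iota K n r) = component (W n) (hW n hn).1 r := by
  have hex : ∀ x : S.RInf K, ∃ n, ∃ r : S.Rn K n, n ≥ M ∧ x = S.iota K n r := by
    intro x
    induction x using RInf.induction with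
    | h n r => exact ⟨_, _, le_max_right n M, (iota_j (le_max_left n M) r).symm⟩
  choose N r hN hr using hex
  let θ : S.RInf K → Matrix (Fin l) (Fin l) K := fun x => component (W (N x)) (hW _ (hN x)).1 (r x)
  have hθ : ∀ n (hn : n ≥ M) (s : S.Rn K n),
      θ (S.iota K n s) = component (W n) (hW n hn).1 s := by
    intro n hn s
    -- The value of `θ` was defined by a chosen representative; `component_j` compares it with any
    -- other at a common later stage.
    obtain ⟨k, h1, h2, e⟩ := exists_j_eq_of_iota_eq (hr (S.iota K n s))
    have hk : k ≥ M := le_trans hn h1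
    rw [← component_j h1 (hW n hn).1 (hW k hk).1 (hW n hn).2 (hW k hk).2, e,
      component_j h2 (hW _ (hN _)).1 (hW k hk).1 (hW _ (hN _)).2 (hW k hk).2]
  have hind : ∀ x z : S.RInf K, ∃ n, ∃ (_ : n ≥ M) (s s' : S.Rn K n),
      x = S.iota K n s ∧ z = S.iota K n s' := by
    intro x z
    refine ⟨max (N x) (N z), (hN x).trans (le_max_left _ _), S.j K (le_max_left _ _) (r x),
      S.j K (le_max_right _ _) (r z), ?_, ?_⟩
    · rw [iota_j]; exact hr x
    · rw [iota_j]; exact hr z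
  have halg : ∀ c, θ (algebraMap K _ c) = algebraMap K _ c := fun c => by
    rw [← (S.iota K M).toAlgHom.commutes c]
    exact (hθ M le_rfl _).trans ((component (W M) _).toAlgHom.commutes c)
  refine ⟨{
    toFun := θ
    map_one' := by simpa using halg 1
    map_mul' := fun x z => ?_
    map_zero' := by simpa using halg 0
    map_add' := fun x z => ?_
    commutes' := halg
    map_star' := fun x => ?_ }, hθ⟩
  · obtain ⟨n, hn, s, s', rfl, rfl⟩ := hind x z
    rw [← map_mul, hθ n hn, hθ n hn, hθ n hn, map_mul]
  · obtain ⟨n, hn, s, s', rfl, rfl⟩ := hind x z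
    rw [← map_add, hθ n hn, hθ n hn, hθ n hn, map_add]
  · obtain ⟨n, hn, s, s', rfl, -⟩ := hind x x
    rw [← map_star, hθ n hn, hθ n hn, map_star]

/-- The image of `h_W` is the central idempotent of the factor `W`. -/
theorem piN_one_sub_hW_mul {n : ℕ} {W : S.Tower n} {r : S.Rn K n} (h : r W = 0) :
    (1 - S.piN K n (hW K W)) * r = r := by
  funext V
  rw [Pi.mul_apply, Pi.sub_apply]
  by_cases hV : V = W
  · subst hV
    rw [h, mul_zero]
  · rw [piN_hW_of_ne hV, sub_zero]; exact one_mul _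

/-- The orbit of `y` climbs the tower over `W` over and over, so its orbit matrix for an element of
`A_n` is block diagonal with the `W`-component repeated. For `1 - h_W` this component is zero. -/
theorem one_sub_hW_mem_orbitIdeal {n l : ℕ} (hl : 0 < l) (hy : S.T^[l] S.y = S.y) {W : S.Tower n}
    (hWy : W.len = l ∧ S.y ∈ W.base) : 1 - hW K W ∈ orbitIdeal S K := by
  rw [mem_orbitIdeal]
  intro i k
  have hb : 1 - hW K W ∈ blockAlg S K n :=
    An_subset_blockAlg (sub_mem (one_mem _) (hW_mem W))
  have h0 : 0 ≤ i % l := Int.emod_nonneg _ (by omega)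
  have h1 : i % l < W.len := by rw [hWy.1]; exact Int.emod_lt_of_pos _ (by omega)
  -- Periodicity moves the row into the first passage through the tower, and the column moves by the
  -- same multiple of `l`.
  have he : ent (1 - hW K W) S.y i k =
      ent (1 - hW K W) S.y (i % l) (k - l * (i / l)) := by
    rw [← ent_y_add hy _ (i % l) _ (i / l), Int.emod_add_mul_ediv, sub_add_cancel]
  rw [he]
  by_cases hk : 0 ≤ k - l * (i / l) ∧ k - l * (i / l) < W.len
  · rw [(hb W _ hWy.2 _ W.some_mem _ _ h0 h1).2]
    obtain ⟨p, hp⟩ := Int.eq_ofNat_of_zero_le h0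
    obtain ⟨q, hq⟩ := Int.eq_ofNat_of_zero_le hk.1
    have hz : S.piN K n (1 - hW K W) W = 0 := by
      rw [piN_sub, piN_one, Pi.sub_apply, piN_hW_self]; exact sub_self _
    rw [hp, hq]
    exact congrFun (congrFun hz ⟨p, by omega⟩) ⟨q, by omega⟩
  · exact (hb W _ hWy.2 _ hWy.2 _ _ h0 h1).1 hk

end ApproxSystem

end

end CrossedApprox

namespace CrossedApprox

noncomputable section

namespace ApproxSystem

variable {X : Type*} [TopologicalSpace X] [MeasurableSpace X] {S : ApproxSystem X}

open Crossed

variable {K : Type*} [Field K] [StarRing K]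

/-! ### The ideal `Ĩ` as a kernel and the quotient `R_∞/Ĩ` -/

theorem iota_piN_mem_RegInf {n : ℕ} {a : Crossed S.T K} (ha : a ∈ S.An K n) :
    S.iota K n (S.piN K n a) ∈ S.RegInf K :=
  subset_starRegularClosure _ ⟨n, a, ha, trivial, rfl⟩

theorem piN_mem_RegN {n : ℕ} {a : Crossed S.T K} (ha : a ∈ S.An K n) :
    S.piN K n a ∈ S.RegN K n := subset_starRegularClosure _ ⟨a, ha, rfl⟩

theorem component_piN_eq_zero {n l : ℕ} {W : S.Tower n} (hW : W.len = l) (hy : S.y ∈ W.base)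
    {a : Crossed S.T K} (ha : a ∈ S.An K n) (h0 : a ∈ orbitIdeal S K) :
    component W hW (S.piN K n a) = 0 := by
  rw [component_eq_zero_iff]
  ext i k
  rw [piN_apply, (An_subset_blockAlg ha W _ W.some_mem _ hy i k (by omega) (by omega)).2]
  exact mem_orbitIdeal.1 h0 i k

theorem mono_one_mem_laurent (d : ℕ) (q : ℤ) : mono (d * q) (1 : CK S.T K) ∈ S.laurent K d := by
  have h : ∀ m : ℕ, mono (d * m) (1 : CK S.T K) ∈ S.laurent K d := fun m => by
    have h1 : (t S.T K ^ d) ^ m ∈ S.laurent K d :=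
      pow_mem (StarAlgebra.self_mem_adjoin_singleton K (t S.T K ^ d)) m
    have e : (t S.T K ^ d) ^ m = mono (d * m) 1 := by rw [← pow_mul, t_pow, Nat.cast_mul]
    rwa [e] at h1
  obtain ⟨m, rfl | rfl⟩ := q.eq_nat_or_neg
  · exact h m
  · have := star_mem (h m)
    rw [star_mono, star_one, shift, smul_one] at this
    rwa [mul_neg]

/-- A system of towers of height `l` over neighbourhoods of `y`, together with the induced
representation of `𝕽_∞` on the orbit of `y`. -/
structure OrbitData (S : ApproxSystem X) (K : Type*) [Field K] [StarRing K] (l M : ℕ) where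
  pos : 0 < l
  period : Function.minimalPeriod S.T S.y = l
  W : ∀ n, S.Tower n
  len_eq : ∀ n ≥ M, (W n).len = l
  y_mem : ∀ n ≥ M, S.y ∈ (W n).base
  θ : S.RInf K →⋆ₐ[K] Matrix (Fin l) (Fin l) K
  θ_iota : ∀ n (hn : n ≥ M) (r : S.Rn K n),
    θ (S.iota K n r) = component (W n) (len_eq n hn) r

namespace OrbitData

variable {l M : ℕ}

theorem iterate (D : OrbitData S K l M) : S.T^[l] S.y = S.y :=
  D.period ▸ Function.iterate_minimalPeriod

theorem θ_iota_piN (D : OrbitData S K l M) {n : ℕ} {a : Crossed S.T K} (ha : a ∈ S.An K n)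
    (h0 : a ∈ orbitIdeal S K) :
    D.θ (S.iota K n (S.piN K n a)) = 0 := by
  rw [← iota_piN (le_max_left n M) ha, D.θ_iota _ (le_max_right n M)]
  exact component_piN_eq_zero _ (D.y_mem _ (le_max_right n M)) (An_mono (le_max_left n M) ha) h0

theorem one_sub_hW_mem (D : OrbitData S K l M) {n : ℕ} (hn : n ≥ M) :
    1 - hW K (D.W n) ∈ orbitIdeal S K :=
  one_sub_hW_mem_orbitIdeal D.pos D.iterate ⟨D.len_eq n hn, D.y_mem n hn⟩

/-- Elements of `I` vanish on the orbit of `y`, so `θ` kills them. Conversely `θ(r) = 0` gives `r =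
(1 - h_{W_n}) r` at some stage, and `1 - h_{W_n}` is in `I ∩ A_n`. -/
theorem mem_idealItilde_iff (D : OrbitData S K l M) (hK : IsPositiveDefinite K) (r : S.RegInf K) :
    r ∈ S.idealItilde K l ↔ D.θ r = 0 := by
  constructor
  · let f : S.RegInf K →+* Matrix (Fin l) (Fin l) K :=
      (D.θ.toAlgHom.comp (S.RegInf K).subtype.toAlgHom).toRingHom
    suffices h : S.idealItilde K l ≤ TwoSidedIdeal.ker f from
      fun hr => (TwoSidedIdeal.mem_ker (f := f)).1 (h hr)
    refine TwoSidedIdeal.span_le.2 ?_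
    rintro r ⟨n, a, ha, haI, e⟩
    rw [SetLike.mem_coe, TwoSidedIdeal.mem_ker]
    change D.θ r = 0
    rw [SetLike.mem_coe, idealI_eq D.pos D.iterate] at haI
    rw [e, D.θ_iota_piN ha haI]
  · intro h0
    obtain ⟨n, hn, s, hs, e⟩ := exists_of_mem_RegInf hK r.2 M
    rw [e, D.θ_iota n hn, component_eq_zero_iff] at h0
    have hmem : 1 - hW K (D.W n) ∈ S.An K n := sub_mem (one_mem _) (hW_mem _)
    have hr : r = ⟨_, iota_piN_mem_RegInf hmem⟩ * r := by
      refine Subtype.ext ?_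
      change (r : S.RInf K) = S.iota K n (S.piN K n (1 - hW K (D.W n))) * (r : S.RInf K)
      rw [e, ← map_mul, piN_sub, piN_one, piN_one_sub_hW_mul h0]
    rw [hr]
    refine TwoSidedIdeal.mul_mem_right _ _ _ (TwoSidedIdeal.subset_span ⟨n, _, hmem, ?_, rfl⟩)
    rw [SetLike.mem_coe, idealI_eq D.pos D.iterate]
    exact D.one_sub_hW_mem hn

theorem idealItilde_eq (D : OrbitData S K l M) (hK : IsPositiveDefinite K) :
    {x : S.RInf K | ∃ r ∈ S.idealItilde K l, x = r} =
      {x | ∃ n ≥ M, ∃ r ∈ S.RegN K n,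
        x = S.iota K n ((1 - S.piN K n (hW K (D.W n))) * r)} := by
  ext x
  constructor
  · rintro ⟨r, hr, rfl⟩
    rw [D.mem_idealItilde_iff hK] at hr
    obtain ⟨n, hn, s, hs, e⟩ := exists_of_mem_RegInf hK r.2 M
    rw [e, D.θ_iota n hn, component_eq_zero_iff] at hr
    exact ⟨n, hn, s, hs, by rw [e, piN_one_sub_hW_mul hr]⟩
  · rintro ⟨n, hn, r, hr, rfl⟩
    have hmem : (1 - S.piN K n (hW K (D.W n))) * r ∈ S.RegN K n :=
      mul_mem (sub_mem (one_mem _) (piN_mem_RegN (hW_mem _))) hr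
    refine ⟨⟨_, iota_mem_RegInf hK hmem⟩, ?_, rfl⟩
    rw [D.mem_idealItilde_iff hK, D.θ_iota n hn, component_eq_zero_iff, Pi.mul_apply, Pi.sub_apply,
      piN_hW_self]
    exact (congrArg (· * r (D.W n)) (sub_self 1)).trans (zero_mul _)

/-- The matrix units `e_{ij}(W_M)` are sent to the standard matrix units. -/
theorem θ_surjective (D : OrbitData S K l M) (N : Matrix (Fin l) (Fin l) K) :
     ∃ r : S.RegInf K, D.θ r = N := by
  have hl := D.len_eq M le_rfl
  refine ⟨∑ i, ∑ k, N i k • ⟨_, iota_piN_mem_RegInf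
    (e_mem (D.W M) (Fin.cast hl.symm i) (Fin.cast hl.symm k))⟩, ?_⟩
  let f : S.RegInf K →ₐ[K] Matrix (Fin l) (Fin l) K :=
    D.θ.toAlgHom.comp (S.RegInf K).subtype.toAlgHom
  change f _ = _
  conv_rhs => rw [Matrix.matrix_eq_sum_single N]
  rw [map_sum]
  refine Finset.sum_congr rfl fun i _ => ?_
  rw [map_sum]
  refine Finset.sum_congr rfl fun k _ => ?_
  rw [map_smul]
  change N i k • D.θ (S.iota K M _) = _
  rw [D.θ_iota M le_rfl]
  ext p q
  rw [Matrix.smul_apply, component_apply, piN_e_self, Matrix.single_apply, Matrix.single_apply,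
    smul_eq_mul]
  simp [Fin.ext_iff]

theorem exists_quotient_equiv (D : OrbitData S K l M) (hK : IsPositiveDefinite K) :
    ∃ φ : (S.idealItilde K l).ringCon.Quotient ≃ₐ[K] Matrix (Fin l) (Fin l) K,
      ∀ r : S.RegInf K, φ ((star r : S.RegInf K)) = star (φ r) := by
  let f : S.RegInf K →ₐ[K] (S.idealItilde K l).ringCon.Quotient := RingCon.mkₐ K _
  let g : S.RegInf K →ₐ[K] Matrix (Fin l) (Fin l) K :=
    D.θ.toAlgHom.comp (S.RegInf K).subtype.toAlgHom
  obtain ⟨φ, hφ⟩ := exists_algEquiv_of_surjective f g (RingCon.mkₐ_surjective _)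
    (fun N => D.θ_surjective N) fun r => by
      rw [show g r = D.θ r from rfl, ← D.mem_idealItilde_iff hK, TwoSidedIdeal.mem_iff]
      exact RingCon.eq _
  refine ⟨φ, fun r => ?_⟩
  refine (hφ (star r)).trans ((map_star D.θ (r : S.RInf K)).trans ?_)
  exact congrArg star (hφ r).symm

/-! ### The ideal `Ĩ` in `𝕽_rk` -/

theorem mem_itildeRk_iff (D : OrbitData S K l M) (hK : IsPositiveDefinite K) {x : S.RRk K} :
    x ∈ S.itildeRk K l ↔ ∃ r ∈ S.RegInf K, D.θ r = 0 ∧ x = toRk S K r := by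
  constructor
  · rintro ⟨r, hr, rfl⟩
    exact ⟨r, r.2, (D.mem_idealItilde_iff hK r).1 hr, rfl⟩
  · rintro ⟨r, hr, h0, rfl⟩
    exact ⟨⟨r, hr⟩, (D.mem_idealItilde_iff hK ⟨r, hr⟩).2 h0, rfl⟩

section

variable [CompactSpace X] {Φ : Crossed S.T K →⋆ₐ[K] S.RRk K}

theorem Φ_apply (hΦ : IsCanonicalEmbedding Φ) {n : ℕ} {a : Crossed S.T K} (ha : a ∈ S.An K n) :
    Φ a = toRk S K (S.iota K n (S.piN K n a)) := hΦ.extends_pi n a ha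

/-- This is `A ∩ Ĩ = I`. An element of `Ĩ` is annihilated by some `h_{W_n}`; if it equals `Φ a`,
then `h_{W_n} a = 0` and `a = (1 - h_{W_n}) a`. -/
theorem Φ_mem_itildeRk_iff (D : OrbitData S K l M) (hΦ : IsCanonicalEmbedding Φ)
    (hK : IsPositiveDefinite K)
    (a : Crossed S.T K) : Φ a ∈ S.itildeRk K l ↔ a ∈ orbitIdeal S K := by
  rw [D.mem_itildeRk_iff hK]
  constructor
  · rintro ⟨r, hr, h0, e⟩
    obtain ⟨n, hn, s, hs, rfl⟩ := exists_of_mem_RegInf hK hr M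
    rw [D.θ_iota n hn, component_eq_zero_iff] at h0
    have h1 : Φ (hW K (D.W n) * a) = 0 := by
      rw [map_mul, Φ_apply hΦ (hW_mem (D.W n)), e, ← map_mul, ← map_mul]
      have : S.piN K n (hW K (D.W n)) * s = 0 := by
        have := piN_one_sub_hW_mul h0
        rwa [sub_mul, one_mul, sub_eq_self] at this
      rw [this, map_zero, map_zero]
    -- Injectivity of `Φ` brings the identity back to `A`; injectivity of the map `𝕽_∞ → 𝕽_rk` is
    -- not needed.
    have h2 : hW K (D.W n) * a = 0 := hΦ.injective (h1.trans (map_zero Φ).symm)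
    have h3 : a = (1 - hW K (D.W n)) * a := by rw [sub_mul, h2, one_mul, sub_zero]
    rw [h3]
    exact TwoSidedIdeal.mul_mem_right _ _ _ (D.one_sub_hW_mem hn)
  · intro ha
    obtain ⟨N, hN⟩ := mem_An_of_mem_orbitIdeal ha
    exact ⟨_, iota_piN_mem_RegInf (hN N le_rfl), D.θ_iota_piN (hN N le_rfl) ha,
      Φ_apply hΦ (hN N le_rfl)⟩

theorem add_mem_itildeRk (D : OrbitData S K l M) (hK : IsPositiveDefinite K) {x z : S.RRk K}
    (hx : x ∈ S.itildeRk K l)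
    (hz : z ∈ S.itildeRk K l) : x + z ∈ S.itildeRk K l := by
  rw [D.mem_itildeRk_iff hK] at hx hz ⊢
  obtain ⟨r, hr, h0, rfl⟩ := hx
  obtain ⟨s, hs, h1, rfl⟩ := hz
  exact ⟨r + s, add_mem hr hs, by rw [map_add, h0, h1, add_zero], (map_add _ _ _).symm⟩

theorem mul_mem_itildeRk (D : OrbitData S K l M) (hK : IsPositiveDefinite K) {x z : S.RRk K}
    (hx : x ∈ S.itildeRk K l)
    (hz : z ∈ S.itildeRk K l) : x * z ∈ S.itildeRk K l := by
  rw [D.mem_itildeRk_iff hK] at hx hz ⊢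
  obtain ⟨r, hr, h0, rfl⟩ := hx
  obtain ⟨s, hs, h1, rfl⟩ := hz
  exact ⟨r * s, mul_mem hr hs, by rw [map_mul, h0, zero_mul], (map_mul _ _ _).symm⟩

theorem star_mem_itildeRk (D : OrbitData S K l M) (hK : IsPositiveDefinite K) {x : S.RRk K}
    (hx : x ∈ S.itildeRk K l) :
    star x ∈ S.itildeRk K l := by
  rw [D.mem_itildeRk_iff hK] at hx ⊢
  obtain ⟨r, hr, h0, rfl⟩ := hx
  exact ⟨star r, star_mem hr, by rw [map_star, h0, star_zero], (map_star _ _).symm⟩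

/-- Elements of `A` need not belong to `R_∞`, but `x = (1 - h)x` gives `a x = (a(1 - h)) x`, and
`a(1 - h) ∈ I ⊆ A_∞`. -/
theorem Φ_mul_mem_itildeRk (D : OrbitData S K l M) (hΦ : IsCanonicalEmbedding Φ)
    (hK : IsPositiveDefinite K)
    (a : Crossed S.T K) {x : S.RRk K} (hx : x ∈ S.itildeRk K l) : Φ a * x ∈ S.itildeRk K l := by
  rw [D.mem_itildeRk_iff hK] at hx ⊢
  obtain ⟨r, hr, h0, rfl⟩ := hx
  obtain ⟨n, hn, s, hs, rfl⟩ := exists_of_mem_RegInf hK hr M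
  rw [D.θ_iota n hn, component_eq_zero_iff] at h0
  have hmem : 1 - hW K (D.W n) ∈ S.An K n := sub_mem (one_mem _) (hW_mem _)
  have hI : a * (1 - hW K (D.W n)) ∈ orbitIdeal S K :=
    TwoSidedIdeal.mul_mem_left _ _ _ (D.one_sub_hW_mem hn)
  obtain ⟨N, hN⟩ := mem_An_of_mem_orbitIdeal hI
  have hN := hN N le_rfl
  refine ⟨_, mul_mem (iota_piN_mem_RegInf hN) hr, ?_, ?_⟩
  · rw [map_mul, D.θ_iota_piN hN hI, zero_mul]
  · rw [map_mul, ← Φ_apply hΦ hN, map_mul, Φ_apply hΦ hmem, mul_assoc, ← map_mul, ← map_mul,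
      piN_sub, piN_one, piN_one_sub_hW_mul h0]

theorem mul_Φ_mem_itildeRk (D : OrbitData S K l M) (hΦ : IsCanonicalEmbedding Φ)
    (hK : IsPositiveDefinite K)
    (a : Crossed S.T K) {x : S.RRk K} (hx : x ∈ S.itildeRk K l) : x * Φ a ∈ S.itildeRk K l := by
  have := D.star_mem_itildeRk hK
    (D.Φ_mul_mem_itildeRk hΦ hK (star a) (D.star_mem_itildeRk hK hx))
  rwa [star_mul, star_star, map_star, star_star] at this

/-! ### The algebra `R` and its decomposition `Ĩ + A` -/

theorem toRk_mem_RegA (hΦ : IsCanonicalEmbedding Φ) (hK : IsPositiveDefinite K) {r : S.RInf K}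
    (hr : r ∈ S.RegInf K) : toRk S K r ∈ RegA Φ := by
  refine map_mem_starRegularClosure (exists_isMoorePenrose_RInf hK) (toRk S K) ?_ hr
  rintro _ ⟨n, a, ha, -, rfl⟩
  exact subset_starRegularClosure _ ⟨a, Φ_apply hΦ ha⟩

theorem algR_le_RegA (hΦ : IsCanonicalEmbedding Φ) (hK : IsPositiveDefinite K) {n : ℕ}
    (W : S.Tower n) : algR Φ l W ≤ RegA Φ := by
  have h : Set.range Φ ⊆ (RegA Φ : Set (S.RRk K)) := subset_starRegularClosure _
  rw [algR, StarAlgebra.adjoin_le_iff]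
  rintro x ((⟨r, -, rfl⟩ | ⟨b, -, rfl⟩) | ⟨b, -, rfl⟩)
  · exact toRk_mem_RegA hΦ hK r.2
  · exact h ⟨b, rfl⟩
  · exact h ⟨b, rfl⟩

/-- Modulo `I` a function is determined by its values on the orbit, and the diagonal element of `h_W
A_M` with entries `f(T^i y)` has the same values. -/
theorem exists_sub_mem_orbitIdeal (D : OrbitData S K l M) (f : CK S.T K) :
    ∃ a ∈ S.An K M, C f - hW K (D.W M) * a ∈ orbitIdeal S K := by
  have hl := D.len_eq M le_rfl
  have hy := D.y_mem M le_rfl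
  set W := D.W M
  refine ⟨∑ i : Fin W.len, f ((S.T ^ ((i : ℕ) : ℤ)) S.y) • e K W i i,
    sum_mem fun i _ => (S.An K M).smul_mem (e_mem _ _ _) _, ?_⟩
  set a : Crossed S.T K := ∑ i : Fin W.len, f ((S.T ^ ((i : ℕ) : ℤ)) S.y) • e K W i i with ha
  have h1 : C f - a ∈ orbitIdeal S K := by
    rw [mem_orbitIdeal]
    intro p q
    have hsum : ∀ p q, ent a S.y p q = ∑ i : Fin W.len, f ((S.T ^ ((i : ℕ) : ℤ)) S.y) *
        ent (e K W i i) S.y p q := by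
      intro p q
      let F : Crossed S.T K →+ K := AddMonoidHom.mk' (fun a => ent a S.y p q)
        fun a b => ent_add a b _ _ _
      change F a = _
      rw [ha, map_sum]
      exact Finset.sum_congr rfl fun i _ => ent_smul _ _ _ _ _
    have h0 : 0 ≤ p % l := Int.emod_nonneg _ (by have := D.pos; omega)
    have hlt : p % l < W.len := by
      rw [hl]; exact Int.emod_lt_of_pos _ (by have := D.pos; omega)
    -- Periodicity reduces the row to a level `p % l` of the tower, so that only the term `i = p %
    -- l` of the sum survives.
    rw [← sub_add_cancel p (l * (p / l)), ← sub_add_cancel q (l * (p / l)), ent_y_add D.iterate,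
      show p - l * (p / l) = p % l by rw [Int.emod_def]]
    generalize q - l * (p / l) = q'
    obtain ⟨p', hp⟩ := Int.eq_ofNat_of_zero_le h0
    rw [hp] at hlt ⊢
    rw [sub_eq_add_neg, ← neg_one_smul K a, ent_add, ent_smul, hsum, ent_C,
      Finset.sum_eq_single ⟨p', by omega⟩]
    · rw [e_eq, ent_mono, shift_apply, zpow_zpow_apply, neg_add_cancel, zpow_zero,
        show (1 : X ≃ₜ X) S.y = S.y from rfl, chi_of_mem _ hy]
      simp only [sub_self, sub_eq_zero]
      split_ifs <;> ring
    · intro i _ hne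
      rw [e_eq, ent_mono, shift_apply, zpow_zpow_apply]
      split_ifs
      · rw [chi_of_notMem, mul_zero]
        intro hx
        have := W.level_unique hx hy (a := i) (b := p') (by omega) (by omega) (by omega)
          (by omega) (by rw [zpow_zpow_apply]; congr 2; ring)
        exact hne (Fin.ext (by simp only; omega))
      · rw [mul_zero]
    · exact fun h => absurd (Finset.mem_univ _) h
  have h2 : C f - hW K W * a = C f - a + (1 - hW K W) * a := by noncomm_ring
  rw [h2]
  exact add_mem h1 (TwoSidedIdeal.mul_mem_right _ _ _ (D.one_sub_hW_mem le_rfl))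

/-- Writing `f t^k` as `(f - h a) t^k + h a t^k`, with `f - h a ∈ I`, uses the three kinds of
generators of `R`. -/
theorem Φ_mem_algR (D : OrbitData S K l M) (hΦ : IsCanonicalEmbedding Φ) (hK : IsPositiveDefinite K)
    (a : Crossed S.T K) : Φ a ∈ algR Φ l (D.W M) := by
  induction a using induction_mono with
  | h k f =>
    obtain ⟨a, ha, h⟩ := D.exists_sub_mem_orbitIdeal f
    rw [← mul_one f, ← C_mul_mono, ← sub_add_cancel (C f) (hW K (D.W M) * a), map_mul, map_add]
    refine mul_mem (add_mem ?_ ?_) ?_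
    · exact StarAlgebra.subset_adjoin K _
        (Or.inl (Or.inl ((D.Φ_mem_itildeRk_iff hΦ hK _).2 h)))
    · exact StarAlgebra.subset_adjoin K _ (Or.inl (Or.inr ⟨_, ⟨a, ha, rfl⟩, rfl⟩))
    · refine StarAlgebra.subset_adjoin K _ (Or.inr ⟨_, ?_, rfl⟩)
      have := mono_one_mem_laurent (S := S) (K := K) 1 k
      rwa [Nat.cast_one, one_mul] at this
  | hadd a b ha hb => rw [map_add]; exact add_mem ha hb

/-- Since `Ĩ` absorbs multiplication by `A`, the sum `Ĩ + Φ(A)` is a `*`-subalgebra; it contains the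
generators of `R`. -/
theorem exists_of_mem_algR (D : OrbitData S K l M) (hΦ : IsCanonicalEmbedding Φ)
    (hK : IsPositiveDefinite K) {z : S.RRk K}
    (hz : z ∈ algR Φ l (D.W M)) : ∃ x ∈ S.itildeRk K l, ∃ a, z = x + Φ a := by
  have h0 : (0 : S.RRk K) ∈ S.itildeRk K l := by
    rw [← map_zero Φ, D.Φ_mem_itildeRk_iff hΦ hK]; exact zero_mem _
  let B : StarSubalgebra K (S.RRk K) :=
    { carrier := {z | ∃ x ∈ S.itildeRk K l, ∃ a, z = x + Φ a}
      mul_mem' := by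
        rintro _ _ ⟨x, hx, a, rfl⟩ ⟨z, hz, b, rfl⟩
        refine ⟨x * z + x * Φ b + Φ a * z, ?_, a * b, ?_⟩
        · exact D.add_mem_itildeRk hK (D.add_mem_itildeRk hK (D.mul_mem_itildeRk hK hx hz)
            (D.mul_Φ_mem_itildeRk hΦ hK b hx)) (D.Φ_mul_mem_itildeRk hΦ hK a hz)
        · rw [map_mul]; noncomm_ring
      add_mem' := by
        rintro _ _ ⟨x, hx, a, rfl⟩ ⟨z, hz, b, rfl⟩
        exact ⟨x + z, D.add_mem_itildeRk hK hx hz, a + b, by rw [map_add]; abel⟩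
      algebraMap_mem' := fun c => ⟨0, h0, algebraMap K _ c, by
        rw [zero_add]; exact (Φ.toAlgHom.commutes c).symm⟩
      star_mem' := by
        rintro _ ⟨x, hx, a, rfl⟩
        exact ⟨star x, D.star_mem_itildeRk hK hx, star a, by rw [star_add, map_star]⟩ }
  have hle : algR Φ l (D.W M) ≤ B := by
    rw [algR, StarAlgebra.adjoin_le_iff]
    rintro x ((hx | ⟨b, -, rfl⟩) | ⟨b, -, rfl⟩)
    · exact ⟨x, hx, 0, by rw [map_zero, add_zero]⟩
    · exact ⟨0, h0, b, (zero_add _).symm⟩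
    · exact ⟨0, h0, b, (zero_add _).symm⟩
  exact hle hz

end

end OrbitData

end ApproxSystem

end

end CrossedApprox

namespace CrossedApprox

noncomputable section

namespace ApproxSystem

variable {X : Type*} [TopologicalSpace X] [MeasurableSpace X] {S : ApproxSystem X}

open Crossed

variable {K : Type*} [Field K] [StarRing K]

/-! ### The representation of `A` over the Laurent polynomials -/

theorem zpow_y_eq_of_dvd {l : ℕ} (hy : S.T^[l] S.y = S.y) {i k : ℤ} (h : (l : ℤ) ∣ i - k) :
    (S.T ^ i) S.y = (S.T ^ k) S.y := by
  obtain ⟨q, hq⟩ := h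
  rw [show i = k + l * q by omega, zpow_y_add_mul hy]

theorem fin_eq_of_dvd {l : ℕ} {i k : Fin l} (h : (l : ℤ) ∣ (i : ℤ) - k) : i = k := by
  have := Int.eq_zero_of_abs_lt_dvd h (by rw [abs_lt]; omega)
  exact Fin.ext (by omega)

variable (S K) in
/-- The element `t^k` of `K[t^l, t^{-l}]` if `l` divides `k`, and zero otherwise. -/
def tPow (l : ℕ) (k : ℤ) : S.laurent K l :=
  open Classical in
  if h : (l : ℤ) ∣ k then
    ⟨mono k 1, by obtain ⟨q, rfl⟩ := h; exact mono_one_mem_laurent l q⟩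
  else 0

theorem tPow_of_dvd {l : ℕ} {k : ℤ} (h : (l : ℤ) ∣ k) :
    (tPow S K l k : Crossed S.T K) = mono k 1 := by rw [tPow, dif_pos h]

theorem tPow_of_not_dvd {l : ℕ} {k : ℤ} (h : ¬ (l : ℤ) ∣ k) : tPow S K l k = 0 := dif_neg h

theorem tPow_mul {l : ℕ} {k m : ℤ} (hk : (l : ℤ) ∣ k) (hm : (l : ℤ) ∣ m) :
    tPow S K l k * tPow S K l m = tPow S K l (k + m) := by
  refine Subtype.ext ?_
  rw [MulMemClass.coe_mul, tPow_of_dvd hk, tPow_of_dvd hm, tPow_of_dvd (dvd_add hk hm),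
    mono_mul_mono, one_mul, shift, smul_one]

theorem star_tPow (l : ℕ) (k : ℤ) : star (tPow S K l k) = tPow S K l (-k) := by
  by_cases h : (l : ℤ) ∣ k
  · refine Subtype.ext ?_
    rw [StarMemClass.coe_star, tPow_of_dvd h, tPow_of_dvd ((dvd_neg).2 h), star_mono, star_one,
      shift, smul_one]
  · rw [tPow_of_not_dvd h, tPow_of_not_dvd (by rwa [dvd_neg]), star_zero]

variable (S K) in
/-- The map `A → M_l(K[t^l, t^{-l}])` whose value at `f t^k` has the entries
`f(T^i y) t^{k-i+j}`, where `l ∣ k - i + j`. -/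
def orbitRepFun (l : ℕ) (a : Crossed S.T K) : Matrix (Fin l) (Fin l) (S.laurent K l) :=
  a.sum fun g f => Matrix.of fun i j =>
    f ((S.T ^ (i : ℤ)) S.y) • tPow S K l (Multiplicative.toAdd g - (i - j))

theorem orbitRepFun_mono (l : ℕ) (k : ℤ) (f : CK S.T K) (i j : Fin l) :
    orbitRepFun S K l (mono k f) i j =
      f ((S.T ^ (i : ℤ)) S.y) • tPow S K l (k - (i - j)) := by
  rw [orbitRepFun, mono, SkewMonoidAlgebra.sum_single_index]
  · rfl
  · ext i j; simp

theorem orbitRepFun_add (l : ℕ) (a b : Crossed S.T K) :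
    orbitRepFun S K l (a + b) = orbitRepFun S K l a + orbitRepFun S K l b := by
  refine SkewMonoidAlgebra.sum_add_index' (fun g => ?_) fun g f f' => ?_
  · ext i j; simp
  · ext i j; simp [add_smul]

/-- For monomials, row `i` of the matrix of `f t^k` has its only possible nonzero entry in the
column `s` congruent to `i - k` modulo `l`, so the matrix product reduces to one term. -/
theorem orbitRepFun_mul {l : ℕ} (hy : S.T^[l] S.y = S.y) (a b : Crossed S.T K) :
    orbitRepFun S K l (a * b) = orbitRepFun S K l a * orbitRepFun S K l b := by
  induction a using induction_mono with
  | hadd a a' ha ha' => rw [add_mul, orbitRepFun_add, ha, ha', orbitRepFun_add, add_mul]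
  | h k f =>
    induction b using induction_mono with
    | hadd b b' hb hb' => rw [mul_add, orbitRepFun_add, hb, hb', orbitRepFun_add, mul_add]
    | h m g =>
      ext1 i j
      have hl : (l : ℤ) ≠ 0 := by have := i.2; omega
      obtain ⟨s, hs⟩ := Int.eq_ofNat_of_zero_le (Int.emod_nonneg (i - k) hl)
      have hlt := Int.emod_lt_of_pos (i - k : ℤ) (by omega : 0 < (l : ℤ))
      have hd : (l : ℤ) ∣ i - k - s := by rw [← hs]; exact Int.dvd_self_sub_emod
      rw [Matrix.mul_apply, Finset.sum_eq_single ⟨s, by omega⟩, mono_mul_mono,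
        orbitRepFun_mono, orbitRepFun_mono, orbitRepFun_mono, CK.mul_apply, shift_apply,
        zpow_zpow_apply, smul_mul_smul_comm]
      · simp only
        rw [zpow_y_eq_of_dvd hy (show (l : ℤ) ∣ -k + i - s by
          rwa [show -k + (i : ℤ) - s = i - k - s by ring])]
        -- If `l` does not divide this exponent, it does not divide the total exponent either, since
        -- `l ∣ i - k - s`; both sides are then zero.
        by_cases hm : (l : ℤ) ∣ m - (s - j)
        · rw [tPow_mul _ hm]
          · congr 2; ring
          · rwa [show k - ((i : ℤ) - s) = -(i - k - s) by ring, dvd_neg]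
        · rw [tPow_of_not_dvd hm, mul_zero, tPow_of_not_dvd]
          intro h
          refine hm ?_
          rw [show m - ((s : ℤ) - j) = (k + m - (i - j)) + (i - k - s) by ring]
          exact dvd_add h hd
      · intro s' _ hne
        rw [orbitRepFun_mono, tPow_of_not_dvd, smul_zero, zero_mul]
        intro h
        refine hne (fin_eq_of_dvd ?_)
        rw [show ((s' : ℤ) - ((⟨s, by omega⟩ : Fin l) : ℕ)) = k - (i - s') + (i - k - s) by
          simp only; ring]
        exact dvd_add h hd
      · exact fun h => absurd (Finset.mem_univ _) h

theorem orbitRepFun_one (l : ℕ) : orbitRepFun S K l 1 = 1 := by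
  ext1 i j
  rw [one_eq_mono, orbitRepFun_mono, CK.one_apply, one_smul]
  by_cases h : i = j
  · subst h
    refine Subtype.ext ?_
    rw [tPow_of_dvd (by simp), Matrix.one_apply_eq, OneMemClass.coe_one, one_eq_mono]
    simp
  · rw [Matrix.one_apply_ne h, tPow_of_not_dvd]
    rw [zero_sub, dvd_neg]
    exact fun hd => h (fin_eq_of_dvd hd)

theorem orbitRepFun_smul (l : ℕ) (c : K) (a : Crossed S.T K) :
    orbitRepFun S K l (c • a) = c • orbitRepFun S K l a := by
  induction a using induction_mono with
  | hadd a a' ha ha' => rw [smul_add, orbitRepFun_add, ha, ha', orbitRepFun_add, smul_add]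
  | h k f =>
    ext1 i j
    rw [← mono_smul, Matrix.smul_apply, orbitRepFun_mono, orbitRepFun_mono, CK.smul_apply, mul_smul]

theorem orbitRepFun_star {l : ℕ} (hy : S.T^[l] S.y = S.y) (a : Crossed S.T K) :
    orbitRepFun S K l (star a) = star (orbitRepFun S K l a) := by
  induction a using induction_mono with
  | hadd a a' ha ha' => rw [star_add, orbitRepFun_add, ha, ha', orbitRepFun_add, star_add]
  | h k f =>
    ext1 i j
    rw [star_mono, orbitRepFun_mono, Matrix.star_apply, orbitRepFun_mono, star_smul, star_tPow,
      shift_apply, zpow_zpow_apply, CK.star_apply,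
      show -(k - ((j : ℤ) - i)) = -k - (i - j) by ring]
    by_cases h : (l : ℤ) ∣ -k - (i - j)
    · rw [zpow_y_eq_of_dvd hy (show (l : ℤ) ∣ k + i - j by
        rwa [show k + (i : ℤ) - j = -(-k - (i - j)) by ring, dvd_neg])]
    · rw [tPow_of_not_dvd h, smul_zero, smul_zero]

variable (K) in
/-- The representation `A → M_l(K[t^l, t^{-l}])` on the orbit of a point of period `l`. -/
def orbitRep {l : ℕ} (hy : S.T^[l] S.y = S.y) :
    Crossed S.T K →⋆ₐ[K] Matrix (Fin l) (Fin l) (S.laurent K l) where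
  toFun := orbitRepFun S K l
  map_one' := orbitRepFun_one l
  map_mul' := orbitRepFun_mul hy
  map_zero' := by simpa using orbitRepFun_smul l (0 : K) (0 : Crossed S.T K)
  map_add' := orbitRepFun_add l
  commutes' c := by
    rw [Algebra.algebraMap_eq_smul_one, orbitRepFun_smul, orbitRepFun_one,
      ← Algebra.algebraMap_eq_smul_one]
  map_star' := orbitRepFun_star hy

/-- The coefficients of the Laurent polynomial in position `(i, j)` are the entries of the orbit
matrix at `y` in row `i` and the columns congruent to `j`. No information about the orbit matrix is
lost. -/
theorem ent_orbitRepFun {l : ℕ} (a : Crossed S.T K) (i j : Fin l) (x : X) (p q : ℤ)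
    [Decidable ((l : ℤ) ∣ p - q)] :
    ent (orbitRepFun S K l a i j : Crossed S.T K) x p q =
      if (l : ℤ) ∣ p - q then ent a S.y i (j - (p - q)) else 0 := by
  induction a using induction_mono with
  | hadd a a' ha ha' =>
    rw [orbitRepFun_add, Matrix.add_apply, AddMemClass.coe_add, ent_add, ha, ha', ent_add]
    split_ifs
    · rfl
    · exact add_zero 0
  | h k f =>
    rw [orbitRepFun_mono, SetLike.val_smul, ent_smul, ent_mono]
    by_cases hk : (l : ℤ) ∣ k - (i - j)
    · rw [tPow_of_dvd hk, ent_mono]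
      by_cases e : p - q = k - (i - j)
      · rw [if_pos e, if_pos (e ▸ hk), if_pos (by omega), CK.one_apply, mul_one]
      · rw [if_neg e, if_neg (show ¬ (i : ℤ) - (j - (p - q)) = k by omega), mul_zero, ite_self]
    · rw [tPow_of_not_dvd hk, ZeroMemClass.coe_zero, ent_zero, mul_zero]
      split_ifs with h e
      · exact absurd (by rwa [show k - ((i : ℤ) - j) = p - q by omega]) hk
      · rfl
      · rfl

theorem orbitRep_eq_zero_iff {l : ℕ} (hl : 0 < l) (hy : S.T^[l] S.y = S.y) (a : Crossed S.T K) :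
    orbitRep K hy a = 0 ↔ a ∈ orbitIdeal S K := by
  change orbitRepFun S K l a = 0 ↔ _
  rw [mem_orbitIdeal]
  constructor
  · intro h p q
    obtain ⟨i, hi⟩ := Int.eq_ofNat_of_zero_le (Int.emod_nonneg p (by omega : (l : ℤ) ≠ 0))
    have hi' := Int.emod_lt_of_pos p (by omega : 0 < (l : ℤ))
    obtain ⟨j, hj⟩ := Int.eq_ofNat_of_zero_le (Int.emod_nonneg q (by omega : (l : ℤ) ≠ 0))
    have hj' := Int.emod_lt_of_pos q (by omega : 0 < (l : ℤ))
    have hp := Int.emod_add_mul_ediv p l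
    have hq := Int.emod_add_mul_ediv q l
    rw [hi] at hp hi'
    rw [hj] at hq hj'
    -- Splitting `p` and `q` into residues `i, j` and multiples of `l`, the exponent `l(p/l) -
    -- l(q/l)` selects the entry `(p, q)`, up to a translation by a period.
    have := ent_orbitRepFun (l := l) a ⟨i, by omega⟩ ⟨j, by omega⟩ S.y
      (l * (p / l)) (l * (q / l))
    rw [if_pos (dvd_sub (dvd_mul_right _ _) (dvd_mul_right _ _)), h, Matrix.zero_apply, ZeroMemClass.coe_zero, ent_zero] at this
    rw [← ent_y_add hy a _ _ (p / l)] at this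
    rw [this]
    congr 1
    · exact hp.symm
    · simp only
      omega
  · intro h
    ext1 i j
    refine Subtype.ext (ext_ent fun x p q => ?_)
    rw [ent_orbitRepFun, h, ite_self, Matrix.zero_apply, ZeroMemClass.coe_zero, ent_zero]

/-- Among `y, …, T^{l-1} y` only `T^i y` lies in level `i` of the tower, so the matrix of `χ_{T^i W}
t^{k+i-j}` has a single nonzero row, and in it a single nonzero entry. -/
theorem orbitRepFun_eq_single {n l : ℕ} {W : S.Tower n} (hW : W.len = l) (hWy : S.y ∈ W.base)
    (i j : Fin l) {k : ℤ} (hk : (l : ℤ) ∣ k) :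
    orbitRepFun S K l (mono (k + (i - j)) (shift (-i) (chi S.T K W.isClopen))) =
      Matrix.single i j (tPow S K l k) := by
  ext1 i' j'
  rw [orbitRepFun_mono, shift_apply, zpow_zpow_apply]
  by_cases hi : i = i'
  · subst hi
    rw [neg_add_cancel, zpow_zero, show (1 : X ≃ₜ X) S.y = S.y from rfl, chi_of_mem _ hWy, one_smul]
    by_cases hj : j = j'
    · subst hj
      rw [Matrix.single_apply_same, add_sub_cancel_right]
    · rw [Matrix.single_apply_of_ne _ _ _ _ _ fun h => hj h.2, tPow_of_not_dvd]
      intro h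
      refine hj (fin_eq_of_dvd ?_).symm
      rw [show (j' : ℤ) - j = k + (i - j) - (i - j') - k by ring]
      exact dvd_sub h hk
  · rw [Matrix.single_apply_of_ne _ _ _ _ _ fun h => hi h.1, chi_of_notMem, zero_smul]
    intro hx
    have := W.level_unique hx hWy (a := i) (b := i') (by omega) (by omega) (by omega) (by omega)
      (by rw [zpow_zpow_apply]; congr 2; ring)
    exact hi (Fin.ext (by omega))

theorem exists_orbitRep_eq_single {n l : ℕ} (hy : S.T^[l] S.y = S.y) {W : S.Tower n}
    (hW : W.len = l) (hWy : S.y ∈ W.base) (z : S.laurent K l) (i j : Fin l) :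
    ∃ a, orbitRep K hy a = Matrix.single i j z := by
  obtain ⟨z, hz⟩ := z
  -- The position must vary in the induction: a product is realised as `E_{ii} E_{ij}`, and the
  -- adjoint exchanges `i` and `j`.
  induction hz using StarAlgebra.adjoin_induction generalizing i j with
  | mem z hz =>
    obtain rfl : z = t S.T K ^ l := hz
    refine ⟨_, (orbitRepFun_eq_single hW hWy i j (dvd_refl (l : ℤ))).trans ?_⟩
    congr 1
    exact Subtype.ext ((tPow_of_dvd dvd_rfl).trans (t_pow l).symm)
  | algebraMap c =>
    refine ⟨c • _, (orbitRepFun_smul l c _).trans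
      ((congrArg (c • ·) (orbitRepFun_eq_single hW hWy i j (dvd_zero (l : ℤ)))).trans ?_)⟩
    simp only [Matrix.smul_single]
    congr 1
    refine Subtype.ext ?_
    rw [SetLike.val_smul, tPow_of_dvd (dvd_zero _), ← one_eq_mono]
    exact (Algebra.algebraMap_eq_smul_one c).symm
  | add z w hz hw h1 h2 =>
    obtain ⟨a, ha⟩ := h1 i j
    obtain ⟨b, hb⟩ := h2 i j
    exact ⟨a + b, by rw [map_add, ha, hb, ← Matrix.single_add]; rfl⟩
  | mul z w hz hw h1 h2 =>
    obtain ⟨a, ha⟩ := h1 i i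
    obtain ⟨b, hb⟩ := h2 i j
    exact ⟨a * b, by rw [map_mul, ha, hb, Matrix.single_mul_single_same]; rfl⟩
  | star z hz h1 =>
    obtain ⟨a, ha⟩ := h1 j i
    refine ⟨star a, ?_⟩
    rw [map_star, ha, Matrix.star_eq_conjTranspose, Matrix.conjTranspose_single]
    rfl

theorem orbitRep_surjective {n l : ℕ} (hy : S.T^[l] S.y = S.y) {W : S.Tower n}
    (hW : W.len = l) (hWy : S.y ∈ W.base) : Function.Surjective (orbitRep K hy) := by
  intro N
  choose a ha using fun i j => exists_orbitRep_eq_single hy hW hWy (N i j) i j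
  refine ⟨∑ i, ∑ j, a i j, ?_⟩
  simp only [map_sum, ha]
  exact (Matrix.matrix_eq_sum_single N).symm

/-! ### The quotient `R/Ĩ` -/

namespace OrbitData

variable {l M : ℕ} [CompactSpace X] {Φ : Crossed S.T K →⋆ₐ[K] S.RRk K}

/-- `Ĩ`, as an ideal of `R`. -/
def itildeIdeal (D : OrbitData S K l M) (hΦ : IsCanonicalEmbedding Φ) (hK : IsPositiveDefinite K) :
    TwoSidedIdeal (algR Φ l (D.W M)) :=
  TwoSidedIdeal.mk' {r | (r : S.RRk K) ∈ S.itildeRk K l}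
    (by
      have := (D.Φ_mem_itildeRk_iff hΦ hK 0).2 (zero_mem _)
      rwa [map_zero] at this)
    (fun h h' => D.add_mem_itildeRk hK h h')
    (fun {x} h => by
      have := D.Φ_mul_mem_itildeRk hΦ hK (-1) h
      rwa [map_neg, map_one, neg_one_mul] at this)
    (fun {x z} h => by
      obtain ⟨w, hw, a, e⟩ := D.exists_of_mem_algR hΦ hK x.2
      change (x : S.RRk K) * z ∈ S.itildeRk K l
      rw [e, add_mul]
      exact D.add_mem_itildeRk hK (D.mul_mem_itildeRk hK hw h) (D.Φ_mul_mem_itildeRk hΦ hK a h))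
    (fun {z x} h => by
      obtain ⟨w, hw, a, e⟩ := D.exists_of_mem_algR hΦ hK x.2
      change (z : S.RRk K) * x ∈ S.itildeRk K l
      rw [e, mul_add]
      exact D.add_mem_itildeRk hK (D.mul_mem_itildeRk hK h hw) (D.mul_Φ_mem_itildeRk hΦ hK a h))

theorem mem_itildeIdeal (D : OrbitData S K l M) (hΦ : IsCanonicalEmbedding Φ)
    (hK : IsPositiveDefinite K) (r : algR Φ l (D.W M)) :
    r ∈ D.itildeIdeal hΦ hK ↔ (r : S.RRk K) ∈ S.itildeRk K l :=
  TwoSidedIdeal.mem_mk' _ _ _ _ _ _ _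

theorem exists_quotient_itildeIdeal_equiv (D : OrbitData S K l M) (hΦ : IsCanonicalEmbedding Φ)
    (hK : IsPositiveDefinite K) :
    ∃ ψ : (D.itildeIdeal hΦ hK).ringCon.Quotient ≃ₐ[K] Matrix (Fin l) (Fin l) (S.laurent K l),
      ∀ r : algR Φ l (D.W M), ψ ((star r : algR Φ l (D.W M))) = star (ψ r) := by
  let q : algR Φ l (D.W M) →ₐ[K] (D.itildeIdeal hΦ hK).ringCon.Quotient := RingCon.mkₐ K _
  let f : Crossed S.T K →ₐ[K] (D.itildeIdeal hΦ hK).ringCon.Quotient :=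
    q.comp (Φ.toAlgHom.codRestrict (algR Φ l (D.W M)).toSubalgebra (D.Φ_mem_algR hΦ hK))
  have hq : ∀ r s : algR Φ l (D.W M), q r = q s ↔ (r - s : S.RRk K) ∈ S.itildeRk K l := by
    intro r s
    rw [← sub_eq_zero, ← map_sub]
    refine Iff.trans ?_ (D.mem_itildeIdeal hΦ hK (r - s))
    rw [TwoSidedIdeal.mem_iff]
    exact RingCon.eq _
  -- The same `a` represents `r` and, after taking adjoints, `star r`; this transports the
  -- involution through `ψ`.
  have hf : ∀ r : algR Φ l (D.W M), ∃ a, q r = f a ∧ q (star r) = f (star a) := by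
    intro r
    obtain ⟨x, hx, a, e⟩ := D.exists_of_mem_algR hΦ hK r.2
    refine ⟨a, (hq _ _).2 ?_, (hq _ _).2 ?_⟩
    · change (r : S.RRk K) - Φ a ∈ S.itildeRk K l
      rwa [e, add_sub_cancel_right]
    · change star (r : S.RRk K) - Φ (star a) ∈ S.itildeRk K l
      rw [e, star_add, map_star, add_sub_cancel_right]
      exact D.star_mem_itildeRk hK hx
  -- Both `A → R/Ĩ` and the orbit representation are onto, and both have kernel `I`.
  obtain ⟨ψ, hψ⟩ := exists_algEquiv_of_surjective f (orbitRep K D.iterate).toAlgHom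
    (fun z => by
      obtain ⟨r, rfl⟩ := RingCon.mkₐ_surjective (α := K) _ z
      obtain ⟨a, ha, -⟩ := hf r
      exact ⟨a, ha.symm⟩)
    (orbitRep_surjective D.iterate (D.len_eq M le_rfl) (D.y_mem M le_rfl)) fun a => by
      refine Iff.trans ?_ (orbitRep_eq_zero_iff D.pos D.iterate a).symm
      rw [← D.Φ_mem_itildeRk_iff hΦ hK, ← map_zero q]
      refine (hq _ _).trans ?_
      rw [ZeroMemClass.coe_zero, sub_zero]
      rfl
  refine ⟨ψ, fun r => ?_⟩
  obtain ⟨a, h1, h2⟩ := hf r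
  change ψ (q (star r)) = star (ψ (q r))
  rw [h1, h2, hψ, hψ]
  exact map_star (orbitRep K D.iterate) a

end OrbitData

end ApproxSystem

end

end CrossedApprox

/-! ### The proposition -/

open CrossedApprox ApproxSystem Crossed in
theorem mainTheorem3
    {X : Type*} [TopologicalSpace X] [CompactSpace X] [TopologicalSpace.MetrizableSpace X]
    [TotallyDisconnectedSpace X] [Infinite X] [MeasurableSpace X] [BorelSpace X]
    (S : ApproxSystem X)
    {K : Type*} [Field K] [StarRing K]
    (hK : ∀ (N : ℕ) (c : Fin N → K), ∑ i, star (c i) * c i = 0 → ∀ i, c i = 0)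
    (l : ℕ) (hl : 0 < l) (hy : Function.minimalPeriod S.T S.y = l) :
    -- the data on which the claim rests: `A` embeds in `𝕽_rk`, `I ⊆ A_∞`, and `M` exists
    (∃ Φ : Crossed S.T K →⋆ₐ[K] S.RRk K, IsCanonicalEmbedding Φ) ∧
    (∀ a ∈ S.idealI K l, a ∈ S.AInf K) ∧
    (∃ M : ℕ, ∀ n ≥ M, ∃! W : S.Tower n, W.len = l ∧ S.y ∈ W.base) ∧
    ∀ Φ : Crossed S.T K →⋆ₐ[K] S.RRk K, IsCanonicalEmbedding Φ →
    ∀ (M : ℕ) (W : ∀ n, S.Tower n), (∀ n ≥ M, (W n).len = l ∧ S.y ∈ (W n).base) →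
      -- (i)
      ({x : S.RInf K | ∃ r ∈ S.idealItilde K l, x = r} =
        {x | ∃ n ≥ M, ∃ r ∈ S.RegN K n, x = S.iota K n ((1 - S.piN K n (hW K (W n))) * r)}) ∧
      (∃ φ : (S.idealItilde K l).ringCon.Quotient ≃ₐ[K] Matrix (Fin l) (Fin l) K,
        ∀ r : S.RegInf K, φ ((star r : S.RegInf K)) = star (φ r)) ∧
      -- (ii)
      algR Φ l (W M) ≤ RegA Φ ∧
      (∀ a : Crossed S.T K, Φ a ∈ algR Φ l (W M)) ∧
      ∃ J : TwoSidedIdeal (algR Φ l (W M)),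
        (∀ r : algR Φ l (W M), r ∈ J ↔ (r : S.RRk K) ∈ S.itildeRk K l) ∧
        ∃ ψ : J.ringCon.Quotient ≃ₐ[K] Matrix (Fin l) (Fin l) (S.laurent K l),
          ∀ r : algR Φ l (W M), ψ ((star r : algR Φ l (W M))) = star (ψ r) := by
  have : SecondCountableTopology X := by
    let := TopologicalSpace.metrizableSpaceMetric X
    infer_instance
  have hper : S.T^[l] S.y = S.y := hy ▸ Function.iterate_minimalPeriod
  refine ⟨exists_isCanonicalEmbedding (tendsto_measure_E hl hper), fun a ha => ?_,
    exists_tower_y hl hy, fun Φ hΦ M W hW => ?_⟩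
  · rw [idealI_eq hl hper] at ha
    obtain ⟨N, hN⟩ := mem_An_of_mem_orbitIdeal ha
    exact Set.mem_iUnion.2 ⟨N, hN N le_rfl⟩
  · obtain ⟨θ, hθ⟩ := exists_character (K := K) W hW
    -- Only the towers with `n ≥ M` are constrained; the values of `W` below `M` play no role.
    let D : OrbitData S K l M :=
      ⟨hl, hy, W, fun n hn => (hW n hn).1, fun n hn => (hW n hn).2, θ, hθ⟩
    exact ⟨D.idealItilde_eq hK, D.exists_quotient_equiv hK, OrbitData.algR_le_RegA hΦ hK (W M),
      D.Φ_mem_algR hΦ hK, D.itildeIdeal hΦ hK, D.mem_itildeIdeal hΦ hK,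
      D.exists_quotient_itildeIdeal_equiv hΦ hK⟩
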